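/- Let $(N,h)$ be a connected smooth Riemannian manifold (finite-dimensional, Hausdorff, second countable, without boundary) with $\dim N\ge 1$. Let $\pi:E\to N$ be a smooth real vector bundle of finite rank with a smooth bundle metric $\kappa$, and let $\nabla$ be a smooth connection on $E$ that is metric, i.e. $X(Y_1,Y_2)_\kappa=(\nabla_XY_1,Y_2)_\kappa+(Y_1,\nabla_XY_2)_\kappa$ for all smooth vector fields $X$ on $N$ and smooth sections $Y_1,Y_2$ of $E$. For $\xi\in T_eE$ choose a smooth curve $\alpha$ in $E$ with $\alpha'(0)=\xi$ and let $K_E(\xi):=\frac{D\alpha}{dt}(0)\in E_{\pi(e)}$, where $\frac{D}{dt}$ is the covariant derivative along $\pi\circ\alpha$ determined by $\nabla$. The Sasaki metric $\sigma$ is the Riemannian metric on the manifold $E$ given by $$(\xi_1,\xi_2)_\sigma=(d\pi(\xi_1),d\pi(\xi_2))_h+(K_E(\xi_1),K_E(\xi_2))_\kappa,\qquad \xi_1,\xi_2\in T_eE,$$ and the Sasaki distance $d_\sigma$ is its Riemannian distance, the infimum of the $\sigma$-lengths of $C^1$ curves in $E$ joining two points. Then for all $q_1,q_2\in N$, $e_1\in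 E_{q_1}$ and $e_2\in E_{q_2}$ the distance $d_\sigma(e_1,e_2)$ is finite and $$d_\sigma(e_1,e_2)^2=\inf_\gamma\left(|e_1-P^\gamma(e_2)|_\kappa^2+\Big(\int_0^1|\gamma'|_h\,dt\Big)^2\right),$$ where the infimum is taken over all piecewise regular curves $\gamma:[0,1]\to N$ with $\gamma(0)=q_1$ and $\gamma(1)=q_2$ (continuous curves for which $[0,1]$ has a finite subdivision into closed intervals on each of which $\gamma$ is smooth with nowhere vanishing velocity), and $P^\gamma:E_{q_2}\to E_{q_1}$ is parallel transport along $\gamma$ with respect to $\nabla$: $P^\gamma(e_2)=X(0)$ for the parallel section $X$ of $E$ along $\gamma$ with $X(1)=e_2$. -/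

import Mathlib

open Bundle Set Manifold
open scoped ContDiff Topology ENNReal

noncomputable section SasakiDefinitions

namespace Sasaki

variable {B : Type*} [NormedAddCommGroup B] [NormedSpace ℝ B]
  {H : Type*} [TopologicalSpace H] {I : ModelWithCorners ℝ B H}
  {N : Type*} [TopologicalSpace N] [ChartedSpace H N]
  {F : Type*} [NormedAddCommGroup F] [NormedSpace ℝ F]
  {V : N → Type*} [TopologicalSpace (TotalSpace F V)]
  [∀ x, NormedAddCommGroup (V x)] [∀ x, InnerProductSpace ℝ (V x)]
  [FiberBundle F V] [VectorBundle ℝ F V]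

variable (I F V) in
/-- The differential `dπ : T_p E → T_{π p} N` of the bundle projection `π : E → N`, where
`E = TotalSpace F V` is the total space. -/
def dproj (p : TotalSpace F V) :
    TangentSpace (I.prod 𝓘(ℝ, F)) p →L[ℝ] TangentSpace I p.proj :=
  mfderiv (I.prod 𝓘(ℝ, F)) I (TotalSpace.proj : TotalSpace F V → N) p

variable (I F V) in
/-- The differential at `p` of the fibre coordinate `E → F` in the trivialization `φ` of the
bundle around `π p`. -/
def dfibre (p : TotalSpace F V) : TangentSpace (I.prod 𝓘(ℝ, F)) p →L[ℝ] F :=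
  mfderiv (I.prod 𝓘(ℝ, F)) 𝓘(ℝ, F)
    (fun z : TotalSpace F V ↦ (trivializationAt F V p.proj z).2) p

/-- The connector operator `K : T_p E → E_{π p}` of a connection `∇` (Mathlib's `cov Y q v` is
`(∇_v Y)(q)`). In the trivialization `φ` around `q = π p`, a curve
`α` in `E` with `α' 0 = ξ` is `α t = ∑ i, a i t • s i (γ t)`, where `γ = π ∘ α` and the `s i` are the
sections that are constant in `φ`, so that by linearity and the Leibniz rule
`Dα/dt = ∑ i, a i' • s i + ∑ i, a i • ∇_{γ'} s i`. The first sum is the vector of `E_q` whose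
coordinate in `φ` is the derivative of the fibre coordinate along `ξ`; the second one is
`∇_{dπ ξ} s`, where `s = FiberBundle.extend F p.2` is the section through `p` that is constant
in `φ`. -/
def connector (cov : CovariantDerivative I F V) (p : TotalSpace F V) :
    TangentSpace (I.prod 𝓘(ℝ, F)) p →L[ℝ] V p.proj :=
  (trivializationAt F V p.proj).symmL ℝ p.proj ∘L dfibre I F V p
    + cov (FiberBundle.extend F p.2) p.proj ∘L dproj I F V p

/-- The covariant derivative `Dα/dt` at time `t` of a curve `α` in the total space, i.e. of
the section `α` along the base curve `π ∘ α`. -/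
def covDerivAlong (cov : CovariantDerivative I F V) (α : ℝ → TotalSpace F V) (t : ℝ) :
    V (α t).proj :=
  connector cov (α t) (mfderiv 𝓘(ℝ, ℝ) (I.prod 𝓘(ℝ, F)) α t (1 : ℝ))

section helpers

variable [ContMDiffVectorBundle 1 F V I]

theorem mdifferentiableAt_fibre (p z : TotalSpace F V)
    (hz : z.proj ∈ (trivializationAt F V p.proj).baseSet) :
    MDifferentiableAt (I.prod 𝓘(ℝ, F)) 𝓘(ℝ, F)
      (fun z : TotalSpace F V ↦ (trivializationAt F V p.proj z).2) z := by
  have h := (trivializationAt F V p.proj).contMDiffOn (IB := I) (n := 1)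
  have hz' : z ∈ (trivializationAt F V p.proj).source := by
    rwa [Trivialization.mem_source]
  have h2 := (h.contMDiffAt ((trivializationAt F V p.proj).open_source.mem_nhds hz')).mdifferentiableAt
    one_ne_zero
  exact h2.snd

/-- The connector is characterized by `K (dY v) = ∇_v Y`. -/
theorem connector_mfderiv_section [FiniteDimensional ℝ F] (cov : CovariantDerivative I F V)
    {Y : ∀ x, V x} {q : N}
    (hY : MDifferentiableAt I (I.prod 𝓘(ℝ, F)) (fun x ↦ TotalSpace.mk' F x (Y x)) q)
    (v : TangentSpace I q) :
    connector cov ⟨q, Y q⟩ (mfderiv I (I.prod 𝓘(ℝ, F)) (fun x ↦ TotalSpace.mk' F x (Y x)) q v)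
      = cov Y q v := by
  set e := trivializationAt F V q with he
  have hq : q ∈ e.baseSet := FiberBundle.mem_baseSet_trivializationAt' q
  let c (σ : ∀ x, V x) (x : N) : F := (e ⟨x, σ x⟩).2
  -- the difference of `∇` and of the flat connection of the trivialization is tensorial
  let Φ (σ : ∀ x, V x) : TangentSpace I q →L[ℝ] V q :=
    cov σ q - e.symmL ℝ q ∘L mvfderiv I (c σ) q
  have hc {σ : ∀ x, V x}
      (hσ : MDifferentiableAt I (I.prod 𝓘(ℝ, F)) (fun x ↦ TotalSpace.mk' F x (σ x)) q) :
      MDifferentiableAt I 𝓘(ℝ, F) (c σ) q := (mdifferentiableAt_section _ σ).1 hσ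
  have hlin {x : N} (hx : x ∈ e.baseSet) (w : V x) :
      (e ⟨x, w⟩).2 = e.continuousLinearMapAt ℝ x w := by
    rw [e.continuousLinearMapAt_apply (R := ℝ), e.coe_linearMapAt_of_mem hx]
  have hcq (σ : ∀ x, V x) : e.symmL ℝ q (c σ q) = σ q := by
    change e.symmL ℝ q (e ⟨q, σ q⟩).2 = σ q
    rw [hlin hq, e.symmL_continuousLinearMapAt hq]
  have hΦ : TensorialAt I F Φ q := by
    constructor
    · intro f σ hf hσ
      have h1 : mvfderiv I (c (f • σ)) q = mvfderiv I (f • c σ) q := by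
        have : c (f • σ) =ᶠ[𝓝 q] f • c σ := by
          filter_upwards [e.open_baseSet.mem_nhds hq] with x hx
          change (e ⟨x, f x • σ x⟩).2 = f x • (e ⟨x, σ x⟩).2
          rw [hlin hx, hlin hx, map_smul]
        ext w
        change mfderiv I 𝓘(ℝ, F) (c (f • σ)) q w = mfderiv I 𝓘(ℝ, F) (f • c σ) q w
        rw [this.mfderiv_eq]
        rfl
      ext w
      simp only [Φ, h1, cov.isCovariantDerivativeOn.leibniz hσ hf, mvfderiv_smul hf (hc hσ)]
      simp [hcq, smul_sub]
    · intro σ σ' hσ hσ'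
      have h1 : mvfderiv I (c (σ + σ')) q = mvfderiv I (c σ + c σ') q := by
        have : c (σ + σ') =ᶠ[𝓝 q] c σ + c σ' := by
          filter_upwards [e.open_baseSet.mem_nhds hq] with x hx
          change (e ⟨x, σ x + σ' x⟩).2 = (e ⟨x, σ x⟩).2 + (e ⟨x, σ' x⟩).2
          rw [hlin hx, hlin hx, hlin hx, map_add]
        ext w
        change mfderiv I 𝓘(ℝ, F) (c (σ + σ')) q w = mfderiv I 𝓘(ℝ, F) (c σ + c σ') q w
        rw [this.mfderiv_eq]
        rfl
      ext w
      simp only [Φ, h1, cov.isCovariantDerivativeOn.add hσ hσ', mvfderiv_add (hc hσ) (hc hσ')]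
      simp
      abel
  have hext : mvfderiv I (c (FiberBundle.extend F (Y q))) q = 0 := by
    have : c (FiberBundle.extend F (Y q)) =ᶠ[𝓝 q] fun _ ↦ (e ⟨q, Y q⟩).2 := by
      filter_upwards [e.open_baseSet.mem_nhds hq] with x hx
      change (e ⟨x, e.symm x (e ⟨q, Y q⟩).2⟩).2 = _
      rw [e.apply_mk_symm hx]
    ext w
    change mfderiv I 𝓘(ℝ, F) (c (FiberBundle.extend F (Y q))) q w = 0
    rw [this.mfderiv_eq, mfderiv_const]
    rfl
  have hmain := hΦ.pointwise hY (FiberBundle.mdifferentiableAt_extend I F (Y q))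
    (FiberBundle.extend_apply_self F (Y q)).symm
  have hmain' := congrArg (fun L ↦ L v) hmain
  simp only [Φ, hext, ContinuousLinearMap.comp_zero, sub_zero] at hmain'
  have h1 : dproj I F V ⟨q, Y q⟩
      (mfderiv I (I.prod 𝓘(ℝ, F)) (fun x ↦ TotalSpace.mk' F x (Y x)) q v) = v := by
    have := mfderiv_comp (I := I) (I' := I.prod 𝓘(ℝ, F)) (I'' := I) q
      (g := (TotalSpace.proj : TotalSpace F V → N)) (f := fun x ↦ TotalSpace.mk' F x (Y x))
      (mdifferentiableAt_proj V) hY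
    have h2 : mfderiv I I ((TotalSpace.proj : TotalSpace F V → N) ∘
      fun x ↦ TotalSpace.mk' F x (Y x)) q v = v := by
      change mfderiv I I id q v = v
      rw [mfderiv_id]; rfl
    rw [this] at h2
    exact h2
  have h2 : dfibre I F V ⟨q, Y q⟩
      (mfderiv I (I.prod 𝓘(ℝ, F)) (fun x ↦ TotalSpace.mk' F x (Y x)) q v)
      = mvfderiv I (c Y) q v := by
    have := mfderiv_comp (I := I) (I' := I.prod 𝓘(ℝ, F)) (I'' := 𝓘(ℝ, F)) q
      (g := fun z : TotalSpace F V ↦ (e z).2) (f := fun x ↦ TotalSpace.mk' F x (Y x))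
      (mdifferentiableAt_fibre ⟨q, Y q⟩ ⟨q, Y q⟩ hq) hY
    exact (congrArg (fun L ↦ L v) this).symm
  change e.symmL ℝ q (dfibre I F V ⟨q, Y q⟩ _) + cov (FiberBundle.extend F (Y q)) q
    (dproj I F V ⟨q, Y q⟩ _) = _
  rw [h1, h2, ← hmain']
  simp

theorem eq_zero_of_dproj_of_connector (cov : CovariantDerivative I F V) (p : TotalSpace F V)
    (ξ : TangentSpace (I.prod 𝓘(ℝ, F)) p) (h1 : dproj I F V p ξ = 0)
    (h2 : connector cov p ξ = 0) : ξ = 0 := by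
  set e := trivializationAt F V p.proj with he
  have hb : p.proj ∈ e.baseSet := FiberBundle.mem_baseSet_trivializationAt' p.proj
  have hp : p ∈ e.source := by rwa [Trivialization.mem_source]
  have h3 : dfibre I F V p ξ = 0 := by
    have h4 : e.symmL ℝ p.proj (dfibre I F V p ξ) = 0 := by
      have : connector cov p ξ = e.symmL ℝ p.proj (dfibre I F V p ξ)
        + cov (FiberBundle.extend F p.2) p.proj (dproj I F V p ξ) := rfl
      rw [this, h1, map_zero, add_zero] at h2
      exact h2
    have := congrArg (e.continuousLinearMapAt ℝ p.proj) h4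
    rwa [Trivialization.continuousLinearMapAt_symmL _ hb, map_zero] at this
  have hd : MDifferentiableAt (I.prod 𝓘(ℝ, F)) (I.prod 𝓘(ℝ, F)) e p :=
    ((e.contMDiffOn (IB := I) (n := 1)).contMDiffAt (e.open_source.mem_nhds hp)).mdifferentiableAt
      one_ne_zero
  have hds : MDifferentiableAt (I.prod 𝓘(ℝ, F)) (I.prod 𝓘(ℝ, F)) e.toOpenPartialHomeomorph.symm
      (e p) :=
    ((e.contMDiffOn_symm (IB := I) (n := 1)).contMDiffAt
      (e.open_target.mem_nhds (e.map_source hp))).mdifferentiableAt one_ne_zero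
  have hid : mfderiv (I.prod 𝓘(ℝ, F)) (I.prod 𝓘(ℝ, F)) (e.toOpenPartialHomeomorph.symm ∘ e) p
      = ContinuousLinearMap.id ℝ _ := by
    rw [← mfderiv_id]
    apply Filter.EventuallyEq.mfderiv_eq
    filter_upwards [e.open_source.mem_nhds hp] with z hz
    exact e.toOpenPartialHomeomorph.left_inv hz
  have hpair : mfderiv (I.prod 𝓘(ℝ, F)) (I.prod 𝓘(ℝ, F)) e p
      = (dproj I F V p).prod (dfibre I F V p) := by
    have h5 : mfderiv (I.prod 𝓘(ℝ, F)) (I.prod 𝓘(ℝ, F)) e p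
      = mfderiv (I.prod 𝓘(ℝ, F)) (I.prod 𝓘(ℝ, F))
        (fun z : TotalSpace F V ↦ (z.proj, (e z).2)) p := by
      apply Filter.EventuallyEq.mfderiv_eq
      filter_upwards [e.open_source.mem_nhds hp] with z hz
      exact Prod.ext (e.coe_fst hz) rfl
    rw [h5]
    exact mfderiv_prodMk (mdifferentiableAt_proj V) (mdifferentiableAt_fibre p p hb)
  have hξ : mfderiv (I.prod 𝓘(ℝ, F)) (I.prod 𝓘(ℝ, F)) e p ξ = 0 := by
    rw [hpair]
    exact Prod.ext h1 h3
  have := congrArg (fun L ↦ L ξ) hid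
  rw [mfderiv_comp p hds hd] at this
  change mfderiv (I.prod 𝓘(ℝ, F)) (I.prod 𝓘(ℝ, F)) e.toOpenPartialHomeomorph.symm (e p)
    (mfderiv (I.prod 𝓘(ℝ, F)) (I.prod 𝓘(ℝ, F)) e p ξ) = ξ at this
  rw [← this, hξ]
  exact map_zero _

end helpers

section metric

variable [ContMDiffVectorBundle 1 F V I]
  [FiniteDimensional ℝ B] [FiniteDimensional ℝ F]
  [RiemannianBundle (fun x : N ↦ TangentSpace I x)]

/-- The Sasaki metric on the total space:
`(ξ₁, ξ₂) ↦ (dπ ξ₁, dπ ξ₂)_h + (K ξ₁, K ξ₂)_κ` on `T_p E`. -/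
def sasakiMetric (cov : CovariantDerivative I F V) :
    RiemannianMetric (fun p : TotalSpace F V ↦ TangentSpace (I.prod 𝓘(ℝ, F)) p) where
  inner p := (dproj I F V p).precomp ℝ ∘L innerSL ℝ (E := TangentSpace I p.proj) ∘L dproj I F V p
    + (connector cov p).precomp ℝ ∘L innerSL ℝ (E := V p.proj) ∘L connector cov p
  symm p ξ η := by
    change inner ℝ (dproj I F V p ξ) (dproj I F V p η)
        + inner ℝ (connector cov p ξ) (connector cov p η)
      = inner ℝ (dproj I F V p η) (dproj I F V p ξ)
        + inner ℝ (connector cov p η) (connector cov p ξ)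
    rw [real_inner_comm, real_inner_comm (connector cov p η)]
  pos p ξ hξ := by
    change 0 < inner ℝ (dproj I F V p ξ) (dproj I F V p ξ)
        + inner ℝ (connector cov p ξ) (connector cov p ξ)
    by_contra h
    have h1 := real_inner_self_nonneg (x := dproj I F V p ξ)
    have h2 := real_inner_self_nonneg (x := connector cov p ξ)
    exact hξ (eq_zero_of_dproj_of_connector cov p ξ
      (inner_self_eq_zero (𝕜 := ℝ).1 (by linarith)) (inner_self_eq_zero (𝕜 := ℝ).1 (by linarith)))
  continuousAt p := by
    change ContinuousAt (fun ξ ↦ inner ℝ (dproj I F V p ξ) (dproj I F V p ξ)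
        + inner ℝ (connector cov p ξ) (connector cov p ξ)) 0
    exact ((((dproj I F V p).continuous).inner (dproj I F V p).continuous).add
      ((connector cov p).continuous.inner (connector cov p).continuous)).continuousAt
  isVonNBounded p := by
    let A : B × F →L[ℝ] TangentSpace I p.proj × V p.proj :=
      ContinuousLinearMap.prod (dproj I F V p) (connector cov p)
    have hA : LinearMap.ker A.toLinearMap = ⊥ := by
      rw [LinearMap.ker_eq_bot']
      intro ξ hξ
      have h1 : dproj I F V p ξ = 0 := congrArg Prod.fst hξ
      have h2 : connector cov p ξ = 0 := congrArg Prod.snd hξ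
      exact eq_zero_of_dproj_of_connector cov p ξ h1 h2
    obtain ⟨K, -, hK⟩ := A.toLinearMap.exists_antilipschitzWith hA
    have hb : Bornology.IsBounded (A ⁻¹' Metric.ball 0 1) :=
      hK.isBounded_preimage Metric.isBounded_ball
    change Bornology.IsVonNBounded ℝ {ξ : B × F | inner ℝ (dproj I F V p ξ) (dproj I F V p ξ)
        + inner ℝ (connector cov p ξ) (connector cov p ξ) < 1}
    refine (NormedSpace.isVonNBounded_iff ℝ).2 (hb.subset ?_)
    intro ξ hξ
    change inner ℝ (dproj I F V p ξ) (dproj I F V p ξ)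
        + inner ℝ (connector cov p ξ) (connector cov p ξ) < 1 at hξ
    rw [real_inner_self_eq_norm_sq, real_inner_self_eq_norm_sq] at hξ
    rw [mem_preimage, mem_ball_zero_iff]
    change max ‖dproj I F V p ξ‖ ‖connector cov p ξ‖ < 1
    rw [max_lt_iff]
    constructor <;> nlinarith [norm_nonneg (dproj I F V p ξ), norm_nonneg (connector cov p ξ)]

/-- The Sasaki distance: the Riemannian distance of the Sasaki metric on the total space. -/
def sasakiEDist (cov : CovariantDerivative I F V) (e₁ e₂ : TotalSpace F V) : ℝ≥0∞ :=
  letI : RiemannianBundle (fun p : TotalSpace F V ↦ TangentSpace (I.prod 𝓘(ℝ, F)) p) :=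
    ⟨sasakiMetric cov⟩
  riemannianEDist (I.prod 𝓘(ℝ, F)) e₁ e₂

end metric

variable (I) in
/-- `γ` restricted to `[0, 1]` is a piecewise regular curve: there is a subdivision
`0 = τ 0 < τ 1 < ⋯ < τ m = 1` such that on each closed subinterval `γ` is smooth with
nowhere vanishing velocity (one-sided at the end points). Continuity on `[0, 1]` follows. -/
def IsPiecewiseRegular (γ : ℝ → N) : Prop :=
  ∃ (m : ℕ) (τ : ℕ → ℝ), τ 0 = 0 ∧ τ m = 1 ∧ ∀ i < m, τ i < τ (i + 1) ∧
    ContMDiffOn 𝓘(ℝ, ℝ) I ∞ γ (Icc (τ i) (τ (i + 1))) ∧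
    ∀ t ∈ Icc (τ i) (τ (i + 1)),
      mfderivWithin 𝓘(ℝ, ℝ) I γ (Icc (τ i) (τ (i + 1))) t (1 : ℝ) ≠ 0

/-- `α`, a curve in the total space, is on `[0, 1]` a parallel section along `γ`:
it lies over `γ`, is continuous and satisfies `Dα/dt = 0` except at finitely many times (corners
of `γ`, end points). -/
def IsParallelAlong (cov : CovariantDerivative I F V) (γ : ℝ → N) (α : ℝ → TotalSpace F V) :
    Prop :=
  (∀ t ∈ Icc (0 : ℝ) 1, (α t).proj = γ t) ∧ ContinuousOn α (Icc 0 1) ∧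
    ∃ S : Set ℝ, S.Finite ∧ ∀ t ∈ Icc (0 : ℝ) 1 \ S,
      MDifferentiableAt 𝓘(ℝ, ℝ) (I.prod 𝓘(ℝ, F)) α t ∧ covDerivAlong cov α t = 0

/-- Parallel transport `P^γ : E_{q₂} → E_{q₁}` along a piecewise smooth curve `γ` on `[0, 1]` from
`q₁` to `q₂`: the value at time `0` of the parallel section along `γ` with value `e` at time `1`.
(Such a section exists and is unique, the parallel equation being a linear ODE.) -/
def parallelTransport (cov : CovariantDerivative I F V) (γ : ℝ → N) {q₁ q₂ : N} (e : V q₂) :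
    V q₁ :=
  Classical.epsilon fun w ↦ ∃ α : ℝ → TotalSpace F V, IsParallelAlong cov γ α ∧
    α 0 = ⟨q₁, w⟩ ∧ α 1 = ⟨q₂, e⟩

end Sasaki

end SasakiDefinitions

noncomputable section

set_option linter.unusedSectionVars false

/-! A Sasaki length splits into a horizontal part, the length of the projected curve, and a vertical
part, the integral of the norm of the covariant derivative. Both inequalities compare curves in the
total space with parallel sections along their projection. Parallel sections exist by gluing
solutions of a linear ODE in trivializations (`exists_isParallelSection`), and metric compatibility
makes their norms constant.

Upper bound (`sasakiEDist_sq_le`): along a regular `γ` of length `ℓ` let `X` be parallel with `X 1 =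
e₂`, and `Y` parallel with `Y 0 = e₁ - X 0`. Put `D = ‖Y‖` and let `c` decrease from 1 to 0 linearly
in arc length. The section `X + c • Y` joins `e₁` to `e₂`, its covariant derivative has norm `|γ'| D
/ ℓ`, and so its Sasaki length is `√(ℓ² + D²)`. Regularity of `γ` ensures `ℓ > 0`.

Lower bound (`IsNiceOn.sq_add_sq_le_pathELength_sq`): for a curve `β` in the total space with
piecewise regular projection, comparison with the parallel section ending at `β 1` bounds `‖e₁ - P
e₂‖` by the integral of `‖Dβ/dt‖` (`enorm_sub_le_of_parallel`). Minkowski's integral inequality then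
combines the two parts.

The distance, however, is an infimum over all `C^1` curves, whose projections may stop or be
constant. Such a curve is replaced by a chart polygon that is longer by an arbitrarily small amount
and whose edges have non-constant base coordinate (`nicelyJoined_of_contMDiffOn`). This uses only
continuity of the Sasaki norm, and `dim N ≥ 1` to push vertical edges sideways. Finiteness follows
from the upper bound, because connectedness provides a piecewise regular curve. -/

namespace Sasaki

/-! ### Local-to-global arguments on intervals and finite sets of break points -/

section RealLine

/-- A transitive relation between the end points of intervals that holds for all short
intervals holds for the whole interval. -/
theorem rel_of_local {R : ℝ → ℝ → Prop} {a b : ℝ} (hab : a < b)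
    (htrans : ∀ s t u, a ≤ s → s < t → t < u → u ≤ b → R s t → R t u → R s u)
    (hloc : ∀ t ∈ Icc a b, ∃ δ > 0, ∀ s s', a ≤ s → s < s' → s' ≤ b → t - δ < s → s' < t + δ →
      R s s') : R a b := by
  choose! δ hδ hR using hloc
  let c (i : Icc a b) : Set (Icc a b) := {x | (x : ℝ) ∈ Ioo ((i : ℝ) - δ i) (i + δ i)}
  obtain ⟨t, h0, hmono, ⟨m, hm⟩, hsub⟩ := exists_monotone_Icc_subset_open_cover_Icc hab.le
    (c := c) (fun i ↦ isOpen_Ioo.preimage continuous_subtype_val)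
    (fun x _ ↦ mem_iUnion.2 ⟨x, by
      have := hδ x x.2
      exact ⟨by linarith, by linarith⟩⟩)
  -- The monotone subdivision may repeat points, while `R` is only controlled on nondegenerate
  -- intervals; the first alternative absorbs the repetitions at `a`.
  have key : ∀ n, (t n : ℝ) = a ∨ R a (t n) := by
    intro n
    induction n with
    | zero => exact .inl (by rw [h0])
    | succ n ih =>
      have hle : (t n : ℝ) ≤ t (n + 1) := hmono n.le_succ
      rcases hle.eq_or_lt with h | h
      · rwa [← h]
      · right
        obtain ⟨i, hi⟩ := hsub n
        have h1 := hi (left_mem_Icc.2 (hmono n.le_succ))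
        have h2 := hi (right_mem_Icc.2 (hmono n.le_succ))
        have h3 : R (t n) (t (n + 1)) :=
          hR i i.2 _ _ (t n).2.1 h (t (n + 1)).2.2 h1.1 h2.2
        rcases ih with ih | ih
        · rwa [ih] at h3
        · rcases (t n).2.1.eq_or_lt with h4 | h4
          · rwa [← h4] at h3
          · exact htrans _ _ _ le_rfl h4 h (t (n + 1)).2.2 ih h3
  have h1 := key m
  rw [hm m le_rfl] at h1
  exact h1.resolve_left hab.ne'

/-- `P s s'` holds for all subintervals of `[a, b]` without a break point in the interior, for
some finite set of break points. -/
def PiecewiseOn (P : ℝ → ℝ → Prop) (a b : ℝ) : Prop :=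
  ∃ S : Set ℝ, S.Finite ∧ ∀ s s', a ≤ s → s < s' → s' ≤ b → Disjoint (Ioo s s') S → P s s'

namespace PiecewiseOn

variable {P Q R : ℝ → ℝ → Prop} {a b c : ℝ}

/-- Near any `t` the only possible break point is `t` itself, so a short interval is either good or
is split by `t` into two good ones. This is the induction principle for piecewise statements. -/
theorem rel (h : PiecewiseOn P a b) (hab : a < b)
    (htrans : ∀ s t u, a ≤ s → s < t → t < u → u ≤ b → R s t → R t u → R s u)
    (hP : ∀ s s', a ≤ s → s < s' → s' ≤ b → P s s' → R s s') : R a b := by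
  obtain ⟨S, hS, h⟩ := h
  refine rel_of_local hab htrans fun t ht ↦ ?_
  have hfin : (S \ {t}).Finite := hS.subset sdiff_subset
  have hnhds : (S \ {t})ᶜ ∈ 𝓝 t := hfin.isClosed.isOpen_compl.mem_nhds (by simp)
  obtain ⟨δ, hδ, hsub⟩ := Metric.mem_nhds_iff.1 hnhds
  have key : ∀ s s', a ≤ s → s < s' → s' ≤ b → t - δ < s → s' < t + δ → t ∉ Ioo s s' →
      R s s' := by
    intro s s' h1 h2 h3 h4 h5 h6
    refine hP s s' h1 h2 h3 (h s s' h1 h2 h3 (Set.disjoint_left.2 fun x hx hxS ↦ ?_))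
    have hx' : x ∈ Metric.ball t δ := by
      rw [Metric.mem_ball, Real.dist_eq, abs_lt]
      constructor <;> linarith [hx.1, hx.2]
    exact hsub hx' ⟨hxS, fun hxt ↦ h6 (hxt ▸ hx)⟩
  refine ⟨δ, hδ, fun s s' h1 h2 h3 h4 h5 ↦ ?_⟩
  by_cases h6 : t ∈ Ioo s s'
  · exact htrans s t s' h1 h6.1 h6.2 h3
      (key s t h1 h6.1 (h6.2.le.trans h3) h4 (by linarith) (fun h ↦ h.2.false))
      (key t s' (h1.trans h6.1.le) h6.2 h3 (by linarith) h5 (fun h ↦ h.1.false))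
  · exact key s s' h1 h2 h3 h4 h5 h6

theorem mono (h : PiecewiseOn P a b)
    (hP : ∀ s s', a ≤ s → s < s' → s' ≤ b → P s s' → Q s s') : PiecewiseOn Q a b := by
  obtain ⟨S, hS, h⟩ := h
  exact ⟨S, hS, fun s s' h1 h2 h3 h4 ↦ hP s s' h1 h2 h3 (h s s' h1 h2 h3 h4)⟩

theorem and (h : PiecewiseOn P a b) (h' : PiecewiseOn Q a b) :
    PiecewiseOn (fun s s' ↦ P s s' ∧ Q s s') a b := by
  obtain ⟨S, hS, h⟩ := h
  obtain ⟨S', hS', h'⟩ := h'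
  refine ⟨S ∪ S', hS.union hS', fun s s' h1 h2 h3 h4 ↦ ?_⟩
  rw [disjoint_union_right] at h4
  exact ⟨h s s' h1 h2 h3 h4.1, h' s s' h1 h2 h3 h4.2⟩

theorem of_forall (h : ∀ s s', a ≤ s → s < s' → s' ≤ b → P s s') : PiecewiseOn P a b :=
  ⟨∅, finite_empty, fun s s' h1 h2 h3 _ ↦ h s s' h1 h2 h3⟩

theorem trans (h : PiecewiseOn P a b) (h' : PiecewiseOn P b c) : PiecewiseOn P a c := by
  obtain ⟨S, hS, h⟩ := h
  obtain ⟨S', hS', h'⟩ := h'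
  -- With `b` among the break points every admissible interval lies on one side of `b`.
  refine ⟨{b} ∪ (S ∪ S'), (finite_singleton b).union (hS.union hS'), fun s s' h1 h2 h3 h4 ↦ ?_⟩
  rw [disjoint_union_right, disjoint_union_right, disjoint_singleton_right] at h4
  obtain ⟨hb, h5, h6⟩ := h4
  by_cases h7 : s' ≤ b
  · exact h s s' h1 h2 h7 h5
  · push Not at h7
    have : b ≤ s := by
      by_contra! h8
      exact hb ⟨h8, h7⟩
    exact h' s s' this h2 h3 h6

/-- All but finitely many points lie in the interior of a good interval. -/
theorem exists_finite_forall (h : PiecewiseOn P a b) :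
    ∃ S : Set ℝ, S.Finite ∧ ∀ t ∈ Icc a b \ S, ∃ s s', a ≤ s ∧ s < t ∧ t < s' ∧ s' ≤ b ∧
      P s s' := by
  obtain ⟨S, hS, h⟩ := h
  refine ⟨{a, b} ∪ S, ((finite_singleton b).insert a).union hS, fun t ht ↦ ?_⟩
  have hta : t ≠ a := fun h ↦ ht.2 (by simp [h])
  have htb : t ≠ b := fun h ↦ ht.2 (by simp [h])
  have htS : t ∉ S := fun h ↦ ht.2 (by simp [h])
  have hta' : a < t := lt_of_le_of_ne ht.1.1 hta.symm
  have htb' : t < b := lt_of_le_of_ne ht.1.2 htb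
  have hnhds : Sᶜ ∩ Ioo a b ∈ 𝓝 t :=
    Filter.inter_mem (hS.isClosed.isOpen_compl.mem_nhds htS) (Ioo_mem_nhds hta' htb')
  obtain ⟨δ, hδ, hsub⟩ := Metric.mem_nhds_iff.1 hnhds
  rw [Real.ball_eq_Ioo] at hsub
  have hsub' : Ioo (t - δ / 2) (t + δ / 2) ⊆ Ioo (t - δ) (t + δ) :=
    Ioo_subset_Ioo (by linarith) (by linarith)
  have h1 := (hsub (show t - δ / 2 ∈ Ioo (t - δ) (t + δ) by constructor <;> linarith)).2
  have h2 := (hsub (show t + δ / 2 ∈ Ioo (t - δ) (t + δ) by constructor <;> linarith)).2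
  refine ⟨t - δ / 2, t + δ / 2, h1.1.le, by linarith, by linarith, h2.2.le,
    h _ _ h1.1.le (by linarith) h2.2.le (Set.disjoint_left.2 fun x hx hxS ↦ ?_)⟩
  exact (hsub (hsub' hx)).1 hxS

end PiecewiseOn

end RealLine

/-! ### Integral inequalities and linear differential equations -/

section Analysis

open MeasureTheory

/-- A curve moves by at most the integral of a bound for its speed. -/
theorem enorm_sub_le_lintegral {W : Type*} [NormedAddCommGroup W] [NormedSpace ℝ W]
    [FiniteDimensional ℝ W] {a b : ℝ} (hab : a ≤ b)
    {u : ℝ → W} (hu : ContinuousOn u (Icc a b)) {S : Set ℝ} (hS : S.Finite)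
    {k : ℝ → ℝ≥0∞}
    (hd : ∀ t ∈ Icc a b \ S, DifferentiableAt ℝ u t ∧ ‖deriv u t‖ₑ ≤ k t) :
    ‖u b - u a‖ₑ ≤ ∫⁻ t in Icc a b, k t := by
  have : CompleteSpace W := FiniteDimensional.complete ℝ W
  borelize W
  by_cases htop : ∫⁻ t in Icc a b, k t = ⊤
  · rw [htop]; exact le_top
  have hle : ∫⁻ t in Icc a b, ‖deriv u t‖ₑ ≤ ∫⁻ t in Icc a b, k t := by
    apply lintegral_mono_ae
    have hS0 : ∀ᵐ t ∂(volume.restrict (Icc a b)), t ∉ S :=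
      measure_eq_zero_iff_ae_notMem.1 (hS.measure_zero _)
    filter_upwards [hS0, ae_restrict_mem measurableSet_Icc] with t h1 h2
    exact (hd t ⟨h2, h1⟩).2
  -- Finiteness of the integral of `k` supplies the integrability required by the fundamental
  -- theorem of calculus off a countable set.
  have hint : IntegrableOn (deriv u) (Icc a b) := by
    refine ⟨(stronglyMeasurable_deriv u).aestronglyMeasurable, ?_⟩
    exact lt_of_le_of_lt hle (lt_top_iff_ne_top.2 htop)
  have hftc := integral_eq_of_hasDerivAt_off_countable u (deriv u) (s := S)
    hS.countable (a := a) (b := b) (by rwa [uIcc_of_le hab])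
    (fun t ht ↦ by
      rw [min_eq_left hab, max_eq_right hab] at ht
      exact (hd t ⟨⟨ht.1.1.le, ht.1.2.le⟩, ht.2⟩).1.hasDerivAt)
    ((intervalIntegrable_iff_integrableOn_Icc_of_le hab).2 hint)
  rw [← hftc, intervalIntegral.integral_of_le hab, ← integral_Icc_eq_integral_Ioc]
  exact (enorm_integral_le_lintegral_enorm _).trans hle

/-- Minkowski's integral inequality for curves in the plane. -/
theorem sq_lintegral_add_sq_lintegral_le {X : Type*} [MeasurableSpace X] (μ : Measure X)
    (f g h : X → ℝ≥0∞) (hh : ∀ᵐ x ∂μ, f x ^ 2 + g x ^ 2 ≤ h x ^ 2) :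
    (∫⁻ x, f x ∂μ) ^ 2 + (∫⁻ x, g x ∂μ) ^ 2 ≤ (∫⁻ x, h x ∂μ) ^ 2 := by
  have hfh : ∫⁻ x, f x ∂μ ≤ ∫⁻ x, h x ∂μ := by
    refine lintegral_mono_ae (hh.mono fun x hx ↦ ?_)
    exact (ENNReal.pow_le_pow_left_iff two_ne_zero).1 (le_self_add.trans hx)
  have hgh : ∫⁻ x, g x ∂μ ≤ ∫⁻ x, h x ∂μ := by
    refine lintegral_mono_ae (hh.mono fun x hx ↦ ?_)
    exact (ENNReal.pow_le_pow_left_iff two_ne_zero).1 (le_add_self.trans hx)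
  by_cases htop : ∫⁻ x, h x ∂μ = ⊤
  · simp [htop]
  obtain ⟨a, ha⟩ : ∃ a : NNReal, (a : ℝ≥0∞) = ∫⁻ x, f x ∂μ := ⟨_, ENNReal.coe_toNNReal (ne_top_of_le_ne_top htop hfh)⟩
  obtain ⟨b, hb⟩ : ∃ b : NNReal, (b : ℝ≥0∞) = ∫⁻ x, g x ∂μ := ⟨_, ENNReal.coe_toNNReal (ne_top_of_le_ne_top htop hgh)⟩
  -- Duality: pairing `(f, g)` with the vector `(a, b)` of norm `r` gives `a f + b g ≤ r h` by
  -- Cauchy–Schwarz, and integration gives `r² ≤ r ∫ h`.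
  set r : NNReal := NNReal.sqrt (a ^ 2 + b ^ 2) with hr
  have hr2 : r ^ 2 = a ^ 2 + b ^ 2 := NNReal.sq_sqrt _
  rcases eq_or_ne r 0 with h0 | h0
  · have : ((a ^ 2 + b ^ 2 : NNReal) : ℝ≥0∞) = 0 := by rw [← hr2, h0]; simp
    rw [← ha, ← hb]
    push_cast at this
    rw [this]
    exact bot_le
  have hpt : ∀ᵐ x ∂μ, a * f x + b * g x ≤ r * h x := by
    filter_upwards [hh] with x hx
    by_cases hx' : h x = ⊤
    · rw [hx', ENNReal.mul_top (by simpa using h0)]; exact le_top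
    have hf' : f x ≤ h x := (ENNReal.pow_le_pow_left_iff two_ne_zero).1 (le_self_add.trans hx)
    have hg' : g x ≤ h x := (ENNReal.pow_le_pow_left_iff two_ne_zero).1 (le_add_self.trans hx)
    obtain ⟨p, hp⟩ : ∃ p : NNReal, (p : ℝ≥0∞) = f x := ⟨_, ENNReal.coe_toNNReal (ne_top_of_le_ne_top hx' hf')⟩
    obtain ⟨q, hq⟩ : ∃ q : NNReal, (q : ℝ≥0∞) = g x := ⟨_, ENNReal.coe_toNNReal (ne_top_of_le_ne_top hx' hg')⟩
    obtain ⟨m, hm⟩ : ∃ m : NNReal, (m : ℝ≥0∞) = h x := ⟨_, ENNReal.coe_toNNReal hx'⟩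
    rw [← hp, ← hq, ← hm] at hx ⊢
    norm_cast at hx ⊢
    refine (pow_le_pow_iff_left₀ zero_le zero_le two_ne_zero).1 ?_
    rw [mul_pow, hr2]
    refine le_trans ?_ (mul_le_mul_right hx _)
    rw [← NNReal.coe_le_coe]
    push_cast
    -- Lagrange's identity: `(a² + b²)(p² + q²) - (ap + bq)² = (aq - bp)²`.
    nlinarith [sq_nonneg ((a : ℝ) * q - b * p)]
  have key : ((r ^ 2 : NNReal) : ℝ≥0∞) ≤ r * ∫⁻ x, h x ∂μ := by
    calc ((r ^ 2 : NNReal) : ℝ≥0∞) = a * ∫⁻ x, f x ∂μ + b * ∫⁻ x, g x ∂μ := by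
          rw [hr2, ← ha, ← hb]; push_cast; ring
      _ = ∫⁻ x, a * f x ∂μ + ∫⁻ x, b * g x ∂μ := by
          rw [lintegral_const_mul' _ _ ENNReal.coe_ne_top,
            lintegral_const_mul' _ _ ENNReal.coe_ne_top]
      -- Superadditivity of the lower integral suffices, so no measurability is required.
      _ ≤ ∫⁻ x, (a * f x + b * g x) ∂μ := le_lintegral_add _ _
      _ ≤ ∫⁻ x, r * h x ∂μ := lintegral_mono_ae hpt
      _ = r * ∫⁻ x, h x ∂μ := lintegral_const_mul' _ _ ENNReal.coe_ne_top
  obtain ⟨c, hc⟩ : ∃ c : NNReal, (c : ℝ≥0∞) = ∫⁻ x, h x ∂μ := ⟨_, ENNReal.coe_toNNReal htop⟩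
  rw [← ha, ← hb]
  rw [← hc] at key ⊢
  norm_cast at key ⊢
  rw [← hr2]
  have hrc : r ≤ c := by
    rw [sq] at key
    exact le_of_mul_le_mul_left key (pos_iff_ne_zero.2 h0)
  gcongr

/-- Linear differential equations are solvable on short intervals. -/
theorem exists_linear_ode {F : Type*} [NormedAddCommGroup F] [NormedSpace ℝ F] [CompleteSpace F]
    {a b : ℝ} {A : ℝ → F →L[ℝ] F} (hA : ContinuousOn A (Icc a b)) {M : ℝ}
    (hM : ∀ t ∈ Icc a b, ‖A t‖ ≤ M) (hab : M * (b - a) ≤ 1 / 2) {t₀ : ℝ} (ht₀ : t₀ ∈ Icc a b)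
    (x₀ : F) :
    ∃ f : ℝ → F, f t₀ = x₀ ∧ ∀ t ∈ Icc a b, HasDerivWithinAt f (A t (f t)) (Icc a b) t := by
  have hM0 : 0 ≤ M := (norm_nonneg _).trans (hM t₀ ht₀)
  lift M to NNReal using hM0
  -- On the ball of radius `‖x₀‖` around `x₀` the field is at most `2 M ‖x₀‖`; since `M (b - a) ≤
  -- 1/2`, a solution cannot leave that ball during `[a, b]`.
  have hpl : IsPicardLindelof (fun t x ↦ A t x) (tmin := a) (tmax := b) ⟨t₀, ht₀⟩ x₀
      ‖x₀‖₊ 0 (2 * M * ‖x₀‖₊) M := by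
    refine ⟨fun t ht ↦ ?_, fun x _ ↦ hA.clm_apply continuousOn_const, fun t ht x hx ↦ ?_, ?_⟩
    · exact ((A t).lipschitz.weaken (hM t ht)).lipschitzOnWith
    · have h1 : ‖x‖ ≤ 2 * ‖x₀‖ := by
        have := mem_closedBall_iff_norm.1 hx
        have h2 := norm_le_norm_add_norm_sub' x x₀
        simp only [coe_nnnorm] at this
        linarith
      calc ‖A t x‖ ≤ ‖A t‖ * ‖x‖ := (A t).le_opNorm x
        _ ≤ M * (2 * ‖x₀‖) := by gcongr; exact hM t ht
        _ = _ := by push_cast; ring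
    · have h3 : max (b - t₀) (t₀ - a) ≤ b - a := max_le (by linarith [ht₀.1]) (by linarith [ht₀.2])
      push_cast
      rw [sub_zero]
      calc 2 * M * ‖x₀‖ * max (b - t₀) (t₀ - a) ≤ 2 * M * ‖x₀‖ * (b - a) := by gcongr
        _ = 2 * (M * (b - a)) * ‖x₀‖ := by ring
        _ ≤ 2 * (1 / 2) * ‖x₀‖ := by gcongr
        _ = ‖x₀‖ := by ring
  exact hpl.exists_eq_forall_mem_Icc_hasDerivWithinAt₀

end Analysis

/-! ### The connector at a point -/

section Pointwise

variable {B : Type*} [NormedAddCommGroup B] [NormedSpace ℝ B]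
  {N : Type*} [TopologicalSpace N] [ChartedSpace B N] 
  {F : Type*} [NormedAddCommGroup F] [NormedSpace ℝ F] 
  {V : N → Type*} [TopologicalSpace (TotalSpace F V)]
  [∀ x, NormedAddCommGroup (V x)] [∀ x, InnerProductSpace ℝ (V x)]
  [FiberBundle F V] [VectorBundle ℝ F V] 

/-- A linear functional equal to 1 on the chart image of `v`, pulled back and shifted to vanish at
`q`. Multiplying a section by it prescribes a covariant derivative without changing the value at
`q`. -/
theorem exists_function_mfderiv_eq_one [IsManifold 𝓘(ℝ, B) ∞ N] (q : N)
    {v : TangentSpace 𝓘(ℝ, B) q} (hv : v ≠ 0) :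
    ∃ l : N → ℝ, MDifferentiableAt 𝓘(ℝ, B) 𝓘(ℝ, ℝ) l q ∧ l q = 0 ∧
      mvfderiv 𝓘(ℝ, B) l q v = 1 := by
  have hinv := isInvertible_mfderiv_extChartAt (I := 𝓘(ℝ, B)) (x := q) (y := q)
    (mem_extChartAt_source q)
  set w : B := mfderiv 𝓘(ℝ, B) 𝓘(ℝ, B) (extChartAt 𝓘(ℝ, B) q) q v with hw
  have hw0 : w ≠ 0 := by
    intro h
    exact hv (hinv.injective (h.trans (map_zero _).symm))
  obtain ⟨L, hL⟩ := SeparatingDual.exists_eq_one (R := ℝ) hw0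
  have hd : MDifferentiableAt 𝓘(ℝ, B) 𝓘(ℝ, B) (extChartAt 𝓘(ℝ, B) q) q :=
    mdifferentiableAt_extChartAt (mem_chart_source B q)
  let L' : B → ℝ := fun x ↦ L (x - extChartAt 𝓘(ℝ, B) q q)
  have hL' : HasFDerivAt L' L (extChartAt 𝓘(ℝ, B) q q) :=
    L.hasFDerivAt.comp _ ((hasFDerivAt_id _).sub_const _)
  have hcomp := HasMFDerivAt.comp q hL'.hasMFDerivAt hd.hasMFDerivAt
  refine ⟨L' ∘ extChartAt 𝓘(ℝ, B) q, hcomp.mdifferentiableAt, by simp [L'], ?_⟩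
  change mfderiv 𝓘(ℝ, B) 𝓘(ℝ, ℝ) (L' ∘ extChartAt 𝓘(ℝ, B) q) q v = (1 : ℝ)
  rw [hcomp.mfderiv]
  exact hL

section

variable [ContMDiffVectorBundle 1 F V 𝓘(ℝ, B)]

theorem dproj_mfderiv_section {Y : ∀ x, V x} {q : N} {w : V q} (hw : Y q = w)
    (hY : MDifferentiableAt 𝓘(ℝ, B) (𝓘(ℝ, B).prod 𝓘(ℝ, F)) (fun x ↦ TotalSpace.mk' F x (Y x)) q)
    (v : TangentSpace 𝓘(ℝ, B) q) :
    dproj 𝓘(ℝ, B) F V ⟨q, w⟩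
      (mfderiv 𝓘(ℝ, B) (𝓘(ℝ, B).prod 𝓘(ℝ, F)) (fun x ↦ TotalSpace.mk' F x (Y x)) q v) = v := by
  subst hw
  have := mfderiv_comp (I := 𝓘(ℝ, B)) (I' := 𝓘(ℝ, B).prod 𝓘(ℝ, F)) (I'' := 𝓘(ℝ, B)) q
    (g := (TotalSpace.proj : TotalSpace F V → N)) (f := fun x ↦ TotalSpace.mk' F x (Y x))
    (mdifferentiableAt_proj V) hY
  have h2 : mfderiv 𝓘(ℝ, B) 𝓘(ℝ, B) ((TotalSpace.proj : TotalSpace F V → N) ∘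
    fun x ↦ TotalSpace.mk' F x (Y x)) q v = v := by
    change mfderiv 𝓘(ℝ, B) 𝓘(ℝ, B) id q v = v
    rw [mfderiv_id]; rfl
  rw [this] at h2
  exact h2

variable [FiniteDimensional ℝ F]

theorem connector_mfderiv_section_of_eq (cov : CovariantDerivative 𝓘(ℝ, B) F V)
    {Y : ∀ x, V x} {q : N} {w : V q} (hw : Y q = w)
    (hY : MDifferentiableAt 𝓘(ℝ, B) (𝓘(ℝ, B).prod 𝓘(ℝ, F)) (fun x ↦ TotalSpace.mk' F x (Y x)) q)
    (v : TangentSpace 𝓘(ℝ, B) q) :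
    connector cov ⟨q, w⟩
      (mfderiv 𝓘(ℝ, B) (𝓘(ℝ, B).prod 𝓘(ℝ, F)) (fun x ↦ TotalSpace.mk' F x (Y x)) q v)
      = cov Y q v := by
  subst hw
  exact connector_mfderiv_section cov hY v

/-- A vector tangent to the total space that is not vertical is the image of its projection under
a section that differs from a given one by a section vanishing at the base point. -/
theorem exists_section_mfderiv_eq [IsManifold 𝓘(ℝ, B) ∞ N]
    (cov : CovariantDerivative 𝓘(ℝ, B) F V) {q : N} (Y₀ : ∀ x, V x)
    (hY₀ : MDifferentiableAt 𝓘(ℝ, B) (𝓘(ℝ, B).prod 𝓘(ℝ, F)) (fun x ↦ TotalSpace.mk' F x (Y₀ x)) q)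
    {w : V q} (hw : Y₀ q = w) (ξ : TangentSpace (𝓘(ℝ, B).prod 𝓘(ℝ, F)) (⟨q, w⟩ : TotalSpace F V))
    (hξ : dproj 𝓘(ℝ, B) F V ⟨q, w⟩ ξ ≠ 0) :
    ∃ l : N → ℝ, MDifferentiableAt 𝓘(ℝ, B) 𝓘(ℝ, ℝ) l q ∧ l q = 0 ∧
      mvfderiv 𝓘(ℝ, B) l q (dproj 𝓘(ℝ, B) F V ⟨q, w⟩ ξ) = 1 ∧
      ∃ Y : ∀ x, V x, Y = Y₀ + l • FiberBundle.extend F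
        (connector cov ⟨q, w⟩ ξ - cov Y₀ q (dproj 𝓘(ℝ, B) F V ⟨q, w⟩ ξ)) ∧
      Y q = w ∧
      MDifferentiableAt 𝓘(ℝ, B) (𝓘(ℝ, B).prod 𝓘(ℝ, F)) (fun x ↦ TotalSpace.mk' F x (Y x)) q ∧
      (mfderiv 𝓘(ℝ, B) (𝓘(ℝ, B).prod 𝓘(ℝ, F)) (fun x ↦ TotalSpace.mk' F x (Y x)) q
        (dproj 𝓘(ℝ, B) F V ⟨q, w⟩ ξ) : B × F) = ξ := by
  set v : TangentSpace 𝓘(ℝ, B) q := dproj 𝓘(ℝ, B) F V ⟨q, w⟩ ξ with hv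
  obtain ⟨l, hl, hl0, hl1⟩ := exists_function_mfderiv_eq_one q hξ
  set z : V q := connector cov ⟨q, w⟩ ξ - cov Y₀ q v with hz
  have hZ : MDifferentiableAt 𝓘(ℝ, B) (𝓘(ℝ, B).prod 𝓘(ℝ, F))
      (fun x ↦ TotalSpace.mk' F x (FiberBundle.extend F z x)) q :=
    FiberBundle.mdifferentiableAt_extend 𝓘(ℝ, B) F z
  have hlZ := hl.smul_section hZ
  have hY := mdifferentiableAt_add_section hY₀ hlZ
  have hYq : (Y₀ + l • FiberBundle.extend F z) q = w := by
    simp [hl0, hw]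
  refine ⟨l, hl, hl0, hl1, _, rfl, hYq, hY, ?_⟩
  -- Since `l q = 0` and `dl v = 1`, the Leibniz rule leaves exactly the correction `z`, the defect
  -- of `Y₀`.
  have hK : cov (Y₀ + l • FiberBundle.extend F z) q v = connector cov ⟨q, w⟩ ξ := by
    rw [cov.isCovariantDerivativeOn.add hY₀ hlZ, cov.isCovariantDerivativeOn.leibniz hZ hl]
    simp [hl0, hl1, hz]
  refine sub_eq_zero.1 (eq_zero_of_dproj_of_connector cov ⟨q, w⟩ _ ?_ ?_)
  · refine (map_sub (dproj 𝓘(ℝ, B) F V ⟨q, w⟩) _ _).trans (sub_eq_zero.2 ?_)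
    exact dproj_mfderiv_section hYq hY v
  · refine (map_sub (connector cov ⟨q, w⟩) _ _).trans (sub_eq_zero.2 ?_)
    exact (connector_mfderiv_section_of_eq cov hYq hY v).trans hK

theorem dproj_surjective (p : TotalSpace F V) :
    Function.Surjective (dproj 𝓘(ℝ, B) F V p) := by
  intro v
  exact ⟨_, dproj_mfderiv_section (FiberBundle.extend_apply_self F p.2)
    (FiberBundle.mdifferentiableAt_extend 𝓘(ℝ, B) F p.2) v⟩

/-- Linear maps on a tangent space of the total space are determined by their values on vectors
that are not vertical. -/
theorem linearMap_ext_of_dproj_ne_zero [Nontrivial B] {p : TotalSpace F V}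
    {W : Type*} [AddCommGroup W] [Module ℝ W]
    {Λ Λ' : TangentSpace (𝓘(ℝ, B).prod 𝓘(ℝ, F)) p →ₗ[ℝ] W}
    (h : ∀ ξ, dproj 𝓘(ℝ, B) F V p ξ ≠ 0 → Λ ξ = Λ' ξ) : Λ = Λ' := by
  obtain ⟨v₀, hv₀⟩ := exists_ne (0 : B)
  obtain ⟨ξ₀, hξ₀⟩ := dproj_surjective (B := B) p v₀
  have hξ₀' : dproj 𝓘(ℝ, B) F V p ξ₀ ≠ 0 := by rw [hξ₀]; exact hv₀
  ext ξ
  by_cases hξ : dproj 𝓘(ℝ, B) F V p ξ = 0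
  -- A vertical `ξ` is the difference of the non-vertical vectors `ξ + ξ₀` and `ξ₀`.
  · have h1 := h (ξ + ξ₀) (by rwa [map_add, hξ, zero_add])
    rwa [map_add, map_add, h ξ₀ hξ₀', add_left_inj] at h1
  · exact h ξ hξ

/-- The section through `q₀`'s trivialization that has constant fibre coordinate `f`. -/
def constSection (q₀ : N) (f : F) (x : N) : V x := (trivializationAt F V q₀).symmL ℝ x f

theorem trivializationAt_constSection {q₀ x : N} (hx : x ∈ (trivializationAt F V q₀).baseSet)
    (f : F) : (trivializationAt F V q₀ ⟨x, constSection q₀ f x⟩).2 = f := by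
  rw [constSection, Trivialization.symmL_apply _ hx, Trivialization.apply_mk_symm _ hx]

theorem constSection_trivializationAt {q₀ x : N} (hx : x ∈ (trivializationAt F V q₀).baseSet)
    (w : V x) : constSection q₀ (trivializationAt F V q₀ ⟨x, w⟩).2 x = w := by
  rw [constSection, Trivialization.symmL_apply _ hx, Trivialization.symm_apply_apply_mk _ hx]

theorem contMDiffOn_constSection {n : WithTop ℕ∞} [ContMDiffVectorBundle n F V 𝓘(ℝ, B)]
    (q₀ : N) (f : F) :
    ContMDiffOn 𝓘(ℝ, B) (𝓘(ℝ, B).prod 𝓘(ℝ, F)) n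
      (fun x ↦ TotalSpace.mk' F x (constSection (V := V) q₀ f x))
      (trivializationAt F V q₀).baseSet := by
  intro x hx
  rw [(trivializationAt F V q₀).contMDiffWithinAt_section _ hx]
  exact (contMDiffWithinAt_const (c := f)).congr
    (fun y hy ↦ trivializationAt_constSection hy f) (trivializationAt_constSection hx f)

theorem mdifferentiableAt_constSection {q₀ x : N}
    (hx : x ∈ (trivializationAt F V q₀).baseSet) (f : F) :
    MDifferentiableAt 𝓘(ℝ, B) (𝓘(ℝ, B).prod 𝓘(ℝ, F))
      (fun x ↦ TotalSpace.mk' F x (constSection (V := V) q₀ f x)) x :=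
  ((contMDiffOn_constSection (n := 1) q₀ f).contMDiffAt
    ((trivializationAt F V q₀).open_baseSet.mem_nhds hx)).mdifferentiableAt one_ne_zero

theorem mdifferentiableAt_fibreCoord {q₀ : N} {z : TotalSpace F V}
    (hz : z.proj ∈ (trivializationAt F V q₀).baseSet) :
    MDifferentiableAt (𝓘(ℝ, B).prod 𝓘(ℝ, F)) 𝓘(ℝ, F)
      (fun z : TotalSpace F V ↦ (trivializationAt F V q₀ z).2) z :=
  mdifferentiableAt_fibre (⟨q₀, 0⟩ : TotalSpace F V) z hz

variable [IsManifold 𝓘(ℝ, B) ∞ N] [Nontrivial B]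

/-- The connector in terms of a trivialization around a nearby point. -/
theorem connector_eq_of_mem_baseSet (cov : CovariantDerivative 𝓘(ℝ, B) F V) {q₀ : N}
    {p : TotalSpace F V} (hp : p.proj ∈ (trivializationAt F V q₀).baseSet)
    (ξ : TangentSpace (𝓘(ℝ, B).prod 𝓘(ℝ, F)) p) :
    connector cov p ξ = (trivializationAt F V q₀).symmL ℝ p.proj
        (mfderiv (𝓘(ℝ, B).prod 𝓘(ℝ, F)) 𝓘(ℝ, F)
          (fun z : TotalSpace F V ↦ (trivializationAt F V q₀ z).2) p ξ)
      + cov (constSection q₀ (trivializationAt F V q₀ p).2) p.proj (dproj 𝓘(ℝ, B) F V p ξ) := by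
  obtain ⟨q, w⟩ := p
  set e := trivializationAt F V q₀ with he
  change q ∈ e.baseSet at hp
  set f := (e ⟨q, w⟩).2 with hf
  let D : TangentSpace (𝓘(ℝ, B).prod 𝓘(ℝ, F)) (⟨q, w⟩ : TotalSpace F V) →L[ℝ] F :=
    mfderiv (𝓘(ℝ, B).prod 𝓘(ℝ, F)) 𝓘(ℝ, F) (fun z : TotalSpace F V ↦ (e z).2) ⟨q, w⟩
  suffices h : (connector cov ⟨q, w⟩).toLinearMap = (e.symmL ℝ q ∘L D
      + cov (constSection q₀ f) q ∘L dproj 𝓘(ℝ, B) F V ⟨q, w⟩).toLinearMap from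
    LinearMap.congr_fun h ξ
  -- A non-vertical `ξ` is the velocity of a section `Y`, chosen as a perturbation of the section
  -- constant in the given trivialization; both sides can then be computed from `Y`.
  refine linearMap_ext_of_dproj_ne_zero fun ξ hξ ↦ ?_
  have hY₀ : constSection q₀ f q = w := constSection_trivializationAt hp w
  obtain ⟨l, hl, hl0, hl1, Y, hYdef, hYq, hYd, hYξ⟩ := exists_section_mfderiv_eq cov
    (constSection q₀ f) (mdifferentiableAt_constSection hp f) hY₀ ξ hξ
  set v := dproj 𝓘(ℝ, B) F V ⟨q, w⟩ ξ with hv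
  set z := connector cov ⟨q, w⟩ ξ - cov (constSection q₀ f) q v with hz
  have hlin {x : N} (hx : x ∈ e.baseSet) (w : V x) :
      (e ⟨x, w⟩).2 = e.continuousLinearMapAt ℝ x w := by
    rw [e.continuousLinearMapAt_apply (R := ℝ), e.coe_linearMapAt_of_mem hx]
  let c (x : N) : F := (e ⟨x, FiberBundle.extend F z x⟩).2
  have hc : MDifferentiableAt 𝓘(ℝ, B) 𝓘(ℝ, F) c q :=
    (e.mdifferentiableAt_section_iff 𝓘(ℝ, B) (FiberBundle.extend F z) hp).1
      (FiberBundle.mdifferentiableAt_extend 𝓘(ℝ, B) F z)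
  -- Only `l • c` varies, and `l` vanishes at `q`, so the derivative along `v` is `c q`, the
  -- coordinate of `z`.
  have hcoord : (fun x ↦ (e ⟨x, Y x⟩).2) =ᶠ[𝓝 q] (fun _ ↦ f) + l • c := by
    filter_upwards [e.open_baseSet.mem_nhds hp] with x hx
    have h1 := trivializationAt_constSection (V := V) hx f
    rw [← he, hlin hx] at h1
    simp only [Pi.add_apply, Pi.smul_apply', c]
    rw [hYdef, hlin hx, hlin hx, Pi.add_apply, Pi.smul_apply', map_add, map_smul, h1]
  have hD : D ξ = e.continuousLinearMapAt ℝ q z := by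
    have h2 : mfderiv 𝓘(ℝ, B) 𝓘(ℝ, F) (fun x ↦ (e ⟨x, Y x⟩).2) q v = D ξ := by
      subst hYq
      have := mfderiv_comp (I := 𝓘(ℝ, B)) (I' := 𝓘(ℝ, B).prod 𝓘(ℝ, F)) (I'' := 𝓘(ℝ, F)) q
        (g := fun z : TotalSpace F V ↦ (e z).2) (f := fun x ↦ TotalSpace.mk' F x (Y x))
        (mdifferentiableAt_fibreCoord hp) hYd
      refine (congrArg (fun L ↦ L v) this).trans ?_
      change D (mfderiv 𝓘(ℝ, B) (𝓘(ℝ, B).prod 𝓘(ℝ, F)) (fun x ↦ TotalSpace.mk' F x (Y x)) q v) = _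
      exact congrArg D hYξ
    rw [← h2, hcoord.mfderiv_eq]
    have h3 := mvfderiv_add (I := 𝓘(ℝ, B)) (g := fun _ : N ↦ f) (g' := l • c)
      (x := q) mdifferentiableAt_const (hl.smul hc)
    have h4 := mvfderiv_smul hl hc
    have h5 : mvfderiv 𝓘(ℝ, B) ((fun _ ↦ f) + l • c) q v = e.continuousLinearMapAt ℝ q z := by
      have h6 : mvfderiv 𝓘(ℝ, B) (fun _ : N ↦ f) q v = 0 := by
        change mfderiv 𝓘(ℝ, B) 𝓘(ℝ, F) (fun _ : N ↦ f) q v = 0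
        rw [mfderiv_const]
        rfl
      rw [h3, h4]
      simp [h6, hl0, hl1, c, hlin hp]
    exact h5
  change connector cov ⟨q, w⟩ ξ = e.symmL ℝ q (D ξ) + cov (constSection q₀ f) q v
  rw [hD, e.symmL_continuousLinearMapAt hp, hz]
  abel

section Metric

variable [IsContMDiffRiemannianBundle 𝓘(ℝ, B) 1 F V]

theorem mdifferentiableAt_normSq (p : TotalSpace F V) :
    MDifferentiableAt (𝓘(ℝ, B).prod 𝓘(ℝ, F)) 𝓘(ℝ, ℝ) (fun z : TotalSpace F V ↦ inner ℝ z.2 z.2)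
      p :=
  MDifferentiableAt.inner_bundle (b := fun z : TotalSpace F V ↦ z.proj) (v := fun z ↦ z.2)
    (w := fun z ↦ z.2) (IB := 𝓘(ℝ, B)) (F := F) mdifferentiableAt_id mdifferentiableAt_id

/-- For a metric connection the derivative of the squared norm is given by the connector. -/
theorem mfderiv_normSq {cov : CovariantDerivative 𝓘(ℝ, B) F V} (hcov : cov.IsMetricCompatible)
    (p : TotalSpace F V) (ξ : TangentSpace (𝓘(ℝ, B).prod 𝓘(ℝ, F)) p) :
    mfderiv (𝓘(ℝ, B).prod 𝓘(ℝ, F)) 𝓘(ℝ, ℝ) (fun z : TotalSpace F V ↦ inner ℝ z.2 z.2) p ξ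
      = 2 * inner ℝ (connector cov p ξ) p.2 := by
  obtain ⟨q, w⟩ := p
  let D : TangentSpace (𝓘(ℝ, B).prod 𝓘(ℝ, F)) (⟨q, w⟩ : TotalSpace F V) →L[ℝ] ℝ :=
    mfderiv (𝓘(ℝ, B).prod 𝓘(ℝ, F)) 𝓘(ℝ, ℝ) (fun z : TotalSpace F V ↦ inner ℝ z.2 z.2) ⟨q, w⟩
  suffices h : D.toLinearMap = ((2 : ℝ) • (innerSL ℝ w ∘L connector cov ⟨q, w⟩)).toLinearMap by
    have := LinearMap.congr_fun h ξ
    change D ξ = 2 * inner ℝ w (connector cov ⟨q, w⟩ ξ) at this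
    rwa [real_inner_comm] at this
  refine linearMap_ext_of_dproj_ne_zero fun ξ hξ ↦ ?_
  obtain ⟨l, hl, hl0, hl1, Y, hYdef, hYq, hYd, hYξ⟩ := exists_section_mfderiv_eq cov
    (FiberBundle.extend F w) (FiberBundle.mdifferentiableAt_extend 𝓘(ℝ, B) F w)
    (FiberBundle.extend_apply_self F w) ξ hξ
  set v := dproj 𝓘(ℝ, B) F V ⟨q, w⟩ ξ with hv
  have hK : connector cov ⟨q, w⟩ ξ = cov Y q v := by
    rw [← connector_mfderiv_section_of_eq cov hYq hYd v]
    exact congrArg (connector cov ⟨q, w⟩) hYξ.symm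
  classical
  -- Compatibility is phrased with a vector field but only uses its value at `q`, so the field equal
  -- to `v` at `q` and zero elsewhere will do.
  have h1 := hcov.mvfderiv_inner_eq (Function.update 0 q v) hYd hYd
  simp only [Function.update_self] at h1
  change D ξ = 2 * inner ℝ w (connector cov ⟨q, w⟩ ξ)
  have h2 : D ξ = mvfderiv 𝓘(ℝ, B) (fun x ↦ inner ℝ (Y x) (Y x)) q v := by
    subst hYq
    have := mfderiv_comp (I := 𝓘(ℝ, B)) (I' := 𝓘(ℝ, B).prod 𝓘(ℝ, F)) (I'' := 𝓘(ℝ, ℝ)) q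
      (g := fun z : TotalSpace F V ↦ inner ℝ z.2 z.2) (f := fun x ↦ TotalSpace.mk' F x (Y x))
      (mdifferentiableAt_normSq _) hYd
    refine Eq.trans ?_ (congrArg (fun L ↦ L v) this).symm
    change _ = D (mfderiv 𝓘(ℝ, B) (𝓘(ℝ, B).prod 𝓘(ℝ, F)) (fun x ↦ TotalSpace.mk' F x (Y x)) q v)
    exact congrArg D hYξ.symm
  rw [h2, h1, hK, hYq, real_inner_comm]
  ring

end Metric

end

end Pointwise

/-! ### Covariant differentiation along curves -/

section AlongCurves

variable {B : Type*} [NormedAddCommGroup B] [NormedSpace ℝ B]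
  {N : Type*} [TopologicalSpace N] [ChartedSpace B N] [IsManifold 𝓘(ℝ, B) ∞ N] [Nontrivial B]
  {F : Type*} [NormedAddCommGroup F] [NormedSpace ℝ F] [FiniteDimensional ℝ F]
  {V : N → Type*} [TopologicalSpace (TotalSpace F V)]
  [∀ x, NormedAddCommGroup (V x)] [∀ x, InnerProductSpace ℝ (V x)]
  [FiberBundle F V] [VectorBundle ℝ F V] [ContMDiffVectorBundle 1 F V 𝓘(ℝ, B)]

theorem constSection_add (q₀ : N) (f g : F) :
    constSection (V := V) q₀ (f + g) = constSection q₀ f + constSection q₀ g := by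
  ext x
  exact map_add ((trivializationAt F V q₀).symmL ℝ x) f g

theorem constSection_smul (q₀ : N) (c : ℝ) (f : F) :
    constSection (V := V) q₀ (c • f) = c • constSection q₀ f := by
  ext x
  exact map_smul ((trivializationAt F V q₀).symmL ℝ x) c f

theorem cov_constSection_add (cov : CovariantDerivative 𝓘(ℝ, B) F V) {q₀ x : N}
    (hx : x ∈ (trivializationAt F V q₀).baseSet) (f g : F) :
    cov (constSection q₀ (f + g)) x = cov (constSection q₀ f) x + cov (constSection q₀ g) x := by
  rw [constSection_add]
  exact cov.isCovariantDerivativeOn.add (mdifferentiableAt_constSection hx f)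
    (mdifferentiableAt_constSection hx g) (mem_univ x)

theorem cov_constSection_smul (cov : CovariantDerivative 𝓘(ℝ, B) F V) {q₀ x : N}
    (hx : x ∈ (trivializationAt F V q₀).baseSet) (c : ℝ) (f : F) :
    cov (constSection q₀ (c • f)) x = c • cov (constSection q₀ f) x := by
  rw [constSection_smul]
  exact cov.isCovariantDerivativeOn.smul_const c (mdifferentiableAt_constSection hx f)
    (mem_univ x)

theorem trivializationAt_eq_continuousLinearMapAt {q₀ x : N}
    (hx : x ∈ (trivializationAt F V q₀).baseSet) (w : V x) :
    (trivializationAt F V q₀ ⟨x, w⟩).2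
      = (trivializationAt F V q₀).continuousLinearMapAt ℝ x w := by
  rw [Trivialization.continuousLinearMapAt_apply (R := ℝ), Trivialization.coe_linearMapAt_of_mem _ hx]

variable {γ : ℝ → N} {t : ℝ}

theorem mdifferentiableAt_curve_iff {f : ∀ s, V (γ s)} {q₀ : N}
    (hq : γ t ∈ (trivializationAt F V q₀).baseSet) :
    MDifferentiableAt 𝓘(ℝ, ℝ) (𝓘(ℝ, B).prod 𝓘(ℝ, F)) (fun s ↦ TotalSpace.mk' F (γ s) (f s)) t ↔
      MDifferentiableAt 𝓘(ℝ, ℝ) 𝓘(ℝ, B) γ t ∧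
        DifferentiableAt ℝ (fun s ↦ (trivializationAt F V q₀ ⟨γ s, f s⟩).2) t := by
  rw [(trivializationAt F V q₀).mdifferentiableAt_totalSpace_iff 𝓘(ℝ, B),
    mdifferentiableAt_iff_differentiableAt (f := fun s ↦ (trivializationAt F V q₀ ⟨γ s, f s⟩).2)]
  rwa [Trivialization.mem_source]

theorem dproj_mfderiv_curve {α : ℝ → TotalSpace F V}
    (hα : MDifferentiableAt 𝓘(ℝ, ℝ) (𝓘(ℝ, B).prod 𝓘(ℝ, F)) α t) :
    dproj 𝓘(ℝ, B) F V (α t) (mfderiv 𝓘(ℝ, ℝ) (𝓘(ℝ, B).prod 𝓘(ℝ, F)) α t (1 : ℝ))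
      = mfderiv 𝓘(ℝ, ℝ) 𝓘(ℝ, B) (fun s ↦ (α s).proj) t (1 : ℝ) := by
  have := mfderiv_comp (I := 𝓘(ℝ, ℝ)) (I' := 𝓘(ℝ, B).prod 𝓘(ℝ, F)) (I'' := 𝓘(ℝ, B)) t
    (g := (TotalSpace.proj : TotalSpace F V → N)) (f := α) (mdifferentiableAt_proj V) hα
  exact (congrArg (fun L ↦ L (1 : ℝ)) this).symm

/-- The covariant derivative along a curve in a trivialization. -/
theorem covDerivAlong_eq (cov : CovariantDerivative 𝓘(ℝ, B) F V) {α : ℝ → TotalSpace F V} {q₀ : N}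
    (hq : (α t).proj ∈ (trivializationAt F V q₀).baseSet)
    (hα : MDifferentiableAt 𝓘(ℝ, ℝ) (𝓘(ℝ, B).prod 𝓘(ℝ, F)) α t) :
    covDerivAlong cov α t = (trivializationAt F V q₀).symmL ℝ (α t).proj
        (deriv (fun s ↦ (trivializationAt F V q₀ (α s)).2) t)
      + cov (constSection q₀ (trivializationAt F V q₀ (α t)).2) (α t).proj
        (mfderiv 𝓘(ℝ, ℝ) 𝓘(ℝ, B) (fun s ↦ (α s).proj) t (1 : ℝ)) := by
  rw [covDerivAlong, connector_eq_of_mem_baseSet cov hq, dproj_mfderiv_curve hα]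
  congr 2
  have := mfderiv_comp (I := 𝓘(ℝ, ℝ)) (I' := 𝓘(ℝ, B).prod 𝓘(ℝ, F)) (I'' := 𝓘(ℝ, F)) t
    (g := fun z : TotalSpace F V ↦ (trivializationAt F V q₀ z).2) (f := α)
    (mdifferentiableAt_fibreCoord hq) hα
  refine (congrArg (fun L ↦ L (1 : ℝ)) this).symm.trans ?_
  change mfderiv 𝓘(ℝ, ℝ) 𝓘(ℝ, F) (fun s ↦ (trivializationAt F V q₀ (α s)).2) t (1 : ℝ) = _
  rw [mfderiv_eq_fderiv]
  rfl

/-- In a trivialization `D/dt` is the ordinary derivative of the fibre coordinate plus a term linear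
in that coordinate, whence the Leibniz rule. The two-term form serves both the difference `f - g`
and the interpolation `X + c • Y`. -/
theorem MDifferentiableAt.linear_combination_curve {f g : ∀ s, V (γ s)} {a b : ℝ → ℝ}
    (ha : DifferentiableAt ℝ a t) (hb : DifferentiableAt ℝ b t)
    (hf : MDifferentiableAt 𝓘(ℝ, ℝ) (𝓘(ℝ, B).prod 𝓘(ℝ, F)) (fun s ↦ TotalSpace.mk' F (γ s) (f s)) t)
    (hg : MDifferentiableAt 𝓘(ℝ, ℝ) (𝓘(ℝ, B).prod 𝓘(ℝ, F)) (fun s ↦ TotalSpace.mk' F (γ s) (g s)) t) :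
    MDifferentiableAt 𝓘(ℝ, ℝ) (𝓘(ℝ, B).prod 𝓘(ℝ, F))
      (fun s ↦ TotalSpace.mk' F (γ s) (a s • f s + b s • g s)) t ∧
    ∀ cov : CovariantDerivative 𝓘(ℝ, B) F V,
      covDerivAlong cov (fun s ↦ TotalSpace.mk' F (γ s) (a s • f s + b s • g s)) t
        = (deriv a t • f t + a t • covDerivAlong cov (fun s ↦ TotalSpace.mk' F (γ s) (f s)) t)
        + (deriv b t • g t + b t • covDerivAlong cov (fun s ↦ TotalSpace.mk' F (γ s) (g s)) t) := by
  set e := trivializationAt F V (γ t) with he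
  have hq : γ t ∈ e.baseSet := FiberBundle.mem_baseSet_trivializationAt' (γ t)
  have hf' := (mdifferentiableAt_curve_iff hq).1 hf
  have hg' := (mdifferentiableAt_curve_iff hq).1 hg
  have hcoord : (fun s ↦ (e ⟨γ s, a s • f s + b s • g s⟩).2) =ᶠ[𝓝 t]
      fun s ↦ a s • (e ⟨γ s, f s⟩).2 + b s • (e ⟨γ s, g s⟩).2 := by
    filter_upwards [hf'.1.continuousAt.preimage_mem_nhds (e.open_baseSet.mem_nhds hq)] with s hs
    rw [trivializationAt_eq_continuousLinearMapAt hs, trivializationAt_eq_continuousLinearMapAt hs,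
      trivializationAt_eq_continuousLinearMapAt hs, map_add, map_smul, map_smul]
  have hd := ((ha.hasDerivAt.smul hf'.2.hasDerivAt).add (hb.hasDerivAt.smul hg'.2.hasDerivAt))
  have hd' := hd.congr_of_eventuallyEq hcoord
  have hsum := (mdifferentiableAt_curve_iff (f := fun s ↦ a s • f s + b s • g s) hq).2
    ⟨hf'.1, hd'.differentiableAt⟩
  refine ⟨hsum, fun cov ↦ ?_⟩
  have hinv (w : V (γ t)) : e.symmL ℝ (γ t) (e ⟨γ t, w⟩).2 = w := by
    rw [trivializationAt_eq_continuousLinearMapAt hq, Trivialization.symmL_continuousLinearMapAt _ hq]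
  rw [covDerivAlong_eq cov (q₀ := γ t) hq hsum, covDerivAlong_eq cov (q₀ := γ t) hq hf,
    covDerivAlong_eq cov (q₀ := γ t) hq hg]
  change e.symmL ℝ (γ t) (deriv (fun s ↦ (e ⟨γ s, a s • f s + b s • g s⟩).2) t)
    + cov (constSection (γ t) (e ⟨γ t, a t • f t + b t • g t⟩).2) (γ t)
      (mfderiv 𝓘(ℝ, ℝ) 𝓘(ℝ, B) γ t (1 : ℝ))
    = (deriv a t • f t + a t • (e.symmL ℝ (γ t) (deriv (fun s ↦ (e ⟨γ s, f s⟩).2) t)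
        + cov (constSection (γ t) (e ⟨γ t, f t⟩).2) (γ t)
          (mfderiv 𝓘(ℝ, ℝ) 𝓘(ℝ, B) γ t (1 : ℝ))))
      + (deriv b t • g t + b t • (e.symmL ℝ (γ t) (deriv (fun s ↦ (e ⟨γ s, g s⟩).2) t)
        + cov (constSection (γ t) (e ⟨γ t, g t⟩).2) (γ t)
          (mfderiv 𝓘(ℝ, ℝ) 𝓘(ℝ, B) γ t (1 : ℝ))))
  have hval : (e ⟨γ t, a t • f t + b t • g t⟩).2
    = a t • (e ⟨γ t, f t⟩).2 + b t • (e ⟨γ t, g t⟩).2 := hcoord.self_of_nhds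
  rw [hd'.deriv, hval, cov_constSection_add cov hq, cov_constSection_smul cov hq,
    cov_constSection_smul cov hq]
  simp only [← he, map_add, map_smul, hinv, _root_.add_apply, _root_.smul_apply]
  module

section Metric

variable [IsContMDiffRiemannianBundle 𝓘(ℝ, B) 1 F V]

theorem hasDerivAt_inner_self {cov : CovariantDerivative 𝓘(ℝ, B) F V}
    (hcov : cov.IsMetricCompatible) {α : ℝ → TotalSpace F V}
    (hα : MDifferentiableAt 𝓘(ℝ, ℝ) (𝓘(ℝ, B).prod 𝓘(ℝ, F)) α t) :
    HasDerivAt (fun s ↦ inner ℝ (α s).2 (α s).2) (2 * inner ℝ (covDerivAlong cov α t) (α t).2) t := by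
  have h1 := HasMFDerivAt.comp t (mdifferentiableAt_normSq (B := B) (α t)).hasMFDerivAt
    hα.hasMFDerivAt
  have h2 : HasFDerivAt (fun s ↦ inner ℝ (α s).2 (α s).2 : ℝ → ℝ) (_ : ℝ →L[ℝ] ℝ) t :=
    hasMFDerivAt_iff_hasFDerivAt.1 h1
  have h3 := h2.hasDerivAt
  convert h3 using 1
  exact (mfderiv_normSq hcov (α t) _).symm

end Metric

end AlongCurves

/-! ### Continuity of the connection form, the connector and the Sasaki norm -/

section Continuity

variable {B : Type*} [NormedAddCommGroup B] [NormedSpace ℝ B] [FiniteDimensional ℝ B] [Nontrivial B]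
  {N : Type*} [TopologicalSpace N] [T2Space N] [ChartedSpace B N] [IsManifold 𝓘(ℝ, B) ∞ N]
  {F : Type*} [NormedAddCommGroup F] [NormedSpace ℝ F] [FiniteDimensional ℝ F]
  {V : N → Type*} [TopologicalSpace (TotalSpace F V)]
  [∀ x, NormedAddCommGroup (V x)] [∀ x, InnerProductSpace ℝ (V x)]
  [FiberBundle F V] [VectorBundle ℝ F V] [ContMDiffVectorBundle ∞ F V 𝓘(ℝ, B)]

/-- The covariant derivative of a section that is constant in a trivialization is continuous as a
function on the tangent bundle. -/
theorem continuousAt_cov_constSection {cov : CovariantDerivative 𝓘(ℝ, B) F V}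
    (hcov : cov.ContMDiffCovariantDerivative ∞) {q₀ : N} (f : F) {v₀ : TangentBundle 𝓘(ℝ, B) N}
    (hv₀ : v₀.proj ∈ (trivializationAt F V q₀).baseSet) :
    ContinuousAt (fun v : TangentBundle 𝓘(ℝ, B) N ↦
      TotalSpace.mk' F v.proj (cov (constSection q₀ f) v.proj v.2)) v₀ := by
  set S := (trivializationAt F V q₀).baseSet with hS
  have hSo : IsOpen S := (trivializationAt F V q₀).open_baseSet
  -- Smoothness of `∇` is applied to global sections, so the local section is cut off by a bump
  -- function `ρ`. As `∇` is local, nothing changes at points near which `ρ = 1`.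
  obtain ⟨ρ, -, hρ⟩ := (SmoothBumpFunction.nhds_basis_tsupport (I := 𝓘(ℝ, B)) v₀.proj).mem_iff.1
    (hSo.mem_nhds hv₀)
  have hσ : ContMDiff 𝓘(ℝ, B) (𝓘(ℝ, B).prod 𝓘(ℝ, F)) ∞
      (fun x ↦ TotalSpace.mk' F x ((⇑ρ • constSection (V := V) q₀ f) x)) :=
    ContMDiffOn.smul_section_of_tsupport ρ.contMDiff.contMDiffOn hSo hρ
      (contMDiffOn_constSection q₀ f)
  have h1 := hcov.contMDiff.contMDiff (σ := ⇑ρ • constSection (V := V) q₀ f) hσ.contMDiffOn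
  have h2 := (contMDiffOn_univ.1 h1).comp (contMDiff_proj (IB := 𝓘(ℝ, B)) (F := B)
    (TangentSpace 𝓘(ℝ, B) : N → Type _))
  have h3 : ContMDiff (𝓘(ℝ, B).prod 𝓘(ℝ, B)) (𝓘(ℝ, B).prod 𝓘(ℝ, B)) ∞
    (fun v : TangentBundle 𝓘(ℝ, B) N ↦ TotalSpace.mk' B v.proj v.2) := contMDiff_id
  have h4 := (ContMDiff.clm_bundle_apply h2 h3).continuous.continuousAt (x := v₀)
  refine h4.congr ?_
  have h5 : ∀ᶠ x in 𝓝 v₀.proj, ∀ᶠ y in 𝓝 x, ρ y = 1 := ρ.eventuallyEq_one.eventually_nhds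
  have h6 : ContinuousAt (TotalSpace.proj : TangentBundle 𝓘(ℝ, B) N → N) v₀ :=
    (FiberBundle.continuous_proj B (TangentSpace 𝓘(ℝ, B) : N → Type _)).continuousAt
  filter_upwards [h6.eventually h5, h6.eventually (hSo.mem_nhds hv₀)] with v hv hvS
  have h7 : cov (⇑ρ • constSection q₀ f) v.proj = cov (constSection q₀ f) v.proj := by
    refine cov.isCovariantDerivativeOnUniv.congr_of_eventuallyEq
      ((hσ _).mdifferentiableAt (by simp)) (mdifferentiableAt_constSection hvS f)
      Filter.univ_mem ?_
    filter_upwards [hv] with y hy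
    simp [hy]
  exact congrArg (fun L ↦ TotalSpace.mk' F v.proj (L v.2)) h7

/-- In a trivialization the connection form depends continuously on tangent vectors. -/
theorem continuousAt_trivializationAt_cov_constSection {cov : CovariantDerivative 𝓘(ℝ, B) F V}
    (hcov : cov.ContMDiffCovariantDerivative ∞) {q₀ : N} (f : F) {v₀ : TangentBundle 𝓘(ℝ, B) N}
    (hv₀ : v₀.proj ∈ (trivializationAt F V q₀).baseSet) :
    ContinuousAt (fun v : TangentBundle 𝓘(ℝ, B) N ↦
      (trivializationAt F V q₀ ⟨v.proj, cov (constSection q₀ f) v.proj v.2⟩).2) v₀ := by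
  have h1 := continuousAt_cov_constSection hcov f hv₀
  have h2 : ContinuousAt (trivializationAt F V q₀)
      (TotalSpace.mk' F v₀.proj (cov (constSection q₀ f) v₀.proj v₀.2)) :=
    (trivializationAt F V q₀).continuousOn.continuousAt
      ((trivializationAt F V q₀).open_source.mem_nhds (by rwa [Trivialization.mem_source]))
  exact (ContinuousAt.comp (f := fun v : TangentBundle 𝓘(ℝ, B) N ↦
    TotalSpace.mk' F v.proj (cov (constSection q₀ f) v.proj v.2)) h2 h1).snd

/-- The connection form of a connection in a trivialization. -/
def connectionForm (cov : CovariantDerivative 𝓘(ℝ, B) F V) (q₀ : N)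
    (v : TangentBundle 𝓘(ℝ, B) N) : F →L[ℝ] F :=
  ∑ i, ((Module.finBasis ℝ F).coord i).toContinuousLinearMap.smulRight
    (trivializationAt F V q₀ ⟨v.proj, cov (constSection q₀ (Module.finBasis ℝ F i)) v.proj v.2⟩).2

theorem connectionForm_apply (cov : CovariantDerivative 𝓘(ℝ, B) F V) {q₀ : N}
    {v : TangentBundle 𝓘(ℝ, B) N} (hv : v.proj ∈ (trivializationAt F V q₀).baseSet) (f : F) :
    connectionForm cov q₀ v f
      = (trivializationAt F V q₀ ⟨v.proj, cov (constSection q₀ f) v.proj v.2⟩).2 := by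
  let L : F →ₗ[ℝ] F :=
    { toFun := fun f ↦ (trivializationAt F V q₀ ⟨v.proj, cov (constSection q₀ f) v.proj v.2⟩).2
      map_add' := fun f g ↦ by
        rw [cov_constSection_add cov hv, _root_.add_apply,
          trivializationAt_eq_continuousLinearMapAt hv,
          trivializationAt_eq_continuousLinearMapAt hv,
          trivializationAt_eq_continuousLinearMapAt hv, map_add]
      map_smul' := fun c f ↦ by
        rw [cov_constSection_smul cov hv, _root_.smul_apply,
          trivializationAt_eq_continuousLinearMapAt hv,
          trivializationAt_eq_continuousLinearMapAt hv, map_smul, RingHom.id_apply] }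
  change _ = L f
  conv_rhs => rw [← (Module.finBasis ℝ F).sum_repr f, map_sum]
  simp only [connectionForm, _root_.sum_apply, map_smul]
  rfl

theorem continuousAt_connectionForm {cov : CovariantDerivative 𝓘(ℝ, B) F V}
    (hcov : cov.ContMDiffCovariantDerivative ∞) {q₀ : N} {v₀ : TangentBundle 𝓘(ℝ, B) N}
    (hv₀ : v₀.proj ∈ (trivializationAt F V q₀).baseSet) :
    ContinuousAt (connectionForm cov q₀) v₀ := by
  unfold connectionForm
  -- The basis expansion reduces continuity in operator norm to finitely many constant sections.
  refine tendsto_finsetSum _ fun i _ ↦ ?_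
  have h := continuousAt_trivializationAt_cov_constSection hcov (Module.finBasis ℝ F i) hv₀
  exact ((ContinuousLinearMap.smulRightL ℝ F F
    ((Module.finBasis ℝ F).coord i).toContinuousLinearMap).continuous.tendsto _).comp h

theorem continuousAt_mfderiv_fibreCoord {q₀ : N}
    {ξ₀ : TangentBundle (𝓘(ℝ, B).prod 𝓘(ℝ, F)) (TotalSpace F V)}
    (h : ξ₀.proj.proj ∈ (trivializationAt F V q₀).baseSet) :
    ContinuousAt (fun ξ : TangentBundle (𝓘(ℝ, B).prod 𝓘(ℝ, F)) (TotalSpace F V) ↦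
      (mfderiv (𝓘(ℝ, B).prod 𝓘(ℝ, F)) 𝓘(ℝ, F)
        (fun z : TotalSpace F V ↦ (trivializationAt F V q₀ z).2) ξ.proj ξ.2 : F)) ξ₀ := by
  set e := trivializationAt F V q₀ with he
  have hc : ContMDiffOn (𝓘(ℝ, B).prod 𝓘(ℝ, F)) 𝓘(ℝ, F) 1 (fun z : TotalSpace F V ↦ (e z).2)
      e.source := fun z hz ↦ (e.contMDiffOn (IB := 𝓘(ℝ, B)) (n := 1) z hz).snd
  have h1 := hc.continuousOn_tangentMapWithin le_rfl e.open_source.uniqueMDiffOn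
  have hopen : IsOpen (TotalSpace.proj ⁻¹' e.source :
      Set (TangentBundle (𝓘(ℝ, B).prod 𝓘(ℝ, F)) (TotalSpace F V))) :=
    e.open_source.preimage (FiberBundle.continuous_proj _ _)
  have hmem : ξ₀ ∈ (TotalSpace.proj ⁻¹' e.source :
      Set (TangentBundle (𝓘(ℝ, B).prod 𝓘(ℝ, F)) (TotalSpace F V))) := by
    rwa [mem_preimage, Trivialization.mem_source]
  have h2 := h1.continuousAt (hopen.mem_nhds hmem)
  have h3 := (contMDiff_snd_tangentBundle_modelSpace (n := 0) F 𝓘(ℝ, F)).continuous.continuousAt.comp h2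
  refine h3.congr ?_
  filter_upwards [hopen.mem_nhds hmem] with ξ hξ
  simp only [Function.comp, tangentMapWithin]
  rw [mfderivWithin_of_isOpen e.open_source hξ]

theorem continuous_dproj : Continuous (fun ξ : TangentBundle (𝓘(ℝ, B).prod 𝓘(ℝ, F)) (TotalSpace F V) ↦
    (⟨ξ.proj.proj, dproj 𝓘(ℝ, B) F V ξ.proj ξ.2⟩ : TangentBundle 𝓘(ℝ, B) N)) :=
  (contMDiff_proj (n := 1) (IB := 𝓘(ℝ, B)) (F := F) V).continuous_tangentMap le_rfl

/-- In a trivialization the connector is the differential of the fibre coordinate plus the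
connection form applied to that coordinate, and both terms depend continuously on the tangent
vector. -/
theorem continuous_connector {cov : CovariantDerivative 𝓘(ℝ, B) F V}
    (hcov : cov.ContMDiffCovariantDerivative ∞) :
    Continuous (fun ξ : TangentBundle (𝓘(ℝ, B).prod 𝓘(ℝ, F)) (TotalSpace F V) ↦
      TotalSpace.mk' F ξ.proj.proj (connector cov ξ.proj ξ.2)) := by
  rw [continuous_iff_continuousAt]
  intro ξ₀
  rw [FiberBundle.continuousAt_totalSpace]
  have hp : Continuous (TotalSpace.proj :
      TangentBundle (𝓘(ℝ, B).prod 𝓘(ℝ, F)) (TotalSpace F V) → TotalSpace F V) :=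
    FiberBundle.continuous_proj _ _
  have hpp := (FiberBundle.continuous_proj F V).comp hp
  refine ⟨hpp.continuousAt, ?_⟩
  set q₀ := ξ₀.proj.proj with hq₀
  set e := trivializationAt F V q₀ with he
  have hmem : q₀ ∈ e.baseSet := FiberBundle.mem_baseSet_trivializationAt' q₀
  have h1 := continuousAt_mfderiv_fibreCoord (B := B) (ξ₀ := ξ₀) hmem
  have h2 : ContinuousAt (fun ξ : TangentBundle (𝓘(ℝ, B).prod 𝓘(ℝ, F)) (TotalSpace F V) ↦
      connectionForm cov q₀ ⟨ξ.proj.proj, dproj 𝓘(ℝ, B) F V ξ.proj ξ.2⟩) ξ₀ :=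
    ContinuousAt.comp (f := fun ξ : TangentBundle (𝓘(ℝ, B).prod 𝓘(ℝ, F)) (TotalSpace F V) ↦
      (⟨ξ.proj.proj, dproj 𝓘(ℝ, B) F V ξ.proj ξ.2⟩ : TangentBundle 𝓘(ℝ, B) N))
      (continuousAt_connectionForm hcov
        (v₀ := ⟨ξ₀.proj.proj, dproj 𝓘(ℝ, B) F V ξ₀.proj ξ₀.2⟩) hmem) continuous_dproj.continuousAt
  have h3 : ContinuousAt (fun ξ : TangentBundle (𝓘(ℝ, B).prod 𝓘(ℝ, F)) (TotalSpace F V) ↦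
      (e ξ.proj).2) ξ₀ := by
    have : ContinuousAt e ξ₀.proj := e.continuousOn.continuousAt
      (e.open_source.mem_nhds (by rwa [Trivialization.mem_source]))
    exact (ContinuousAt.comp (f := TotalSpace.proj) this hp.continuousAt).snd
  refine (h1.add (h2.clm_apply h3)).congr ?_
  filter_upwards [hpp.continuousAt.preimage_mem_nhds (e.open_baseSet.mem_nhds hmem)] with ξ hξ
  change ξ.proj.proj ∈ e.baseSet at hξ
  have h4 := connectionForm_apply cov (v := ⟨ξ.proj.proj, dproj 𝓘(ℝ, B) F V ξ.proj ξ.2⟩) hξ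
    (e ξ.proj).2
  have h5 := connector_eq_of_mem_baseSet cov hξ ξ.2
  have h6 : (e ⟨ξ.proj.proj, connector cov ξ.proj ξ.2⟩).2
      = (show F from mfderiv (𝓘(ℝ, B).prod 𝓘(ℝ, F)) 𝓘(ℝ, F)
        (fun z : TotalSpace F V ↦ (e z).2) ξ.proj ξ.2)
        + connectionForm cov q₀ ⟨ξ.proj.proj, dproj 𝓘(ℝ, B) F V ξ.proj ξ.2⟩ (e ξ.proj).2 := by
    rw [h4, h5, trivializationAt_eq_continuousLinearMapAt hξ, map_add,
      trivializationAt_eq_continuousLinearMapAt hξ]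
    exact congrArg₂ _ (Trivialization.continuousLinearMapAt_symmL _ hξ _)
      (trivializationAt_eq_continuousLinearMapAt hξ _).symm
  exact h6.symm

variable [RiemannianBundle (fun x : N ↦ TangentSpace 𝓘(ℝ, B) x)]
  [IsContMDiffRiemannianBundle 𝓘(ℝ, B) ∞ B (fun x : N ↦ TangentSpace 𝓘(ℝ, B) x)]
  [IsContMDiffRiemannianBundle 𝓘(ℝ, B) ∞ F V]

theorem continuous_inner_dproj_add_inner_connector {cov : CovariantDerivative 𝓘(ℝ, B) F V}
    (hcov : cov.ContMDiffCovariantDerivative ∞) :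
    Continuous (fun ξ : TangentBundle (𝓘(ℝ, B).prod 𝓘(ℝ, F)) (TotalSpace F V) ↦
      inner ℝ (dproj 𝓘(ℝ, B) F V ξ.proj ξ.2) (dproj 𝓘(ℝ, B) F V ξ.proj ξ.2)
        + inner ℝ (connector cov ξ.proj ξ.2) (connector cov ξ.proj ξ.2)) := by
  have h1 : ContMDiff ((𝓘(ℝ, B).prod 𝓘(ℝ, F)).tangent) (𝓘(ℝ, B).prod 𝓘(ℝ, B)) 0
      (fun ξ : TangentBundle (𝓘(ℝ, B).prod 𝓘(ℝ, F)) (TotalSpace F V) ↦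
        TotalSpace.mk' B ξ.proj.proj (dproj 𝓘(ℝ, B) F V ξ.proj ξ.2)) :=
    contMDiff_zero_iff.2 continuous_dproj
  have h2 : ContMDiff ((𝓘(ℝ, B).prod 𝓘(ℝ, F)).tangent) (𝓘(ℝ, B).prod 𝓘(ℝ, F)) 0
      (fun ξ : TangentBundle (𝓘(ℝ, B).prod 𝓘(ℝ, F)) (TotalSpace F V) ↦
        TotalSpace.mk' F ξ.proj.proj (connector cov ξ.proj ξ.2)) :=
    contMDiff_zero_iff.2 (continuous_connector hcov)
  have h3 := ContMDiff.inner_bundle (IB := 𝓘(ℝ, B)) (n := 0) (F := B)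
    (E := fun x : N ↦ TangentSpace 𝓘(ℝ, B) x) (IM := (𝓘(ℝ, B).prod 𝓘(ℝ, F)).tangent)
    (b := fun ξ : TangentBundle (𝓘(ℝ, B).prod 𝓘(ℝ, F)) (TotalSpace F V) ↦ ξ.proj.proj)
    (v := fun ξ ↦ dproj 𝓘(ℝ, B) F V ξ.proj ξ.2) (w := fun ξ ↦ dproj 𝓘(ℝ, B) F V ξ.proj ξ.2)
  exact (h3 h1 h1).continuous.add (h2.inner_bundle h2).continuous

end Continuity

/-! ### Existence of parallel sections -/

section ParallelExistence

variable {B : Type*} [NormedAddCommGroup B] [NormedSpace ℝ B] [FiniteDimensional ℝ B] [Nontrivial B]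
  {N : Type*} [TopologicalSpace N] [T2Space N] [ChartedSpace B N] [IsManifold 𝓘(ℝ, B) ∞ N]
  {F : Type*} [NormedAddCommGroup F] [NormedSpace ℝ F] [FiniteDimensional ℝ F]
  {V : N → Type*} [TopologicalSpace (TotalSpace F V)]
  [∀ x, NormedAddCommGroup (V x)] [∀ x, InnerProductSpace ℝ (V x)]
  [FiberBundle F V] [VectorBundle ℝ F V] [ContMDiffVectorBundle ∞ F V 𝓘(ℝ, B)]

variable (F) in
/-- The curve in the total space given by a section along a curve in the base. -/
abbrev sectionCurve {γ : ℝ → N} (f : ∀ t, V (γ t)) (t : ℝ) : TotalSpace F V := ⟨γ t, f t⟩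

/-- The two derivatives lie in fibres over points that are only propositionally equal; stating
locality for vanishing avoids transport between fibres. -/
theorem covDerivAlong_eq_zero_congr {cov : CovariantDerivative 𝓘(ℝ, B) F V}
    {α β : ℝ → TotalSpace F V} {t : ℝ} (h : α =ᶠ[𝓝 t] β) (hα : covDerivAlong cov α t = 0) :
    covDerivAlong cov β t = 0 := by
  have key : ∀ (p p' : TotalSpace F V) (_ : p = p') (ξ : B × F),
      connector cov p (show TangentSpace (𝓘(ℝ, B).prod 𝓘(ℝ, F)) p from ξ) = 0 →
      connector cov p' (show TangentSpace (𝓘(ℝ, B).prod 𝓘(ℝ, F)) p' from ξ) = 0 := by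
    rintro p _ rfl ξ h
    exact h
  have h1 := key _ _ h.self_of_nhds _ hα
  have h2 := congrArg (fun L : ℝ →L[ℝ] B × F ↦ L 1) (h.mfderiv_eq (I := 𝓘(ℝ, ℝ)) (I' := 𝓘(ℝ, B).prod 𝓘(ℝ, F)))
  have h3 : connector cov (β t) (show TangentSpace (𝓘(ℝ, B).prod 𝓘(ℝ, F)) (β t) from
    mfderiv 𝓘(ℝ, ℝ) (𝓘(ℝ, B).prod 𝓘(ℝ, F)) α t (1 : ℝ)) = 0 := h1
  exact (congrArg (connector cov (β t)) h2.symm).trans h3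

variable {γ : ℝ → N} {a b : ℝ}

variable (cov : CovariantDerivative 𝓘(ℝ, B) F V) in
/-- Sections along a curve that are piecewise `C^1` and parallel. -/
def IsParallelSection (f : ∀ t, V (γ t)) (a b : ℝ) : Prop :=
  PiecewiseOn (fun s s' ↦
    ContMDiffOn 𝓘(ℝ, ℝ) (𝓘(ℝ, B).prod 𝓘(ℝ, F)) 1 (sectionCurve F f) (Icc s s') ∧
      ∀ t ∈ Ioo s s', covDerivAlong cov (sectionCurve F f) t = 0) a b

theorem IsParallelSection.congr {cov : CovariantDerivative 𝓘(ℝ, B) F V} {f g : ∀ t, V (γ t)}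
    (hf : IsParallelSection cov f a b) (h : ∀ t ∈ Icc a b, f t = g t) :
    IsParallelSection cov g a b := by
  have h' : ∀ t ∈ Icc a b, sectionCurve F f t = sectionCurve F g t := fun t ht ↦ by
    rw [sectionCurve, sectionCurve, h t ht]
  refine hf.mono fun s s' h1 h2 h3 hs ↦ ⟨hs.1.congr fun t ht ↦ (h' t ?_).symm, fun t ht ↦ ?_⟩
  · exact ⟨h1.trans ht.1, ht.2.trans h3⟩
  · refine covDerivAlong_eq_zero_congr ?_ (hs.2 t ht)
    filter_upwards [Ioo_mem_nhds ht.1 ht.2] with r hr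
    exact h' r ⟨h1.trans hr.1.le, hr.2.le.trans h3⟩

/-- In the trivialization around `γ t₀` the parallel equation is the linear system `y' = -ω(γ') y`,
with `ω` the connection form. The same `δ` works for every initial time and value, so solutions can
be continued in both directions. -/
theorem exists_parallel_of_short {cov : CovariantDerivative 𝓘(ℝ, B) F V}
    (hcov : cov.ContMDiffCovariantDerivative ∞) (hab : a < b)
    (hγ : ContMDiffOn 𝓘(ℝ, ℝ) 𝓘(ℝ, B) 1 γ (Icc a b)) {t₀ : ℝ} (ht₀ : t₀ ∈ Icc a b) :
    ∃ δ > 0, ∀ s s', a ≤ s → s < s' → s' ≤ b → t₀ - δ < s → s' < t₀ + δ →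
      ∀ t₁ ∈ Icc s s', ∀ w : V (γ t₁), ∃ f : ∀ t, V (γ t), f t₁ = w ∧
        ContMDiffOn 𝓘(ℝ, ℝ) (𝓘(ℝ, B).prod 𝓘(ℝ, F)) 1 (sectionCurve F f) (Icc s s') ∧
        ∀ t ∈ Ioo s s', covDerivAlong cov (sectionCurve F f) t = 0 := by
  set e := trivializationAt F V (γ t₀) with he
  have hmem : γ t₀ ∈ e.baseSet := FiberBundle.mem_baseSet_trivializationAt' _
  let ι : ℝ → TangentBundle 𝓘(ℝ, ℝ) ℝ := fun t ↦ ⟨t, (1 : ℝ)⟩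
  have hι : Continuous ι :=
    (contMDiff_vectorSpace_iff_contDiff (V := fun _ : ℝ ↦ (1 : ℝ)) (n := 0)).2 contDiff_const |>.continuous
  -- The velocity is taken within `[a, b]`, which keeps it continuous up to the end points.
  let τ : ℝ → TangentBundle 𝓘(ℝ, B) N := fun t ↦ tangentMapWithin 𝓘(ℝ, ℝ) 𝓘(ℝ, B) γ (Icc a b) (ι t)
  have hτ : ContinuousOn τ (Icc a b) :=
    (hγ.continuousOn_tangentMapWithin le_rfl (uniqueMDiffOn_iff_uniqueDiffOn.2
      (uniqueDiffOn_Icc hab))).comp hι.continuousOn fun t ht ↦ ht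
  let A : ℝ → F →L[ℝ] F := fun t ↦ -connectionForm cov (γ t₀) (τ t)
  have hA : ∀ t ∈ Icc a b, γ t ∈ e.baseSet → ContinuousWithinAt A (Icc a b) t := fun t ht htb ↦
    ((continuousAt_connectionForm hcov (v₀ := τ t) htb).comp_continuousWithinAt (hτ t ht)).neg
  have hev : ∀ᶠ t in 𝓝[Icc a b] t₀, γ t ∈ e.baseSet ∧ ‖A t‖ ≤ ‖A t₀‖ + 1 := by
    refine Filter.Eventually.and
      ((hγ.continuousOn t₀ ht₀).preimage_mem_nhdsWithin (e.open_baseSet.mem_nhds hmem)) ?_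
    filter_upwards [(hA t₀ ht₀ hmem).norm.preimage_mem_nhdsWithin
      (Iio_mem_nhds (lt_add_one ‖A t₀‖))] with t ht
    exact le_of_lt ht
  obtain ⟨ε, hε, hsub⟩ := Metric.mem_nhdsWithin_iff.1 hev
  set M := ‖A t₀‖ + 1 with hM
  have hM0 : 0 < M := by positivity
  -- An interval inside `(t₀ - δ, t₀ + δ)` is shorter than `2δ ≤ 1 / (2M)`, the length allowed by
  -- `exists_linear_ode`.
  refine ⟨min ε (1 / (4 * M)), by positivity, fun s s' h1 h2 h3 h4 h5 t₁ ht₁ w ↦ ?_⟩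
  have hIcc : Icc s s' ⊆ Icc a b := Icc_subset_Icc h1 h3
  have hgood : ∀ t ∈ Icc s s', γ t ∈ e.baseSet ∧ ‖A t‖ ≤ M := fun t ht ↦ by
    refine hsub ⟨?_, hIcc ht⟩
    rw [Metric.mem_ball, Real.dist_eq, abs_lt]
    have := min_le_left ε (1 / (4 * M))
    constructor <;> linarith [ht.1, ht.2]
  have hAc : ContinuousOn A (Icc s s') := fun t ht ↦
    (hA t (hIcc ht) (hgood t ht).1).mono hIcc
  have hlen : M * (s' - s) ≤ 1 / 2 := by
    have := min_le_right ε (1 / (4 * M))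
    have h6 : s' - s ≤ 2 * (1 / (4 * M)) := by linarith
    calc M * (s' - s) ≤ M * (2 * (1 / (4 * M))) := by gcongr
      _ = 1 / 2 := by field_simp; norm_num
  have : CompleteSpace F := FiniteDimensional.complete ℝ F
  obtain ⟨y, hy0, hy⟩ := exists_linear_ode hAc (fun t ht ↦ (hgood t ht).2) hlen ht₁ (e ⟨γ t₁, w⟩).2
  have hyc : ContinuousOn y (Icc s s') := fun t ht ↦ (hy t ht).continuousWithinAt
  have hy1 : ContDiffOn ℝ 1 y (Icc s s') := by
    have h6 : ContDiffOn ℝ (0 + 1) y (Icc s s') := by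
      rw [contDiffOn_succ_iff_derivWithin (uniqueDiffOn_Icc h2)]
      refine ⟨fun t ht ↦ (hy t ht).differentiableWithinAt, by simp, ?_⟩
      refine contDiffOn_zero.2 ((hAc.clm_apply hyc).congr fun t ht ↦ ?_)
      exact (hy t ht).derivWithin (uniqueDiffOn_Icc h2 t ht)
    simpa using h6
  let f : ∀ t, V (γ t) := fun t ↦ constSection (γ t₀) (y t) (γ t)
  have hcoord : ∀ t ∈ Icc s s', (e (sectionCurve F f t)).2 = y t := fun t ht ↦
    trivializationAt_constSection (hgood t ht).1 (y t)
  have hf1 : ContMDiffOn 𝓘(ℝ, ℝ) (𝓘(ℝ, B).prod 𝓘(ℝ, F)) 1 (sectionCurve F f) (Icc s s') := by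
    rw [e.contMDiffOn_iff (fun t ht ↦ by rw [Trivialization.mem_source]; exact (hgood t ht).1)]
    exact ⟨hγ.mono hIcc, hy1.contMDiffOn.congr hcoord⟩
  refine ⟨f, ?_, hf1, fun t ht ↦ ?_⟩
  · change constSection (γ t₀) (y t₁) (γ t₁) = w
    rw [hy0]
    exact constSection_trivializationAt (hgood t₁ ht₁).1 w
  · have htI := Ioo_subset_Icc_self ht
    have hb := (hgood t htI).1
    have hmd := (hf1.contMDiffAt (Icc_mem_nhds ht.1 ht.2)).mdifferentiableAt one_ne_zero
    rw [covDerivAlong_eq cov (q₀ := γ t₀) hb hmd]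
    have h6 : deriv (fun s ↦ (e (sectionCurve F f s)).2) t = A t (y t) := by
      have h7 : (fun s ↦ (e (sectionCurve F f s)).2) =ᶠ[𝓝 t] y := by
        filter_upwards [Icc_mem_nhds ht.1 ht.2] with r hr using hcoord r hr
      rw [h7.deriv_eq]
      exact ((hy t htI).hasDerivAt (Icc_mem_nhds ht.1 ht.2)).deriv
    have h8 : τ t = ⟨γ t, mfderiv 𝓘(ℝ, ℝ) 𝓘(ℝ, B) γ t (1 : ℝ)⟩ := by
      change (⟨γ t, mfderivWithin 𝓘(ℝ, ℝ) 𝓘(ℝ, B) γ (Icc a b) t (1 : ℝ)⟩ : TangentBundle 𝓘(ℝ, B) N) = _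
      rw [mfderivWithin_of_mem_nhds (Icc_mem_nhds (h1.trans_lt ht.1) (ht.2.trans_le h3))]
    have h9 : A t (y t) = -(e ⟨γ t, cov (constSection (γ t₀) (y t)) (γ t)
        (mfderiv 𝓘(ℝ, ℝ) 𝓘(ℝ, B) γ t (1 : ℝ))⟩).2 := by
      change -(connectionForm cov (γ t₀) (τ t) (y t)) = _
      rw [h8, connectionForm_apply cov hb]
    rw [h6, h9, hcoord t htI, map_neg]
    have h10 := constSection_trivializationAt hb (cov (constSection (γ t₀) (y t)) (γ t)
        (mfderiv 𝓘(ℝ, ℝ) 𝓘(ℝ, B) γ t (1 : ℝ)))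
    change -(constSection (γ t₀) _ (γ t)) + _ = 0
    rw [h10]
    exact neg_add_cancel _

theorem IsParallelSection.exists_glue {cov : CovariantDerivative 𝓘(ℝ, B) F V} {c : ℝ}
    {f g : ∀ t, V (γ t)} (hf : IsParallelSection cov f a b) (hg : IsParallelSection cov g b c)
    (h : f b = g b) : ∃ k : ∀ t, V (γ t), (∀ t ≤ b, k t = f t) ∧ (∀ t ≥ b, k t = g t) ∧
      IsParallelSection cov k a c := by
  classical
  let k : ∀ t, V (γ t) := fun t ↦ if t ≤ b then f t else g t
  have h1 : ∀ t ≤ b, k t = f t := fun t ht ↦ if_pos ht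
  have h2 : ∀ t ≥ b, k t = g t := fun t ht ↦ by
    rcases ht.eq_or_lt with h3 | h3
    · subst h3; rw [h1 _ le_rfl, h]
    · exact if_neg (not_le.2 h3)
  exact ⟨k, h1, h2, (hf.congr fun t ht ↦ (h1 t ht.2).symm).trans
    (hg.congr fun t ht ↦ (h2 t ht.1).symm)⟩

/-- Parallel sections along a piecewise `C^1` curve exist. -/
theorem exists_isParallelSection {cov : CovariantDerivative 𝓘(ℝ, B) F V}
    (hcov : cov.ContMDiffCovariantDerivative ∞) (hab : a < b)
    (hγ : PiecewiseOn (fun s s' ↦ ContMDiffOn 𝓘(ℝ, ℝ) 𝓘(ℝ, B) 1 γ (Icc s s')) a b) :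
    (∀ w : V (γ a), ∃ f : ∀ t, V (γ t), f a = w ∧ IsParallelSection cov f a b) ∧
      ∀ w : V (γ b), ∃ f : ∀ t, V (γ t), f b = w ∧ IsParallelSection cov f a b := by
  set R : ℝ → ℝ → Prop := fun a b ↦
    (∀ w : V (γ a), ∃ f : ∀ t, V (γ t), f a = w ∧ IsParallelSection cov f a b) ∧
      ∀ w : V (γ b), ∃ f : ∀ t, V (γ t), f b = w ∧ IsParallelSection cov f a b with hR
  have htrans : ∀ s t u, s < t → t < u → R s t → R t u → R s u := by
    rintro s t u h1 h2 ⟨h3, h4⟩ ⟨h5, h6⟩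
    refine ⟨fun w ↦ ?_, fun w ↦ ?_⟩
    · obtain ⟨f, hf, hf'⟩ := h3 w
      obtain ⟨g, hg, hg'⟩ := h5 (f t)
      obtain ⟨k, hk1, hk2, hk⟩ := hf'.exists_glue hg' hg.symm
      exact ⟨k, by rw [hk1 s h1.le, hf], hk⟩
    · obtain ⟨g, hg, hg'⟩ := h6 w
      obtain ⟨f, hf, hf'⟩ := h4 (g t)
      obtain ⟨k, hk1, hk2, hk⟩ := hf'.exists_glue hg' hf
      exact ⟨k, by rw [hk2 u h2.le, hg], hk⟩
  refine hγ.rel hab (fun s t u _ h1 h2 _ ↦ htrans s t u h1 h2) fun s s' _ hss _ hs ↦ ?_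
  -- The break points are already dealt with; what remains is to chain short intervals inside one
  -- `C^1` piece.
  refine rel_of_local hss (fun s t u _ h1 h2 _ ↦ htrans s t u h1 h2) fun t ht ↦ ?_
  obtain ⟨δ, hδ, h⟩ := exists_parallel_of_short (V := V) hcov hss hs ht
  refine ⟨δ, hδ, fun r r' h1 h2 h3 h4 h5 ↦ ?_⟩
  have key : ∀ t₁ ∈ Icc r r', ∀ w : V (γ t₁), ∃ f : ∀ t, V (γ t), f t₁ = w ∧
      IsParallelSection cov f r r' := fun t₁ ht₁ w ↦ by
    obtain ⟨f, hf, hf1, hf2⟩ := h r r' h1 h2 h3 h4 h5 t₁ ht₁ w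
    refine ⟨f, hf, .of_forall fun x y hx hxy hy ↦ ⟨hf1.mono (Icc_subset_Icc hx hy), fun t ht ↦
      hf2 t (Ioo_subset_Ioo hx hy ht)⟩⟩
  exact ⟨key r (left_mem_Icc.2 h2.le), key r' (right_mem_Icc.2 h2.le)⟩

end ParallelExistence

/-! ### Piecewise regular curves through break points -/

section PiecewiseCurves

theorem PiecewiseOn.continuousOn {X : Type*} [TopologicalSpace X] {f : ℝ → X} {a b : ℝ}
    (h : PiecewiseOn (fun s s' ↦ ContinuousOn f (Icc s s')) a b) (hab : a < b) :
    ContinuousOn f (Icc a b) :=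
  h.rel (R := fun s s' ↦ ContinuousOn f (Icc s s')) hab
    (fun s t u _ h1 h2 _ h3 h4 ↦ by
      rw [← Icc_union_Icc_eq_Icc h1.le h2.le]
      exact h3.union_of_isClosed h4 isClosed_Icc isClosed_Icc) fun _ _ _ _ _ h ↦ h

variable {B : Type*} [NormedAddCommGroup B] [NormedSpace ℝ B]
  {N : Type*} [TopologicalSpace N] [ChartedSpace B N]

/-- Smooth curves with nowhere vanishing velocity on a compact interval. -/
def IsRegularOn (γ : ℝ → N) (a b : ℝ) : Prop :=
  ContMDiffOn 𝓘(ℝ, ℝ) 𝓘(ℝ, B) ∞ γ (Icc a b) ∧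
    ∀ t ∈ Icc a b, mfderivWithin 𝓘(ℝ, ℝ) 𝓘(ℝ, B) γ (Icc a b) t (1 : ℝ) ≠ 0

theorem IsRegularOn.mono {γ : ℝ → N} {a b s s' : ℝ} (h : IsRegularOn (B := B) γ a b)
    (h1 : a ≤ s) (h2 : s < s') (h3 : s' ≤ b) : IsRegularOn (B := B) γ s s' := by
  have hsub : Icc s s' ⊆ Icc a b := Icc_subset_Icc h1 h3
  refine ⟨h.1.mono hsub, fun t ht ↦ ?_⟩
  rw [mfderivWithin_subset hsub (uniqueMDiffWithinAt_iff_uniqueDiffWithinAt.2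
    (uniqueDiffOn_Icc h2 t ht)) ((h.1 t (hsub ht)).mdifferentiableWithinAt (by simp))]
  exact h.2 t (hsub ht)

/-- Trades an indexed subdivision for a finite set of break points, which can be merged and refined
without index arithmetic. -/
theorem isPiecewiseRegular_iff {γ : ℝ → N} :
    IsPiecewiseRegular 𝓘(ℝ, B) γ ↔ PiecewiseOn (IsRegularOn (B := B) γ) 0 1 := by
  constructor
  · rintro ⟨m, τ, h0, h1, h⟩
    have key : ∀ n ≤ m, PiecewiseOn (IsRegularOn (B := B) γ) (τ 0) (τ n) := by
      intro n
      induction n with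
      | zero =>
        exact fun _ ↦ .of_forall fun s s' h2 h3 h4 ↦ absurd (h2.trans_lt (h3.trans_le h4)) (lt_irrefl _)
      | succ n ih =>
        intro hn
        refine (ih (by omega)).trans (.of_forall fun s s' h2 h3 h4 ↦ ?_)
        exact IsRegularOn.mono ⟨(h n (by omega)).2.1, (h n (by omega)).2.2⟩ h2 h3 h4
    have := key m le_rfl
    rwa [h0, h1] at this
  · intro h
    refine h.rel (R := fun a b ↦ ∃ (m : ℕ) (τ : ℕ → ℝ), τ 0 = a ∧ τ m = b ∧ ∀ i < m,
      τ i < τ (i + 1) ∧ ContMDiffOn 𝓘(ℝ, ℝ) 𝓘(ℝ, B) ∞ γ (Icc (τ i) (τ (i + 1))) ∧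
      ∀ t ∈ Icc (τ i) (τ (i + 1)),
        mfderivWithin 𝓘(ℝ, ℝ) 𝓘(ℝ, B) γ (Icc (τ i) (τ (i + 1))) t (1 : ℝ) ≠ 0) one_pos ?_ ?_
    · rintro s t u - - - - ⟨m, τ, h0, h1, h⟩ ⟨m', τ', h0', h1', h'⟩
      have e1 : ∀ i ≤ m, (fun i ↦ if i ≤ m then τ i else τ' (i - m)) i = τ i := fun i hi ↦ if_pos hi
      -- At `i = m` both branches give the common end point `τ m = τ' 0`.
      have e2 : ∀ i ≥ m, (fun i ↦ if i ≤ m then τ i else τ' (i - m)) i = τ' (i - m) := fun i hi ↦ by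
        rcases hi.eq_or_lt with rfl | h2
        · simp [h1, h0']
        · exact if_neg (not_le.2 h2)
      refine ⟨m + m', fun i ↦ if i ≤ m then τ i else τ' (i - m), ?_, ?_, fun i hi ↦ ?_⟩
      · rw [e1 0 (Nat.zero_le _), h0]
      · rw [e2 (m + m') (Nat.le_add_right _ _), Nat.add_sub_cancel_left, h1']
      · rcases lt_or_ge i m with h2 | h2
        · rw [e1 i h2.le, e1 (i + 1) h2]
          exact h i h2
        · rw [e2 i h2, e2 (i + 1) (by omega), show i + 1 - m = (i - m) + 1 by omega]
          exact h' (i - m) (by omega)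
    · intro s s' _ hss _ hs
      refine ⟨1, fun i ↦ if i = 0 then s else s', by simp, by simp, fun i hi ↦ ?_⟩
      obtain rfl : i = 0 := by omega
      exact ⟨hss, hs⟩

end PiecewiseCurves

/-! ### Norm estimates and uniqueness of parallel transport -/

section ParallelNorm

variable {B : Type*} [NormedAddCommGroup B] [NormedSpace ℝ B] [FiniteDimensional ℝ B] [Nontrivial B]
  {N : Type*} [TopologicalSpace N] [T2Space N] [ChartedSpace B N] [IsManifold 𝓘(ℝ, B) ∞ N]
  {F : Type*} [NormedAddCommGroup F] [NormedSpace ℝ F] [FiniteDimensional ℝ F]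
  {V : N → Type*} [TopologicalSpace (TotalSpace F V)]
  [∀ x, NormedAddCommGroup (V x)] [∀ x, InnerProductSpace ℝ (V x)]
  [FiberBundle F V] [VectorBundle ℝ F V] [ContMDiffVectorBundle ∞ F V 𝓘(ℝ, B)]

variable {γ : ℝ → N} {a b : ℝ}

theorem IsParallelSection.continuousOn {cov : CovariantDerivative 𝓘(ℝ, B) F V} {f : ∀ t, V (γ t)}
    (hf : IsParallelSection cov f a b) (hab : a < b) : ContinuousOn (sectionCurve F f) (Icc a b) :=
  PiecewiseOn.continuousOn (hf.mono fun _ _ _ _ _ h ↦ h.1.continuousOn) hab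

theorem exists_finite_mdifferentiableAt {E' : Type*} [NormedAddCommGroup E'] [NormedSpace ℝ E']
    {H' : Type*} [TopologicalSpace H'] {I' : ModelWithCorners ℝ E' H'} {M : Type*}
    [TopologicalSpace M] [ChartedSpace H' M] {α : ℝ → M}
    (h : PiecewiseOn (fun s s' ↦ ContMDiffOn 𝓘(ℝ, ℝ) I' 1 α (Icc s s')) a b) :
    ∃ S : Set ℝ, S.Finite ∧ ∀ t ∈ Icc a b \ S, MDifferentiableAt 𝓘(ℝ, ℝ) I' α t := by
  obtain ⟨S, hS, h⟩ := h.exists_finite_forall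
  refine ⟨S, hS, fun t ht ↦ ?_⟩
  obtain ⟨s, s', -, h2, h3, -, h4⟩ := h t ht
  exact (h4.contMDiffAt (Icc_mem_nhds h2 h3)).mdifferentiableAt one_ne_zero

theorem IsParallelSection.exists_finite {cov : CovariantDerivative 𝓘(ℝ, B) F V} {f : ∀ t, V (γ t)}
    (hf : IsParallelSection cov f a b) : ∃ S : Set ℝ, S.Finite ∧ ∀ t ∈ Icc a b \ S,
      MDifferentiableAt 𝓘(ℝ, ℝ) (𝓘(ℝ, B).prod 𝓘(ℝ, F)) (sectionCurve F f) t ∧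
        covDerivAlong cov (sectionCurve F f) t = 0 := by
  obtain ⟨S, hS, h⟩ := hf.exists_finite_forall
  refine ⟨S, hS, fun t ht ↦ ?_⟩
  obtain ⟨s, s', -, h2, h3, -, h4⟩ := h t ht
  exact ⟨(h4.1.contMDiffAt (Icc_mem_nhds h2 h3)).mdifferentiableAt one_ne_zero, h4.2 t ⟨h2, h3⟩⟩

variable [IsContMDiffRiemannianBundle 𝓘(ℝ, B) ∞ F V]

open MeasureTheory

/-- The norm along a curve in the total space changes at most by the integral of the norm of
its covariant derivative. -/
theorem enorm_norm_sub_norm_le {cov : CovariantDerivative 𝓘(ℝ, B) F V}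
    (hmetric : cov.IsMetricCompatible) (hab : a ≤ b) {α : ℝ → TotalSpace F V}
    (hα : ContinuousOn (fun t ↦ ‖(α t).2‖) (Icc a b)) {S : Set ℝ} (hS : S.Finite)
    (hd : ∀ t ∈ Icc a b \ S, MDifferentiableAt 𝓘(ℝ, ℝ) (𝓘(ℝ, B).prod 𝓘(ℝ, F)) α t) :
    ‖‖(α b).2‖ - ‖(α a).2‖‖ₑ ≤ ∫⁻ t in Icc a b, ‖covDerivAlong cov α t‖ₑ := by
  have : IsContMDiffRiemannianBundle 𝓘(ℝ, B) 1 F V := inferInstance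
  set J := ∫⁻ t in Icc a b, ‖covDerivAlong cov α t‖ₑ with hJ
  refine ENNReal.le_of_forall_pos_le_add fun ε hε _ ↦ ?_
  have hε' : (0 : ℝ) < ε := hε
  -- The norm need not be differentiable at zeros of the section. This regularization is, lies
  -- within `ε` of the norm, and has derivative `⟨Dα/dt, α⟩ / u`, at most `‖Dα/dt‖` in absolute
  -- value.
  let u : ℝ → ℝ := fun t ↦ Real.sqrt (inner ℝ (α t).2 (α t).2 + (ε : ℝ) ^ 2)
  have hu0 : ∀ t, 0 < inner ℝ (α t).2 (α t).2 + (ε : ℝ) ^ 2 := fun t ↦ by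
    have := real_inner_self_nonneg (x := (α t).2)
    positivity
  have hnorm : ∀ t, ‖(α t).2‖ ≤ u t ∧ u t ≤ ‖(α t).2‖ + ε := fun t ↦ by
    constructor
    · refine Real.le_sqrt_of_sq_le ?_
      rw [real_inner_self_eq_norm_sq]
      nlinarith
    · refine Real.sqrt_le_iff.2 ⟨by positivity, ?_⟩
      rw [real_inner_self_eq_norm_sq]
      nlinarith [mul_nonneg (norm_nonneg (α t).2) hε'.le]
  have huc : ContinuousOn u (Icc a b) := by
    refine ContinuousOn.sqrt (ContinuousOn.add ?_ continuousOn_const)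
    exact (hα.pow 2).congr fun t _ ↦ real_inner_self_eq_norm_sq _
  have h1 : ‖u b - u a‖ₑ ≤ J := by
    refine enorm_sub_le_lintegral hab huc hS fun t ht ↦ ?_
    have h2 := ((hasDerivAt_inner_self hmetric (hd t ht)).add_const ((ε : ℝ) ^ 2)).sqrt (hu0 t).ne'
    have h2' : HasDerivAt u _ t := h2
    refine ⟨h2'.differentiableAt, ?_⟩
    rw [h2'.deriv, enorm_le_iff_norm_le, norm_div, norm_mul, norm_mul]
    have h3 : 0 < u t := Real.sqrt_pos.2 (hu0 t)
    change ‖(2 : ℝ)‖ * _ / (‖(2 : ℝ)‖ * ‖u t‖) ≤ _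
    rw [Real.norm_of_nonneg h3.le, mul_div_mul_left _ _ (by norm_num), div_le_iff₀ h3]
    refine (norm_inner_le_norm _ _).trans ?_
    gcongr
    exact (hnorm t).1
  have h4 : |‖(α b).2‖ - ‖(α a).2‖| ≤ |u b - u a| + ε := by
    have ha := hnorm a
    have hb := hnorm b
    rw [abs_le]
    constructor
    · linarith [neg_abs_le (u b - u a)]
    · linarith [le_abs_self (u b - u a)]
  calc ‖‖(α b).2‖ - ‖(α a).2‖‖ₑ = ENNReal.ofReal |‖(α b).2‖ - ‖(α a).2‖| := Real.enorm_eq_ofReal_abs _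
    _ ≤ ENNReal.ofReal (|u b - u a| + ε) := ENNReal.ofReal_le_ofReal h4
    _ = ‖u b - u a‖ₑ + ε := by
      rw [ENNReal.ofReal_add (abs_nonneg _) hε'.le, Real.enorm_eq_ofReal_abs, ENNReal.ofReal_coe_nnreal]
    _ ≤ J + ε := by gcongr

/-- Expanding `‖f - g‖²` reduces the claim to continuity of the metric on pairs of sections. -/
theorem continuousOn_norm_sub [IsContMDiffRiemannianBundle 𝓘(ℝ, B) 0 F V] {f g : ∀ t, V (γ t)} {s : Set ℝ}
    (hf : ContinuousOn (sectionCurve F f) s) (hg : ContinuousOn (sectionCurve F g) s) :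
    ContinuousOn (fun t ↦ ‖f t - g t‖) s := by
  have hf' : ContMDiffOn 𝓘(ℝ, ℝ) (𝓘(ℝ, B).prod 𝓘(ℝ, F)) 0 (sectionCurve F f) s :=
    contMDiffOn_zero_iff.2 hf
  have hg' : ContMDiffOn 𝓘(ℝ, ℝ) (𝓘(ℝ, B).prod 𝓘(ℝ, F)) 0 (sectionCurve F g) s :=
    contMDiffOn_zero_iff.2 hg
  have h := (((hf'.inner_bundle hf').continuousOn.sub
    ((hf'.inner_bundle hg').continuousOn.const_mul 2)).add (hg'.inner_bundle hg').continuousOn).sqrt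
  refine h.congr fun t _ ↦ ?_
  rw [norm_eq_sqrt_real_inner, real_inner_sub_sub_self]
  rfl

/-- Comparison of a section along a curve with a parallel one. -/
theorem enorm_sub_le_of_parallel {cov : CovariantDerivative 𝓘(ℝ, B) F V}
    (hmetric : cov.IsMetricCompatible) (hab : a ≤ b) {f g : ∀ t, V (γ t)}
    (hf : ContinuousOn (sectionCurve F f) (Icc a b))
    (hg : ContinuousOn (sectionCurve F g) (Icc a b)) {S T : Set ℝ} (hS : S.Finite) (hT : T.Finite)
    (hfd : ∀ t ∈ Icc a b \ S,
      MDifferentiableAt 𝓘(ℝ, ℝ) (𝓘(ℝ, B).prod 𝓘(ℝ, F)) (sectionCurve F f) t)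
    (hgd : ∀ t ∈ Icc a b \ T,
      MDifferentiableAt 𝓘(ℝ, ℝ) (𝓘(ℝ, B).prod 𝓘(ℝ, F)) (sectionCurve F g) t ∧
        covDerivAlong cov (sectionCurve F g) t = 0) (hb : f b = g b) :
    ‖f a - g a‖ₑ ≤ ∫⁻ t in Icc a b, ‖covDerivAlong cov (sectionCurve F f) t‖ₑ := by
  -- This is `f - g`, written so that `linear_combination_curve` applies. As `g` is parallel, `k`
  -- has the covariant derivative of `f`, and `k b = 0`.
  let k : ∀ t, V (γ t) := fun t ↦ (fun _ : ℝ ↦ (1 : ℝ)) t • f t + (fun _ : ℝ ↦ (-1 : ℝ)) t • g t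
  have hk : ∀ t, k t = f t - g t := fun t ↦ by simp [k, sub_eq_add_neg]
  have key : ∀ t ∈ Icc a b \ (S ∪ T),
      MDifferentiableAt 𝓘(ℝ, ℝ) (𝓘(ℝ, B).prod 𝓘(ℝ, F)) (sectionCurve F k) t ∧
        covDerivAlong cov (sectionCurve F k) t = covDerivAlong cov (sectionCurve F f) t := by
    intro t ht
    have htf := hfd t ⟨ht.1, fun h ↦ ht.2 (.inl h)⟩
    have htg := hgd t ⟨ht.1, fun h ↦ ht.2 (.inr h)⟩
    have h := MDifferentiableAt.linear_combination_curve (a := fun _ ↦ (1 : ℝ)) (b := fun _ ↦ (-1 : ℝ))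
      (differentiableAt_const (1 : ℝ)) (differentiableAt_const (-1 : ℝ)) htf htg.1
    refine ⟨h.1, (h.2 cov).trans ?_⟩
    have h2 : covDerivAlong cov (fun s ↦ TotalSpace.mk' F (γ s) (g s)) t = 0 := htg.2
    rw [h2]
    simp
  have h1 := enorm_norm_sub_norm_le (α := sectionCurve F k) hmetric hab
    ((continuousOn_norm_sub (B := B) hf hg).congr fun t _ ↦ by
      change ‖k t‖ = _
      rw [hk]) (hS.union hT) fun t ht ↦ (key t ht).1
  have h2 : ‖(sectionCurve F k b).2‖ = 0 := by
    change ‖k b‖ = 0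
    rw [hk, hb, sub_self, norm_zero]
  have h3 : ‖(sectionCurve F k a).2‖ = ‖f a - g a‖ := congrArg norm (hk a)
  rw [h2, h3, zero_sub, enorm_neg, enorm_norm] at h1
  refine h1.trans (lintegral_mono_ae ?_)
  have hae : ∀ᵐ t ∂(volume.restrict (Icc a b)), t ∈ Icc a b ∧ t ∉ S ∪ T := by
    refine (ae_restrict_mem measurableSet_Icc).and ?_
    have := (hS.union hT).measure_zero (volume.restrict (Icc a b))
    exact measure_eq_zero_iff_ae_notMem.1 this
  filter_upwards [hae] with t ht
  exact (congrArg (fun w : V (γ t) ↦ ‖w‖ₑ) (key t ht).2).le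

theorem IsParallelSection.norm_eq {cov : CovariantDerivative 𝓘(ℝ, B) F V}
    (hmetric : cov.IsMetricCompatible) (hab : a < b) {f : ∀ t, V (γ t)}
    (hf : IsParallelSection cov f a b) {t : ℝ} (ht : t ∈ Icc a b) : ‖f t‖ = ‖f a‖ := by
  obtain ⟨S, hS, h⟩ := hf.exists_finite
  have hc := hf.continuousOn hab
  have hcn : ContinuousOn (fun t ↦ ‖f t‖) (Icc a b) := by
    have : IsContMDiffRiemannianBundle 𝓘(ℝ, B) 0 F V := inferInstance
    have hf' : ContMDiffOn 𝓘(ℝ, ℝ) (𝓘(ℝ, B).prod 𝓘(ℝ, F)) 0 (sectionCurve F f) (Icc a b) :=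
      contMDiffOn_zero_iff.2 hc
    exact (hf'.inner_bundle hf').continuousOn.sqrt.congr fun t _ ↦ norm_eq_sqrt_real_inner _
  have hsub : Icc a t ⊆ Icc a b := Icc_subset_Icc le_rfl ht.2
  have h1 := enorm_norm_sub_norm_le (α := sectionCurve F f) hmetric ht.1 (hcn.mono hsub) hS
    fun s hs ↦ (h s ⟨hsub hs.1, hs.2⟩).1
  have h2 : ∫⁻ s in Icc a t, ‖covDerivAlong cov (sectionCurve F f) s‖ₑ = 0 := by
    rw [← lintegral_zero (μ := volume.restrict (Icc a t))]
    refine lintegral_congr_ae ?_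
    filter_upwards [ae_restrict_mem measurableSet_Icc,
      measure_eq_zero_iff_ae_notMem.1 (hS.measure_zero (volume.restrict (Icc a t)))] with s hs hs'
    rw [(h s ⟨hsub hs, hs'⟩).2, enorm_zero]
  rw [h2, nonpos_iff_eq_zero, enorm_eq_zero, sub_eq_zero] at h1
  exact h1

/-- Parallel transport is given by parallel sections. -/
theorem parallelTransport_eq {cov : CovariantDerivative 𝓘(ℝ, B) F V}
    (hmetric : cov.IsMetricCompatible) {f : ∀ t, V (γ t)} (hf : IsParallelSection cov f 0 1) :
    parallelTransport cov γ (q₁ := γ 0) (q₂ := γ 1) (f 1) = f 0 := by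
  classical
  obtain ⟨S, hS, hfd⟩ := hf.exists_finite
  have hfc := hf.continuousOn one_pos
  have hex : ∃ w : V (γ 0), ∃ α : ℝ → TotalSpace F V, IsParallelAlong cov γ α ∧
      α 0 = ⟨γ 0, w⟩ ∧ α 1 = ⟨γ 1, f 1⟩ :=
    ⟨f 0, sectionCurve F f, ⟨fun _ _ ↦ rfl, hfc, S, hS, hfd⟩, rfl, rfl⟩
  -- The choice operator returns the start of some parallel curve `α` ending at `f 1`; comparing `f`
  -- with `α` shows that it starts at `f 0`.
  obtain ⟨α, ⟨hα, hαc, T, hT, hαd⟩, h0, h1⟩ := Classical.epsilon_spec hex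
  change α 0 = ⟨γ 0, parallelTransport cov γ (q₁ := γ 0) (q₂ := γ 1) (f 1)⟩ at h0
  -- `α` lies over `γ` only on `[0, 1]` and only up to propositional equality; elsewhere `g` takes
  -- the default value 0.
  let g : ∀ t, V (γ t) := fun t ↦ if h : (α t).proj = γ t then h ▸ (α t).2 else 0
  have key : ∀ (p : TotalSpace F V) (q : N) (h : p.proj = q),
      (⟨q, h ▸ p.2⟩ : TotalSpace F V) = p := by
    rintro p _ rfl
    rfl
  have hg : ∀ t, (α t).proj = γ t → sectionCurve F g t = α t := by
    intro t h
    have h2 : g t = h ▸ (α t).2 := dif_pos h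
    rw [sectionCurve, h2]
    exact key _ _ h
  have hg' : ∀ t ∈ Icc (0 : ℝ) 1, sectionCurve F g t = α t := fun t ht ↦ hg t (hα t ht)
  -- The end points are excluded because `g` and `α` need not agree on a full neighbourhood of them.
  have hgd : ∀ t ∈ Icc (0 : ℝ) 1 \ ({0, 1} ∪ T),
      MDifferentiableAt 𝓘(ℝ, ℝ) (𝓘(ℝ, B).prod 𝓘(ℝ, F)) (sectionCurve F g) t ∧
        covDerivAlong cov (sectionCurve F g) t = 0 := by
    intro t ht
    have ht0 : 0 < t := lt_of_le_of_ne ht.1.1 fun h ↦ ht.2 (by simp [← h])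
    have ht1 : t < 1 := lt_of_le_of_ne ht.1.2 fun h ↦ ht.2 (by simp [h])
    have hev : α =ᶠ[𝓝 t] sectionCurve F g := by
      filter_upwards [Icc_mem_nhds ht0 ht1] with s hs using (hg' s hs).symm
    have h2 := hαd t ⟨ht.1, fun h ↦ ht.2 (.inr h)⟩
    exact ⟨h2.1.congr_of_eventuallyEq hev.symm, covDerivAlong_eq_zero_congr hev h2.2⟩
  have e0 : g 0 = parallelTransport cov γ (q₁ := γ 0) (q₂ := γ 1) (f 1) :=
    TotalSpace.mk_injective _ ((hg' 0 (by simp)).trans h0)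
  have e1 : g 1 = f 1 := TotalSpace.mk_injective _ ((hg' 1 (by simp)).trans h1)
  have h2 := enorm_sub_le_of_parallel hmetric zero_le_one hfc (hαc.congr hg') hS
    (((finite_singleton 1).insert 0).union hT) (fun t ht ↦ (hfd t ht).1) hgd e1.symm
  have h3 : ∫⁻ s in Icc (0 : ℝ) 1, ‖covDerivAlong cov (sectionCurve F f) s‖ₑ = 0 := by
    rw [← lintegral_zero (μ := volume.restrict (Icc (0 : ℝ) 1))]
    refine lintegral_congr_ae ?_
    filter_upwards [ae_restrict_mem measurableSet_Icc,
      measure_eq_zero_iff_ae_notMem.1 (hS.measure_zero (volume.restrict (Icc (0 : ℝ) 1)))] with s hs hs'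
    rw [(hfd s ⟨hs, hs'⟩).2, enorm_zero]
  rw [h3, nonpos_iff_eq_zero, enorm_eq_zero, sub_eq_zero] at h2
  rw [h2, e0]

end ParallelNorm

open MeasureTheory

/-! ### Arc length of piecewise regular curves -/

section ArcLength

variable {B : Type*} [NormedAddCommGroup B] [NormedSpace ℝ B]
  {N : Type*} [TopologicalSpace N] [ChartedSpace B N] [IsManifold 𝓘(ℝ, B) ∞ N]
  [RiemannianBundle (fun x : N ↦ TangentSpace 𝓘(ℝ, B) x)]
  [IsContMDiffRiemannianBundle 𝓘(ℝ, B) ∞ B (fun x : N ↦ TangentSpace 𝓘(ℝ, B) x)]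

theorem continuous_norm_tangentBundle :
    Continuous (fun v : TangentBundle 𝓘(ℝ, B) N ↦ ‖v.2‖) := by
  have : IsContMDiffRiemannianBundle 𝓘(ℝ, B) 0 B (fun x : N ↦ TangentSpace 𝓘(ℝ, B) x) :=
    inferInstance
  have h1 : ContMDiff (𝓘(ℝ, B).tangent) (𝓘(ℝ, B).prod 𝓘(ℝ, B)) 0
      (fun v : TangentBundle 𝓘(ℝ, B) N ↦ TotalSpace.mk' B v.proj v.2) := contMDiff_id
  have h3 := ContMDiff.inner_bundle (IB := 𝓘(ℝ, B)) (n := 0) (F := B)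
    (E := fun x : N ↦ TangentSpace 𝓘(ℝ, B) x) (IM := 𝓘(ℝ, B).tangent)
    (b := fun v : TangentBundle 𝓘(ℝ, B) N ↦ v.proj) (v := fun v ↦ v.2) (w := fun v ↦ v.2)
  exact (h3 h1 h1).continuous.sqrt.congr fun v ↦ (norm_eq_sqrt_real_inner _).symm

theorem continuousOn_velocity {γ : ℝ → N} {s s' : ℝ} (hs : s < s')
    (h : ContMDiffOn 𝓘(ℝ, ℝ) 𝓘(ℝ, B) 1 γ (Icc s s')) :
    ContinuousOn (fun t ↦ (⟨γ t, mfderivWithin 𝓘(ℝ, ℝ) 𝓘(ℝ, B) γ (Icc s s') t (1 : ℝ)⟩ :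
      TangentBundle 𝓘(ℝ, B) N)) (Icc s s') := by
  let ι : ℝ → TangentBundle 𝓘(ℝ, ℝ) ℝ := fun t ↦ ⟨t, (1 : ℝ)⟩
  have hι : Continuous ι :=
    (contMDiff_vectorSpace_iff_contDiff (V := fun _ : ℝ ↦ (1 : ℝ)) (n := 0)).2
      contDiff_const |>.continuous
  exact ContinuousOn.comp (f := ι) (h.continuousOn_tangentMapWithin le_rfl
    (uniqueMDiffOn_iff_uniqueDiffOn.2 (uniqueDiffOn_Icc hs))) hι.continuousOn fun t ht ↦ ht

theorem continuousOn_norm_mfderivWithin {γ : ℝ → N} {s s' : ℝ} (hs : s < s')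
    (h : ContMDiffOn 𝓘(ℝ, ℝ) 𝓘(ℝ, B) 1 γ (Icc s s')) :
    ContinuousOn (fun t ↦ ‖mfderivWithin 𝓘(ℝ, ℝ) 𝓘(ℝ, B) γ (Icc s s') t (1 : ℝ)‖) (Icc s s') := by
  have h1 := continuousOn_velocity (B := B) hs h
  have h2 := (continuous_norm_tangentBundle (B := B) (N := N)).continuousOn (s := univ)
  have h3 := ContinuousOn.comp h2 h1 (fun _ _ ↦ mem_univ _)
  exact h3

/-- At the ends of a piece the two-sided derivative depends on the curve outside it. The one-sided
speed is continuous on the closed piece and is extended by constants. -/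
theorem IsRegularOn.exists_speed {γ : ℝ → N} {s s' : ℝ} (h : IsRegularOn (B := B) γ s s')
    (hs : s < s') : ∃ w : ℝ → ℝ, Continuous w ∧
      (∀ t ∈ Ioo s s', w t = ‖mfderiv 𝓘(ℝ, ℝ) 𝓘(ℝ, B) γ t (1 : ℝ)‖) ∧ ∀ t ∈ Icc s s', 0 < w t := by
  have hu := continuousOn_norm_mfderivWithin (B := B) hs (h.1.of_le (by simp))
  generalize hu' : (fun t ↦ ‖mfderivWithin 𝓘(ℝ, ℝ) 𝓘(ℝ, B) γ (Icc s s') t (1 : ℝ)‖) = u at hu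
  have hu1 : ∀ t, u t = ‖mfderivWithin 𝓘(ℝ, ℝ) 𝓘(ℝ, B) γ (Icc s s') t (1 : ℝ)‖ :=
    fun t ↦ (congrFun hu' t).symm
  have hw : ∀ t ∈ Icc s s', IccExtend hs.le ((Icc s s').domRestrict u) t = u t :=
    fun t ht ↦ IccExtend_of_mem _ _ ht
  have hwc : Continuous (IccExtend hs.le ((Icc s s').domRestrict u)) :=
    (continuousOn_iff_continuous_domRestrict.1 hu).Icc_extend'
  refine ⟨IccExtend hs.le ((Icc s s').domRestrict u), hwc, fun t ht ↦ ?_, fun t ht ↦ ?_⟩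
  · rw [hw t (Ioo_subset_Icc_self ht), hu1, mfderivWithin_of_mem_nhds (Icc_mem_nhds ht.1 ht.2)]
  · rw [hw t ht, hu1]
    exact norm_pos_iff.2 (h.2 t ht)

/-- The arc length of a piecewise regular curve. -/
theorem exists_arcLength {γ : ℝ → N} {a b : ℝ} (hab : a < b)
    (hγ : PiecewiseOn (IsRegularOn (B := B) γ) a b) :
    ∃ l : ℝ → ℝ, l a = 0 ∧ 0 < l b ∧ pathELength 𝓘(ℝ, B) γ a b = ENNReal.ofReal (l b) ∧
      PiecewiseOn (fun s s' ↦ ContDiffOn ℝ 1 l (Icc s s') ∧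
        ∀ t ∈ Ioo s s', deriv l t = ‖mfderiv 𝓘(ℝ, ℝ) 𝓘(ℝ, B) γ t (1 : ℝ)‖) a b := by
  let v : ℝ → ℝ := fun t ↦ ‖mfderiv 𝓘(ℝ, ℝ) 𝓘(ℝ, B) γ t (1 : ℝ)‖
  have hint : IntervalIntegrable v volume a b ∧ 0 < ∫ t in a..b, v t := by
    refine hγ.rel (R := fun a b ↦ IntervalIntegrable v volume a b ∧ 0 < ∫ t in a..b, v t) hab ?_ ?_
    · rintro s t u - - - - ⟨h1, h2⟩ ⟨h3, h4⟩
      refine ⟨h1.trans h3, ?_⟩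
      rw [← intervalIntegral.integral_add_adjacent_intervals h1 h3]
      positivity
    · intro s s' _ hs _ h
      obtain ⟨w, hw, hwv, hw0⟩ := h.exists_speed hs
      have h1 : IntervalIntegrable v volume s s' := by
        refine (hw.intervalIntegrable s s').congr_uIoo ?_
        rw [uIoo_of_le hs.le]
        exact hwv
      refine ⟨h1, intervalIntegral.intervalIntegral_pos_of_pos_on h1 (fun t ht ↦ ?_) hs⟩
      exact (hw0 t (Ioo_subset_Icc_self ht)).trans_eq (hwv t ht)
  have hsub : ∀ s ∈ Icc a b, ∀ t ∈ Icc a b, IntervalIntegrable v volume s t := fun s hs t ht ↦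
    hint.1.mono_set (by rw [uIcc_of_le hab.le]; exact uIcc_subset_Icc hs ht)
  refine ⟨fun t ↦ ∫ r in a..t, v r, intervalIntegral.integral_same, hint.2, ?_, ?_⟩
  · change _ = ENNReal.ofReal (∫ r in a..b, v r)
    rw [pathELength_eq_lintegral_mfderiv_Icc, intervalIntegral.integral_of_le hab.le,
      ← restrict_Ioc_eq_restrict_Icc, ofReal_integral_eq_lintegral_ofReal
        ((intervalIntegrable_iff_integrableOn_Ioc_of_le hab.le).1 hint.1)
        (Filter.Eventually.of_forall fun t ↦ norm_nonneg _)]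
    refine lintegral_congr fun t ↦ ?_
    exact (ofReal_norm _).symm
  · refine hγ.mono fun s s' h1 hs h3 h ↦ ?_
    obtain ⟨w, hw, hwv, -⟩ := h.exists_speed hs
    -- Replacing `v` by the continuous `w` on one piece changes no integral there and makes the arc
    -- length `C^1` up to its ends.
    let l' : ℝ → ℝ := fun t ↦ (∫ r in a..s, v r) + ∫ r in s..t, w r
    have hl' : ∀ t, HasDerivAt l' (w t) t := fun t ↦
      (hw.integral_hasStrictDerivAt s t).hasDerivAt.const_add _
    have heq : ∀ t ∈ Icc s s', ∫ r in a..t, v r = l' t := by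
      intro t ht
      have hsI : s ∈ Icc a b := ⟨h1, hs.le.trans h3⟩
      have htI : t ∈ Icc a b := ⟨h1.trans ht.1, ht.2.trans h3⟩
      rw [← intervalIntegral.integral_add_adjacent_intervals
        (hsub a (left_mem_Icc.2 hab.le) s hsI) (hsub s hsI t htI)]
      change _ = _ + _
      congr 1
      refine intervalIntegral.integral_congr_uIoo fun r hr ↦ ?_
      rw [uIoo_of_le ht.1] at hr
      exact (hwv r ⟨hr.1, hr.2.trans_le ht.2⟩).symm
    have hC : ContDiff ℝ 1 l' := by
      rw [contDiff_one_iff_deriv]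
      refine ⟨fun t ↦ (hl' t).differentiableAt, ?_⟩
      rwa [show deriv l' = w from funext fun t ↦ (hl' t).deriv]
    refine ⟨hC.contDiffOn.congr heq, fun t ht ↦ ?_⟩
    have hev : (fun t ↦ ∫ r in a..t, v r) =ᶠ[𝓝 t] l' := by
      filter_upwards [Icc_mem_nhds ht.1 ht.2] with r hr using heq r hr
    rw [hev.deriv_eq, (hl' t).deriv, hwv t ht]

end ArcLength

/-! ### Upper bound: interpolation between parallel sections -/

section UpperBound

variable {B : Type*} [NormedAddCommGroup B] [NormedSpace ℝ B] [FiniteDimensional ℝ B] [Nontrivial B]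
  {N : Type*} [TopologicalSpace N] [T2Space N] [ChartedSpace B N] [IsManifold 𝓘(ℝ, B) ∞ N]
  [RiemannianBundle (fun x : N ↦ TangentSpace 𝓘(ℝ, B) x)]
  {F : Type*} [NormedAddCommGroup F] [NormedSpace ℝ F] [FiniteDimensional ℝ F]
  {V : N → Type*} [TopologicalSpace (TotalSpace F V)]
  [∀ x, NormedAddCommGroup (V x)] [∀ x, InnerProductSpace ℝ (V x)]
  [FiberBundle F V] [VectorBundle ℝ F V] [ContMDiffVectorBundle ∞ F V 𝓘(ℝ, B)]

/-- The tangent bundle of the total space with the Sasaki metric. -/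
abbrev sasakiBundle (cov : CovariantDerivative 𝓘(ℝ, B) F V) :
    RiemannianBundle (fun p : TotalSpace F V ↦ TangentSpace (𝓘(ℝ, B).prod 𝓘(ℝ, F)) p) :=
  ⟨sasakiMetric cov⟩

theorem sasaki_norm_sq (cov : CovariantDerivative 𝓘(ℝ, B) F V) (p : TotalSpace F V)
    (ξ : TangentSpace (𝓘(ℝ, B).prod 𝓘(ℝ, F)) p) :
    letI := sasakiBundle cov
    ‖ξ‖ ^ 2 = ‖dproj 𝓘(ℝ, B) F V p ξ‖ ^ 2 + ‖connector cov p ξ‖ ^ 2 := by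
  let _ := sasakiBundle cov
  have h : inner ℝ ξ ξ = inner ℝ (dproj 𝓘(ℝ, B) F V p ξ) (dproj 𝓘(ℝ, B) F V p ξ)
        + inner ℝ (connector cov p ξ) (connector cov p ξ) := rfl
  rw [real_inner_self_eq_norm_sq, real_inner_self_eq_norm_sq, real_inner_self_eq_norm_sq] at h
  exact h

theorem sasaki_enorm_sq (cov : CovariantDerivative 𝓘(ℝ, B) F V) (p : TotalSpace F V)
    (ξ : TangentSpace (𝓘(ℝ, B).prod 𝓘(ℝ, F)) p) :
    letI := sasakiBundle cov
    ‖ξ‖ₑ ^ 2 = ‖dproj 𝓘(ℝ, B) F V p ξ‖ₑ ^ 2 + ‖connector cov p ξ‖ₑ ^ 2 := by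
  let _ := sasakiBundle cov
  have h := sasaki_norm_sq cov p ξ
  rw [← ofReal_norm, ← ofReal_norm, ← ofReal_norm,
    ← ENNReal.ofReal_pow (norm_nonneg _), ← ENNReal.ofReal_pow (norm_nonneg _),
    ← ENNReal.ofReal_pow (norm_nonneg _), ← ENNReal.ofReal_add (by positivity) (by positivity)]
  exact congrArg ENNReal.ofReal h

variable [IsContMDiffRiemannianBundle 𝓘(ℝ, B) ∞ B (fun x : N ↦ TangentSpace 𝓘(ℝ, B) x)]
  [IsContMDiffRiemannianBundle 𝓘(ℝ, B) ∞ F V]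

theorem contMDiffOn_linear_combination_curve {γ : ℝ → N} {f g : ∀ t, V (γ t)} {a b : ℝ → ℝ}
    {s : Set ℝ} (ha : ContDiffOn ℝ 1 a s) (hb : ContDiffOn ℝ 1 b s)
    (hf : ContMDiffOn 𝓘(ℝ, ℝ) (𝓘(ℝ, B).prod 𝓘(ℝ, F)) 1 (sectionCurve F f) s)
    (hg : ContMDiffOn 𝓘(ℝ, ℝ) (𝓘(ℝ, B).prod 𝓘(ℝ, F)) 1 (sectionCurve F g) s) :
    ContMDiffOn 𝓘(ℝ, ℝ) (𝓘(ℝ, B).prod 𝓘(ℝ, F)) 1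
      (sectionCurve F fun t ↦ a t • f t + b t • g t) s := by
  intro t ht
  set e := trivializationAt F V (γ t) with he
  have hq : γ t ∈ e.baseSet := FiberBundle.mem_baseSet_trivializationAt' (γ t)
  have hf' := contMDiffWithinAt_totalSpace.1 (hf t ht)
  have hg' := contMDiffWithinAt_totalSpace.1 (hg t ht)
  have hlin : ∀ r, γ r ∈ e.baseSet → (e ⟨γ r, a r • f r + b r • g r⟩).2
      = a r • (e ⟨γ r, f r⟩).2 + b r • (e ⟨γ r, g r⟩).2 := fun r hr ↦ by
    rw [trivializationAt_eq_continuousLinearMapAt hr, trivializationAt_eq_continuousLinearMapAt hr,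
      trivializationAt_eq_continuousLinearMapAt hr, map_add, map_smul, map_smul]
  refine contMDiffWithinAt_totalSpace.2 ⟨hf'.1, ?_⟩
  have h1 := ((ha.contMDiffOn t ht).smul hf'.2).add ((hb.contMDiffOn t ht).smul hg'.2)
  refine h1.congr_of_eventuallyEq ?_ (hlin t hq)
  filter_upwards [hf'.1.continuousWithinAt.preimage_mem_nhdsWithin (e.open_baseSet.mem_nhds hq)]
    with r hr using hlin r hr

/-- The upper bound for the Sasaki distance given by a piecewise regular curve. -/
theorem sasakiEDist_sq_le {cov : CovariantDerivative 𝓘(ℝ, B) F V}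
    (hcov : cov.ContMDiffCovariantDerivative ∞) (hmetric : cov.IsMetricCompatible)
    {γ : ℝ → N} (hγ : IsPiecewiseRegular 𝓘(ℝ, B) γ) (e₁ : V (γ 0)) (e₂ : V (γ 1)) :
    sasakiEDist cov ⟨γ 0, e₁⟩ ⟨γ 1, e₂⟩ ≠ ⊤ ∧
    sasakiEDist cov ⟨γ 0, e₁⟩ ⟨γ 1, e₂⟩ ^ 2 ≤
      ‖e₁ - parallelTransport cov γ e₂‖ₑ ^ 2 + pathELength 𝓘(ℝ, B) γ 0 1 ^ 2 := by
  rw [isPiecewiseRegular_iff] at hγ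
  have hγ1 : PiecewiseOn (fun s s' ↦ ContMDiffOn 𝓘(ℝ, ℝ) 𝓘(ℝ, B) 1 γ (Icc s s')) 0 1 :=
    hγ.mono fun _ _ _ _ _ h ↦ h.1.of_le (by simp)
  obtain ⟨X, hX1, hX⟩ := (exists_isParallelSection hcov one_pos hγ1).2 e₂
  obtain ⟨Y, hY0, hY⟩ := (exists_isParallelSection hcov one_pos hγ1).1 (e₁ - X 0)
  obtain ⟨l, hl0, hl1, hlen, hl⟩ := exists_arcLength one_pos hγ
  have hP := parallelTransport_eq hmetric hX
  rw [hX1] at hP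
  set D := ‖e₁ - X 0‖ with hD
  -- Linearity in arc length makes the vertical speed `|γ'| D / l 1` proportional to the horizontal
  -- speed, so the Sasaki speed is `κ |γ'|` with constant `κ`.
  let c : ℝ → ℝ := fun t ↦ 1 - l t / l 1
  let f : ∀ t, V (γ t) := fun t ↦ (fun _ : ℝ ↦ (1 : ℝ)) t • X t + c t • Y t
  set κ := Real.sqrt (1 + (D / l 1) ^ 2) with hκ
  have halg : ∀ v : ℝ, v ^ 2 + (v / l 1 * D) ^ 2 = (κ * v) ^ 2 := fun v ↦ by
    rw [mul_pow κ, hκ, Real.sq_sqrt (by positivity)]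
    ring
  let _ := sasakiBundle cov
  have hspeed : PiecewiseOn (fun s s' ↦
      ContMDiffOn 𝓘(ℝ, ℝ) (𝓘(ℝ, B).prod 𝓘(ℝ, F)) 1 (sectionCurve F f) (Icc s s') ∧
      ∀ t ∈ Ioo s s', ‖mfderiv 𝓘(ℝ, ℝ) (𝓘(ℝ, B).prod 𝓘(ℝ, F)) (sectionCurve F f) t (1 : ℝ)‖ₑ
        = ENNReal.ofReal κ * ‖mfderiv 𝓘(ℝ, ℝ) 𝓘(ℝ, B) γ t (1 : ℝ)‖ₑ) 0 1 := by
    refine (((hX.and hY).and hl).and hγ1).mono fun s s' h1 hs h3 h ↦ ?_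
    obtain ⟨⟨⟨hXs, hYs⟩, hls⟩, hγs⟩ := h
    have hcs : ContDiffOn ℝ 1 c (Icc s s') := contDiffOn_const.sub (hls.1.div_const _)
    refine ⟨contMDiffOn_linear_combination_curve contDiffOn_const hcs hXs.1 hYs.1, fun t ht ↦ ?_⟩
    have hnhds := Icc_mem_nhds ht.1 ht.2
    have hXt := (hXs.1.contMDiffAt hnhds).mdifferentiableAt one_ne_zero
    have hYt := (hYs.1.contMDiffAt hnhds).mdifferentiableAt one_ne_zero
    have hlt := (hls.1.contDiffAt hnhds).differentiableAt one_ne_zero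
    have hct : HasDerivAt c (-(deriv l t / l 1)) t := (hlt.hasDerivAt.div_const _).const_sub 1
    have hfc := MDifferentiableAt.linear_combination_curve
      (differentiableAt_const (1 : ℝ)) hct.differentiableAt hXt hYt
    have hcov' : covDerivAlong cov (sectionCurve F f) t = deriv c t • Y t := by
      refine (hfc.2 cov).trans ?_
      have h5 : covDerivAlong cov (fun s ↦ TotalSpace.mk' F (γ s) (X s)) t = 0 := hXs.2 t ht
      have h6 : covDerivAlong cov (fun s ↦ TotalSpace.mk' F (γ s) (Y s)) t = 0 := hYs.2 t ht
      rw [h5, h6]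
      simp
    have hproj : dproj 𝓘(ℝ, B) F V (sectionCurve F f t)
        (mfderiv 𝓘(ℝ, ℝ) (𝓘(ℝ, B).prod 𝓘(ℝ, F)) (sectionCurve F f) t (1 : ℝ))
        = mfderiv 𝓘(ℝ, ℝ) 𝓘(ℝ, B) γ t (1 : ℝ) := dproj_mfderiv_curve hfc.1
    have hYD : ‖Y t‖ = D := by
      rw [hY.norm_eq hmetric one_pos ⟨h1.trans ht.1.le, ht.2.le.trans h3⟩, hY0]
    have h7 := sasaki_norm_sq cov (sectionCurve F f t)
      (mfderiv 𝓘(ℝ, ℝ) (𝓘(ℝ, B).prod 𝓘(ℝ, F)) (sectionCurve F f) t (1 : ℝ))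
    have h8 : ‖mfderiv 𝓘(ℝ, ℝ) (𝓘(ℝ, B).prod 𝓘(ℝ, F)) (sectionCurve F f) t (1 : ℝ)‖ ^ 2
        = (κ * ‖mfderiv 𝓘(ℝ, ℝ) 𝓘(ℝ, B) γ t (1 : ℝ)‖) ^ 2 := by
      refine h7.trans ?_
      have h9 : ‖connector cov (sectionCurve F f t)
          (mfderiv 𝓘(ℝ, ℝ) (𝓘(ℝ, B).prod 𝓘(ℝ, F)) (sectionCurve F f) t (1 : ℝ))‖
          = ‖mfderiv 𝓘(ℝ, ℝ) 𝓘(ℝ, B) γ t (1 : ℝ)‖ / l 1 * D := by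
        refine (congrArg (fun w : V (γ t) ↦ ‖w‖) hcov').trans ?_
        rw [norm_smul, hYD, hct.deriv, norm_neg, norm_div, hls.2 t ht, norm_norm,
          Real.norm_of_nonneg hl1.le]
      rw [h9, congrArg (fun w : TangentSpace 𝓘(ℝ, B) (γ t) ↦ ‖w‖) hproj]
      exact halg _
    have h10 := (pow_left_inj₀ (norm_nonneg _) (by positivity) two_ne_zero).1 h8
    rw [← ofReal_norm, h10, ENNReal.ofReal_mul (Real.sqrt_nonneg _), ofReal_norm]
  have hdist : riemannianEDist (𝓘(ℝ, B).prod 𝓘(ℝ, F)) (sectionCurve F f 0) (sectionCurve F f 1)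
      ≤ ENNReal.ofReal κ * pathELength 𝓘(ℝ, B) γ 0 1 := by
    -- The distance is defined by `C^1` curves, so each piece is estimated separately and the
    -- triangle inequality passes the corners.
    refine hspeed.rel (R := fun s s' ↦ riemannianEDist (𝓘(ℝ, B).prod 𝓘(ℝ, F)) (sectionCurve F f s)
      (sectionCurve F f s') ≤ ENNReal.ofReal κ * pathELength 𝓘(ℝ, B) γ s s') one_pos ?_ ?_
    · intro s t u _ h1 h2 _ h3 h4
      rw [← pathELength_add h1.le h2.le, mul_add]
      exact riemannianEDist_triangle.trans (add_le_add h3 h4)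
    · intro s s' _ hs _ h
      refine (riemannianEDist_le_pathELength h.1 rfl rfl hs.le).trans_eq ?_
      rw [pathELength_eq_lintegral_mfderiv_Ioo, pathELength_eq_lintegral_mfderiv_Ioo,
        ← lintegral_const_mul' _ _ ENNReal.ofReal_ne_top]
      exact setLIntegral_congr_fun measurableSet_Ioo h.2
  have h0 : sectionCurve F f 0 = ⟨γ 0, e₁⟩ := by
    have : f 0 = e₁ := by simp [f, c, hl0, hY0]
    rw [sectionCurve, this]
  have h1 : sectionCurve F f 1 = ⟨γ 1, e₂⟩ := by
    have : f 1 = e₂ := by simp [f, c, hl1.ne', hX1]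
    rw [sectionCurve, this]
  rw [h0, h1, hlen, ← ENNReal.ofReal_mul (Real.sqrt_nonneg _)] at hdist
  have hdist' : sasakiEDist cov ⟨γ 0, e₁⟩ ⟨γ 1, e₂⟩ ≤ ENNReal.ofReal (κ * l 1) := hdist
  refine ⟨ne_top_of_le_ne_top ENNReal.ofReal_ne_top hdist', ?_⟩
  refine (pow_le_pow_left' hdist' 2).trans_eq ?_
  rw [hP, hlen, ← ofReal_norm, ← hD, ← ENNReal.ofReal_pow (norm_nonneg _),
    ← ENNReal.ofReal_pow hl1.le, ← ENNReal.ofReal_add (by positivity) (by positivity),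
    ← ENNReal.ofReal_pow (by positivity), mul_pow, hκ, Real.sq_sqrt (by positivity)]
  congr 1
  field_simp
  ring

end UpperBound

open MeasureTheory

/-! ### Comparing lengths with a frozen norm in a chart -/

section ChartComparison

variable {E : Type*} [NormedAddCommGroup E] [NormedSpace ℝ E] [FiniteDimensional ℝ E]
  {H : Type*} [TopologicalSpace H] {J : ModelWithCorners ℝ E H} [J.Boundaryless]
  {M : Type*} [TopologicalSpace M] [ChartedSpace H M] [IsManifold J ∞ M]

variable (J) in
/-- The derivative of the inverse of the preferred chart at a point. -/
def chartSymmDeriv (p : M) (u : E) : E →L[ℝ] TangentSpace J ((extChartAt J p).symm u) :=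
  mfderiv 𝓘(ℝ, E) J (extChartAt J p).symm u

theorem chartSymmDeriv_injective {p : M} {u : E} (hu : u ∈ (extChartAt J p).target) :
    Function.Injective (chartSymmDeriv J p u) := by
  have h := isInvertible_mfderivWithin_extChartAt_symm (I := J) hu
  rw [J.range_eq_univ, mfderivWithin_univ] at h
  exact h.injective

theorem mdifferentiableAt_extChartAt_symm {p : M} {u : E} (hu : u ∈ (extChartAt J p).target) :
    MDifferentiableAt 𝓘(ℝ, E) J (extChartAt J p).symm u :=
  ((contMDiffOn_extChartAt_symm (n := ∞) p).contMDiffAt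
    ((isOpen_extChartAt_target p).mem_nhds hu)).mdifferentiableAt (by simp)

theorem mfderiv_extChartAt_symm_comp {p : M} {u : ℝ → E} {t : ℝ}
    (hu : u t ∈ (extChartAt J p).target) (hd : DifferentiableAt ℝ u t) :
    mfderiv 𝓘(ℝ, ℝ) J (fun s ↦ (extChartAt J p).symm (u s)) t (1 : ℝ)
      = chartSymmDeriv J p (u t) (deriv u t) := by
  have h := mfderiv_comp (I := 𝓘(ℝ, ℝ)) (I' := 𝓘(ℝ, E)) (I'' := J) t
    (g := (extChartAt J p).symm) (f := u) (mdifferentiableAt_extChartAt_symm hu)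
    hd.mdifferentiableAt
  refine (congrArg (fun L ↦ L (1 : ℝ)) h).trans ?_
  change chartSymmDeriv J p (u t) (mfderiv 𝓘(ℝ, ℝ) 𝓘(ℝ, E) u t (1 : ℝ)) = _
  congr 1
  rw [mfderiv_eq_fderiv]
  rfl

/-- The curve that is affine in a chart. -/
def chartSegment (J : ModelWithCorners ℝ E H) (p : M) (u₁ u₂ : E) (s s' t : ℝ) : M :=
  (extChartAt J p).symm (u₁ + ((t - s) / (s' - s)) • (u₂ - u₁))

theorem chartSegment_left (p : M) (u₁ u₂ : E) (s s' : ℝ) :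
    chartSegment J p u₁ u₂ s s' s = (extChartAt J p).symm u₁ := by
  simp [chartSegment]

theorem chartSegment_right (p : M) (u₁ u₂ : E) {s s' : ℝ} (hs : s < s') :
    chartSegment J p u₁ u₂ s s' s' = (extChartAt J p).symm u₂ := by
  simp [chartSegment, (sub_pos.2 hs).ne']

theorem contMDiffOn_chartSegment {p : M} {C : Set E} (hC : Convex ℝ C)
    (hCt : C ⊆ (extChartAt J p).target) {u₁ u₂ : E} (h₁ : u₁ ∈ C) (h₂ : u₂ ∈ C) {s s' : ℝ}
    (hs : s < s') : ContMDiffOn 𝓘(ℝ, ℝ) J ∞ (chartSegment J p u₁ u₂ s s') (Icc s s') ∧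
      ∀ t ∈ Icc s s', u₁ + ((t - s) / (s' - s)) • (u₂ - u₁) ∈ C := by
  have h : ∀ t ∈ Icc s s', u₁ + ((t - s) / (s' - s)) • (u₂ - u₁) ∈ C := fun t ht ↦ by
    have h3 : 0 < s' - s := sub_pos.2 hs
    refine hC.add_smul_sub_mem h₁ h₂ ⟨div_nonneg (by linarith [ht.1]) h3.le, ?_⟩
    rw [div_le_one h3]
    linarith [ht.2]
  refine ⟨(contMDiffOn_extChartAt_symm p).comp (t := (extChartAt J p).target) ?_
    fun t ht ↦ hCt (h t ht), h⟩
  refine ContDiffOn.contMDiffOn (ContDiff.contDiffOn ?_)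
  fun_prop

variable [RiemannianBundle (fun x : M ↦ TangentSpace J x)]

theorem norm_mfderiv_congr {α β : ℝ → M} {t : ℝ} (h : α =ᶠ[𝓝 t] β) :
    ‖mfderiv 𝓘(ℝ, ℝ) J α t (1 : ℝ)‖ = ‖mfderiv 𝓘(ℝ, ℝ) J β t (1 : ℝ)‖ := by
  have A : α t = β t := h.self_of_nhds
  have key : ∀ (x y : M) (_ : x = y) (w : E), ‖(show TangentSpace J x from w)‖
      = ‖(show TangentSpace J y from w)‖ := by
    rintro x _ rfl w
    rfl
  refine (key _ _ A _).trans ?_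
  have h1 := congrArg (fun L : ℝ →L[ℝ] E ↦ L 1) (h.mfderiv_eq (I := 𝓘(ℝ, ℝ)) (I' := J))
  exact congrArg (fun w : TangentSpace J (β t) ↦ ‖w‖) h1

theorem continuousOn_norm_chartSymmDeriv (hN : Continuous fun v : TangentBundle J M ↦ ‖v.2‖)
    (p : M) : ContinuousOn (fun z : E × E ↦ ‖chartSymmDeriv J p z.1 z.2‖)
      ((extChartAt J p).target ×ˢ univ) := by
  have ho := isOpen_extChartAt_target (I := J) p
  have h1 := (contMDiffOn_extChartAt_symm (I := J) (n := ∞) p).continuousOn_tangentMapWithin (by simp)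
    ho.uniqueMDiffOn
  have h2 : Continuous (fun z : E × E ↦ (⟨z.1, z.2⟩ : TangentBundle 𝓘(ℝ, E) E)) :=
    (tangentBundleModelSpaceHomeomorph 𝓘(ℝ, E)).symm.continuous
  have h3 : ContinuousOn (fun z : E × E ↦ (⟨(extChartAt J p).symm z.1, chartSymmDeriv J p z.1 z.2⟩ :
      TangentBundle J M)) ((extChartAt J p).target ×ˢ univ) := by
    refine (h1.comp h2.continuousOn fun z hz ↦ hz.1).congr fun z hz ↦ ?_
    simp only [Function.comp, tangentMapWithin]
    rw [mfderivWithin_of_isOpen ho hz.1]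
    rfl
  have h4 := ContinuousOn.comp (hN.continuousOn (s := univ)) h3 fun _ _ ↦ mem_univ _
  exact h4

/-- Near a point the norms of tangent vectors are almost constant in a chart. -/
theorem exists_chart_norm_comparison (hN : Continuous fun v : TangentBundle J M ↦ ‖v.2‖)
    (p : M) {ε : ℝ} (hε : 0 < ε) :
    ∃ r > 0, Metric.ball (extChartAt J p p) r ⊆ (extChartAt J p).target ∧
      ∀ u ∈ Metric.ball (extChartAt J p p) r, ∀ w : E,
        ‖chartSymmDeriv J p u w‖ ≤ (1 + ε) * ‖chartSymmDeriv J p (extChartAt J p p) w‖ ∧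
        ‖chartSymmDeriv J p (extChartAt J p p) w‖ ≤ (1 + ε) * ‖chartSymmDeriv J p u w‖ := by
  set u₀ := extChartAt J p p with hu₀
  have ho := isOpen_extChartAt_target (I := J) p
  have hmem : u₀ ∈ (extChartAt J p).target := mem_extChartAt_target p
  have hc := continuousOn_norm_chartSymmDeriv hN p
  have key : ∀ᶠ u in 𝓝 u₀, ∀ w ∈ Metric.sphere (0 : E) 1,
      ‖chartSymmDeriv J p u w‖ ≤ (1 + ε) * ‖chartSymmDeriv J p u₀ w‖ ∧
      ‖chartSymmDeriv J p u₀ w‖ ≤ (1 + ε) * ‖chartSymmDeriv J p u w‖ := by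
    -- Compactness of the unit sphere gives one neighbourhood of `u₀` for all directions;
    -- homogeneity later extends the bounds to all `w`.
    refine (isCompact_sphere (0 : E) 1).eventually_forall_of_forall_eventually fun w hw ↦ ?_
    have h1 : ContinuousAt (fun z : E × E ↦ ‖chartSymmDeriv J p z.1 z.2‖) (u₀, w) :=
      hc.continuousAt ((ho.prod isOpen_univ).mem_nhds ⟨hmem, mem_univ _⟩)
    have h2 : ContinuousAt (fun z : E × E ↦ ‖chartSymmDeriv J p u₀ z.2‖) (u₀, w) := by
      have : Continuous (fun w : E ↦ ‖chartSymmDeriv J p u₀ w‖) :=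
        (chartSymmDeriv J p u₀).continuous.norm
      exact (this.comp continuous_snd).continuousAt
    have h3 : 0 < ‖chartSymmDeriv J p u₀ w‖ := by
      rw [norm_pos_iff]
      intro h
      have : w = 0 := chartSymmDeriv_injective hmem (h.trans (map_zero _).symm)
      rw [this] at hw
      simp at hw
    have h4 : ‖chartSymmDeriv J p u₀ w‖ < (1 + ε) * ‖chartSymmDeriv J p u₀ w‖ := by nlinarith
    filter_upwards [h1.eventually_lt (h2.const_mul (1 + ε)) h4,
      h2.eventually_lt (h1.const_mul (1 + ε)) h4] with z hz1 hz2
    exact ⟨hz1.le, hz2.le⟩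
  obtain ⟨r, hr, hsub⟩ := Metric.mem_nhds_iff.1 (Filter.inter_mem key (ho.mem_nhds hmem))
  refine ⟨r, hr, fun u hu ↦ (hsub hu).2, fun u hu w ↦ ?_⟩
  rcases eq_or_ne w 0 with rfl | hw
  · rw [map_zero, map_zero, norm_zero, norm_zero, mul_zero]
    exact ⟨le_rfl, le_rfl⟩
  · have h1 := (hsub hu).1 (‖w‖⁻¹ • w) (by simp [norm_smul, hw])
    have h2 : 0 < ‖w‖⁻¹ := inv_pos.2 (norm_pos_iff.2 hw)
    rw [map_smul, map_smul, norm_smul, norm_smul, Real.norm_of_nonneg h2.le] at h1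
    constructor
    · have := h1.1
      rw [mul_left_comm] at this
      exact le_of_mul_le_mul_left this h2
    · have := h1.2
      rw [mul_left_comm] at this
      exact le_of_mul_le_mul_left this h2

/-- Integrating the pointwise comparison of speeds bounds the chart displacement, in the norm frozen
at `p`, by the length of any curve in the ball. With `pathELength_chartSegment_le` it shows that a
chart segment is at most `(1 + ε)²` times as long as such a curve with the same ends. -/
theorem enorm_chartSymmDeriv_sub_le {p : M} {ε r : ℝ} (hε : 0 < ε)
    (hcomp : ∀ u ∈ Metric.ball (extChartAt J p p) r, ∀ w : E,
      ‖chartSymmDeriv J p (extChartAt J p p) w‖ ≤ (1 + ε) * ‖chartSymmDeriv J p u w‖)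
    {α : ℝ → M} {s s' : ℝ} (hs : s < s') (hα : ContMDiffOn 𝓘(ℝ, ℝ) J 1 α (Icc s s'))
    (hsource : ∀ t ∈ Icc s s', α t ∈ (extChartAt J p).source ∧
      extChartAt J p (α t) ∈ Metric.ball (extChartAt J p p) r) :
    ‖chartSymmDeriv J p (extChartAt J p p) (extChartAt J p (α s') - extChartAt J p (α s))‖ₑ
      ≤ ENNReal.ofReal (1 + ε) * pathELength J α s s' := by
  set L := chartSymmDeriv J p (extChartAt J p p) with hL
  let u : ℝ → E := fun t ↦ extChartAt J p (α t)
  have : FiniteDimensional ℝ (TangentSpace J ((extChartAt J p).symm (extChartAt J p p))) :=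
    inferInstanceAs (FiniteDimensional ℝ E)
  rw [map_sub, pathELength_eq_lintegral_mfderiv_Icc, ← lintegral_const_mul' _ _ ENNReal.ofReal_ne_top]
  have hu : ContinuousOn u (Icc s s') :=
    (continuousOn_extChartAt p).comp hα.continuousOn fun t ht ↦ (hsource t ht).1
  refine enorm_sub_le_lintegral (u := fun t ↦ L (u t)) (S := {s, s'}) hs.le
    (L.continuous.comp_continuousOn hu) ((finite_singleton s').insert s) fun t ht ↦ ?_
  have h1 : s < t := lt_of_le_of_ne ht.1.1 fun h ↦ ht.2 (by simp [← h])
  have h2 : t < s' := lt_of_le_of_ne ht.1.2 fun h ↦ ht.2 (by simp [h])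
  have hαt := (hα.contMDiffAt (Icc_mem_nhds h1 h2)).mdifferentiableAt one_ne_zero
  have hut : DifferentiableAt ℝ u t :=
    ((mdifferentiableAt_extChartAt (I := J) (x := p)
      (by rw [← extChartAt_source J]; exact (hsource t ht.1).1)).comp t hαt).differentiableAt
  have h3 : HasDerivAt (fun t ↦ L (u t)) (L (deriv u t)) t :=
    L.hasFDerivAt.comp_hasDerivAt t hut.hasDerivAt
  refine ⟨h3.differentiableAt, ?_⟩
  have h4 : α =ᶠ[𝓝 t] fun s ↦ (extChartAt J p).symm (u s) := by
    filter_upwards [Icc_mem_nhds h1 h2] with x hx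
    exact ((extChartAt J p).left_inv (hsource x hx).1).symm
  have h5 : ‖mfderiv 𝓘(ℝ, ℝ) J α t (1 : ℝ)‖ = ‖chartSymmDeriv J p (u t) (deriv u t)‖ :=
    (norm_mfderiv_congr h4).trans (congrArg norm (mfderiv_extChartAt_symm_comp
      ((extChartAt J p).map_source (hsource t ht.1).1) hut))
  rw [h3.deriv, ← ofReal_norm, ← ofReal_norm]
  refine le_of_le_of_eq ?_
    (congrArg (fun x ↦ ENNReal.ofReal (1 + ε) * ENNReal.ofReal x) h5.symm)
  rw [← ENNReal.ofReal_mul (by positivity)]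
  exact ENNReal.ofReal_le_ofReal (hcomp _ (hsource t ht.1).2 _)

theorem pathELength_chartSegment_le {p : M} {ε r : ℝ} (hε : 0 < ε)
    (hball : Metric.ball (extChartAt J p p) r ⊆ (extChartAt J p).target)
    (hcomp : ∀ u ∈ Metric.ball (extChartAt J p p) r, ∀ w : E,
      ‖chartSymmDeriv J p u w‖ ≤ (1 + ε) * ‖chartSymmDeriv J p (extChartAt J p p) w‖)
    {u₁ u₂ : E} (h₁ : u₁ ∈ Metric.ball (extChartAt J p p) r)
    (h₂ : u₂ ∈ Metric.ball (extChartAt J p p) r) {s s' : ℝ} (hs : s < s') :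
    pathELength J (chartSegment J p u₁ u₂ s s') s s'
      ≤ ENNReal.ofReal (1 + ε) * ‖chartSymmDeriv J p (extChartAt J p p) (u₂ - u₁)‖ₑ := by
  have hs' : 0 < s' - s := sub_pos.2 hs
  have hmem := (contMDiffOn_chartSegment (convex_ball _ _) hball h₁ h₂ hs).2
  set A := ‖chartSymmDeriv J p (extChartAt J p p) (u₂ - u₁)‖ with hA
  have key : ∀ t ∈ Icc s s', ‖mfderiv 𝓘(ℝ, ℝ) J (chartSegment J p u₁ u₂ s s') t (1 : ℝ)‖ₑ
      ≤ ENNReal.ofReal ((1 + ε) * ((s' - s)⁻¹ * A)) := by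
    intro t ht
    have hd : HasDerivAt (fun t : ℝ ↦ u₁ + ((t - s) / (s' - s)) • (u₂ - u₁))
        ((s' - s)⁻¹ • (u₂ - u₁)) t := by
      have h := ((((hasDerivAt_id t).sub_const s).div_const (s' - s)).smul_const
        (u₂ - u₁)).const_add u₁
      simpa using h
    have h1 := mfderiv_extChartAt_symm_comp (J := J) (p := p) (hball (hmem t ht)) hd.differentiableAt
    rw [hd.deriv] at h1
    rw [← ofReal_norm]
    refine ENNReal.ofReal_le_ofReal ?_
    refine (congrArg norm h1).le.trans ((hcomp _ (hmem t ht) _).trans_eq ?_)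
    rw [map_smul, norm_smul, Real.norm_of_nonneg (inv_pos.2 hs').le]
  rw [pathELength_eq_lintegral_mfderiv_Icc]
  refine (setLIntegral_mono' measurableSet_Icc key).trans_eq ?_
  rw [setLIntegral_const, Real.volume_Icc, ← ofReal_norm, ← hA,
    ← ENNReal.ofReal_mul (by positivity), ← ENNReal.ofReal_mul (by positivity)]
  congr 1
  field_simp

end ChartComparison

open MeasureTheory

/-! ### Regularity of chart segments -/

section RegularSegments

variable {B : Type*} [NormedAddCommGroup B] [NormedSpace ℝ B] [FiniteDimensional ℝ B]
  {N : Type*} [TopologicalSpace N] [ChartedSpace B N]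

theorem IsRegularOn.congr {γ γ' : ℝ → N} {a b : ℝ} (h : IsRegularOn (B := B) γ a b)
    (hγ : ∀ t ∈ Icc a b, γ' t = γ t) : IsRegularOn (B := B) γ' a b := by
  refine ⟨h.1.congr hγ, fun t ht h0 ↦ h.2 t ht ?_⟩
  have h1 := mfderivWithin_congr (I := 𝓘(ℝ, ℝ)) (I' := 𝓘(ℝ, B)) hγ (hγ t ht)
  have h2 := congrArg (fun L : ℝ →L[ℝ] B ↦ L 1) h1
  exact h2.symm.trans h0

variable [IsManifold 𝓘(ℝ, B) ∞ N]

theorem isRegularOn_chartSegment {q : N} {C : Set B} (hC : Convex ℝ C)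
    (hCt : C ⊆ (extChartAt 𝓘(ℝ, B) q).target) {u₁ u₂ : B} (h₁ : u₁ ∈ C) (h₂ : u₂ ∈ C)
    (hne : u₁ ≠ u₂) {s s' : ℝ} (hs : s < s') :
    IsRegularOn (B := B) (chartSegment 𝓘(ℝ, B) q u₁ u₂ s s') s s' := by
  have h := contMDiffOn_chartSegment hC hCt h₁ h₂ hs
  refine ⟨h.1, fun t ht ↦ ?_⟩
  have hs' : 0 < s' - s := sub_pos.2 hs
  have hd : HasDerivAt (fun t : ℝ ↦ u₁ + ((t - s) / (s' - s)) • (u₂ - u₁))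
      ((s' - s)⁻¹ • (u₂ - u₁)) t := by
    have h := ((((hasDerivAt_id t).sub_const s).div_const (s' - s)).smul_const
      (u₂ - u₁)).const_add u₁
    simpa using h
  have ht' := hCt (h.2 t ht)
  have h1 := mfderiv_extChartAt_symm_comp (J := 𝓘(ℝ, B)) (p := q) ht' hd.differentiableAt
  have hmd : MDifferentiableAt 𝓘(ℝ, ℝ) 𝓘(ℝ, B) (chartSegment 𝓘(ℝ, B) q u₁ u₂ s s') t :=
    MDifferentiableAt.comp t (g := (extChartAt 𝓘(ℝ, B) q).symm)
      (mdifferentiableAt_extChartAt_symm ht') hd.differentiableAt.mdifferentiableAt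
  rw [mfderivWithin_eq_mfderiv (uniqueMDiffWithinAt_iff_uniqueDiffWithinAt.2
    (uniqueDiffOn_Icc hs t ht)) hmd]
  intro h0
  have h2 := h1.symm.trans h0
  rw [hd.deriv] at h2
  have h3 : (s' - s)⁻¹ • (u₂ - u₁) = 0 :=
    chartSymmDeriv_injective ht' (h2.trans (map_zero _).symm)
  rcases smul_eq_zero.1 h3 with h4 | h4
  · exact (inv_pos.2 hs').ne' h4
  · exact hne (sub_eq_zero.1 h4).symm

end RegularSegments

/-! ### Approximation by curves with piecewise regular projection -/

section Joined

variable {B : Type*} [NormedAddCommGroup B] [NormedSpace ℝ B] [FiniteDimensional ℝ B] [Nontrivial B]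
  {N : Type*} [TopologicalSpace N] [ChartedSpace B N] [IsManifold 𝓘(ℝ, B) ∞ N]
  {F : Type*} [NormedAddCommGroup F] [NormedSpace ℝ F] [FiniteDimensional ℝ F]
  {V : N → Type*} [TopologicalSpace (TotalSpace F V)]
  [∀ x, NormedAddCommGroup (V x)] [∀ x, InnerProductSpace ℝ (V x)]
  [FiberBundle F V] [VectorBundle ℝ F V] [ContMDiffVectorBundle ∞ F V 𝓘(ℝ, B)]

/-- Piecewise `C^1` curves in the total space with piecewise regular projection. -/
def IsNiceOn (β : ℝ → TotalSpace F V) (a b : ℝ) : Prop :=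
  PiecewiseOn (fun s s' ↦ ContMDiffOn 𝓘(ℝ, ℝ) (𝓘(ℝ, B).prod 𝓘(ℝ, F)) 1 β (Icc s s') ∧
    IsRegularOn (B := B) (fun t ↦ (β t).proj) s s') a b

theorem IsNiceOn.congr {β β' : ℝ → TotalSpace F V} {a b : ℝ} (h : IsNiceOn (B := B) β a b)
    (hβ : ∀ t ∈ Icc a b, β' t = β t) : IsNiceOn (B := B) β' a b := by
  refine h.mono fun s s' h1 _ h3 h ↦ ?_
  have hβ' : ∀ t ∈ Icc s s', β' t = β t := fun t ht ↦ hβ t ⟨h1.trans ht.1, ht.2.trans h3⟩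
  exact ⟨h.1.congr hβ', h.2.congr fun t ht ↦ by rw [hβ' t ht]⟩

/-- The preferred charts of the total space are bundle charts, so a chart segment projects to a
chart segment of `N`, which is regular once its end points have different base coordinates. -/
theorem proj_extChartAt_symm {p : TotalSpace F V} {u : B × F}
    (hu : u ∈ (extChartAt (𝓘(ℝ, B).prod 𝓘(ℝ, F)) p).target) :
    u.1 ∈ (extChartAt 𝓘(ℝ, B) p.proj).target ∧
    ((extChartAt (𝓘(ℝ, B).prod 𝓘(ℝ, F)) p).symm u).proj
      = (extChartAt 𝓘(ℝ, B) p.proj).symm u.1 := by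
  rw [FiberBundle.extChartAt_target] at hu
  refine ⟨hu.1.1, ?_⟩
  rw [FiberBundle.extChartAt]
  exact Trivialization.proj_symm_apply' _ hu.1.2

theorem isNiceOn_chartSegment {p : TotalSpace F V} {C : Set (B × F)} (hC : Convex ℝ C)
    (hCt : C ⊆ (extChartAt (𝓘(ℝ, B).prod 𝓘(ℝ, F)) p).target) {u₁ u₂ : B × F} (h₁ : u₁ ∈ C)
    (h₂ : u₂ ∈ C) (hne : u₁.1 ≠ u₂.1) {s s' : ℝ} (hs : s < s') :
    IsNiceOn (B := B) (chartSegment (𝓘(ℝ, B).prod 𝓘(ℝ, F)) p u₁ u₂ s s') s s' := by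
  have h := contMDiffOn_chartSegment hC hCt h₁ h₂ hs
  have hC' : Convex ℝ (Prod.fst '' C) := hC.linear_image (LinearMap.fst ℝ B F)
  have hreg := isRegularOn_chartSegment (q := p.proj) hC'
    (by rintro _ ⟨u, hu, rfl⟩; exact (proj_extChartAt_symm (hCt hu)).1)
    (mem_image_of_mem _ h₁) (mem_image_of_mem _ h₂) hne hs
  have hreg' := hreg.congr (γ' := fun t ↦
    (chartSegment (𝓘(ℝ, B).prod 𝓘(ℝ, F)) p u₁ u₂ s s' t).proj)
    fun t ht ↦ (proj_extChartAt_symm (hCt (h.2 t ht))).2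
  exact .of_forall fun r r' h1 h2 h3 ↦
    ⟨(h.1.of_le (by simp)).mono (Icc_subset_Icc h1 h3), hreg'.mono h1 h2 h3⟩

variable [RiemannianBundle (fun p : TotalSpace F V ↦ TangentSpace (𝓘(ℝ, B).prod 𝓘(ℝ, F)) p)]

variable (B) in
/-- Two points are joined on `[a, b]` by a nice curve of length at most `K`. -/
def NicelyJoined (x y : TotalSpace F V) (a b : ℝ) (K : ℝ≥0∞) : Prop :=
  ∃ β : ℝ → TotalSpace F V, β a = x ∧ β b = y ∧ IsNiceOn (B := B) β a b ∧
    pathELength (𝓘(ℝ, B).prod 𝓘(ℝ, F)) β a b ≤ K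

theorem NicelyJoined.mono {x y : TotalSpace F V} {a b : ℝ} {K K' : ℝ≥0∞}
    (h : NicelyJoined B x y a b K) (hK : K ≤ K') : NicelyJoined B x y a b K' := by
  obtain ⟨β, h1, h2, h3, h4⟩ := h
  exact ⟨β, h1, h2, h3, h4.trans hK⟩

theorem NicelyJoined.trans {x y z : TotalSpace F V} {a b c : ℝ} {K K' : ℝ≥0∞} (hab : a < b)
    (hbc : b < c) (h : NicelyJoined B x y a b K) (h' : NicelyJoined B y z b c K') :
    NicelyJoined B x z a c (K + K') := by
  classical
  obtain ⟨β, h1, h2, h3, h4⟩ := h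
  obtain ⟨β', h1', h2', h3', h4'⟩ := h'
  let k : ℝ → TotalSpace F V := fun t ↦ if t ≤ b then β t else β' t
  have e1 : ∀ t ≤ b, k t = β t := fun t ht ↦ if_pos ht
  have e2 : ∀ t ≥ b, k t = β' t := fun t ht ↦ by
    rcases ht.eq_or_lt with h3 | h3
    · subst h3; rw [e1 _ le_rfl, h2, h1']
    · exact if_neg (not_le.2 h3)
  refine ⟨k, by rw [e1 a hab.le, h1], by rw [e2 c hbc.le, h2'], PiecewiseOn.trans
    (h3.congr fun t ht ↦ e1 t ht.2) (h3'.congr fun t ht ↦ e2 t ht.1), ?_⟩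
  rw [← pathELength_add hab.le hbc.le, pathELength_congr (γ' := β) fun t ht ↦ e1 t ht.2,
    pathELength_congr (γ := k) (γ' := β') fun t ht ↦ e2 t ht.1]
  exact add_le_add h4 h4'

/-- Points in a small chart ball are joined by nice curves that are not much longer than the
chart segment. -/
theorem nicelyJoined_of_mem_ball {p : TotalSpace F V} {ε r : ℝ} (hε : 0 < ε)
    (hball : Metric.ball (extChartAt (𝓘(ℝ, B).prod 𝓘(ℝ, F)) p p) r
      ⊆ (extChartAt (𝓘(ℝ, B).prod 𝓘(ℝ, F)) p).target)
    (hcomp : ∀ u ∈ Metric.ball (extChartAt (𝓘(ℝ, B).prod 𝓘(ℝ, F)) p p) r, ∀ w : B × F,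
      ‖chartSymmDeriv (𝓘(ℝ, B).prod 𝓘(ℝ, F)) p u w‖ ≤ (1 + ε) *
        ‖chartSymmDeriv (𝓘(ℝ, B).prod 𝓘(ℝ, F)) p (extChartAt (𝓘(ℝ, B).prod 𝓘(ℝ, F)) p p) w‖)
    {u₁ u₂ : B × F} (h₁ : u₁ ∈ Metric.ball (extChartAt (𝓘(ℝ, B).prod 𝓘(ℝ, F)) p p) r)
    (h₂ : u₂ ∈ Metric.ball (extChartAt (𝓘(ℝ, B).prod 𝓘(ℝ, F)) p p) r) {s s' : ℝ} (hs : s < s')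
    {η : ℝ} (hη : 0 < η) :
    NicelyJoined B ((extChartAt (𝓘(ℝ, B).prod 𝓘(ℝ, F)) p).symm u₁)
      ((extChartAt (𝓘(ℝ, B).prod 𝓘(ℝ, F)) p).symm u₂) s s'
      (ENNReal.ofReal (1 + ε) * ‖chartSymmDeriv (𝓘(ℝ, B).prod 𝓘(ℝ, F)) p
        (extChartAt (𝓘(ℝ, B).prod 𝓘(ℝ, F)) p p) (u₂ - u₁)‖ₑ + ENNReal.ofReal η) := by
  set L := chartSymmDeriv (𝓘(ℝ, B).prod 𝓘(ℝ, F)) p (extChartAt (𝓘(ℝ, B).prod 𝓘(ℝ, F)) p p) with hL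
  have hseg : ∀ {v₁ v₂ : B × F}, v₁ ∈ Metric.ball (extChartAt (𝓘(ℝ, B).prod 𝓘(ℝ, F)) p p) r →
      v₂ ∈ Metric.ball (extChartAt (𝓘(ℝ, B).prod 𝓘(ℝ, F)) p p) r → v₁.1 ≠ v₂.1 → ∀ {a b : ℝ}, a < b →
      NicelyJoined B ((extChartAt (𝓘(ℝ, B).prod 𝓘(ℝ, F)) p).symm v₁) ((extChartAt (𝓘(ℝ, B).prod 𝓘(ℝ, F)) p).symm v₂) a b
        (ENNReal.ofReal (1 + ε) * ‖L (v₂ - v₁)‖ₑ) := by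
    intro v₁ v₂ hv₁ hv₂ hne a b hab
    exact ⟨chartSegment (𝓘(ℝ, B).prod 𝓘(ℝ, F)) p v₁ v₂ a b, chartSegment_left _ _ _ _ _, chartSegment_right _ _ _ hab,
      isNiceOn_chartSegment (convex_ball _ _) hball hv₁ hv₂ hne hab,
      pathELength_chartSegment_le hε hball hcomp hv₁ hv₂ hab⟩
  by_cases hne : u₁.1 = u₂.1
  swap
  · exact (hseg h₁ h₂ hne hs).mono le_self_add
  obtain ⟨v, hv⟩ := exists_ne (0 : B)
  -- A segment with `u₁.1 = u₂.1` projects to a point. It is replaced by two segments through a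
  -- midpoint pushed sideways by `δ`, at an extra cost of at most `2 (1 + ε) δ K`.
  let m : ℝ → B × F := fun δ ↦ u₁ + (1 / 2 : ℝ) • (u₂ - u₁) + δ • (v, 0)
  set K := ‖L (v, 0)‖ with hK
  have hm : Continuous m := by fun_prop
  have hm0 : m 0 ∈ Metric.ball (extChartAt (𝓘(ℝ, B).prod 𝓘(ℝ, F)) p p) r := by
    simp only [m, zero_smul, add_zero]
    exact (convex_ball _ _).add_smul_sub_mem h₁ h₂ ⟨by norm_num, by norm_num⟩
  have hev : ∀ᶠ δ in 𝓝[>] (0 : ℝ), m δ ∈ Metric.ball (extChartAt (𝓘(ℝ, B).prod 𝓘(ℝ, F)) p p) r ∧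
      2 * ((1 + ε) * (δ * K)) < η := by
    refine Filter.Eventually.filter_mono nhdsWithin_le_nhds (Filter.Eventually.and
      (hm.continuousAt.preimage_mem_nhds (Metric.isOpen_ball.mem_nhds hm0)) ?_)
    have : ContinuousAt (fun δ : ℝ ↦ 2 * ((1 + ε) * (δ * K))) 0 := by fun_prop
    exact this.eventually_lt continuousAt_const (by simpa using hη)
  obtain ⟨δ, ⟨hδm, hδη⟩, hδ⟩ := (hev.and self_mem_nhdsWithin).exists
  have hδ0 : 0 < δ := hδ
  have e1 : m δ - u₁ = (1 / 2 : ℝ) • (u₂ - u₁) + δ • (v, 0) := by simp only [m]; abel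
  have e2 : u₂ - m δ = (1 / 2 : ℝ) • (u₂ - u₁) - δ • (v, 0) := by simp only [m]; module
  have hb1 : u₁.1 ≠ (m δ).1 := fun h ↦ by
    have := congrArg Prod.fst e1
    simp only [← h, hne, Prod.fst_sub, Prod.fst_add, Prod.smul_fst, sub_self, smul_zero,
      zero_add] at this
    exact smul_ne_zero hδ0.ne' hv this.symm
  have hb2 : (m δ).1 ≠ u₂.1 := fun h ↦ hb1 (hne.trans h.symm)
  have n1 : ‖L (m δ - u₁)‖ ≤ 1 / 2 * ‖L (u₂ - u₁)‖ + δ * K := by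
    rw [e1, map_add, map_smul, map_smul]
    refine (norm_add_le _ _).trans_eq ?_
    rw [norm_smul, norm_smul, Real.norm_of_nonneg hδ0.le, Real.norm_of_nonneg (by norm_num)]
  have n2 : ‖L (u₂ - m δ)‖ ≤ 1 / 2 * ‖L (u₂ - u₁)‖ + δ * K := by
    rw [e2, map_sub, map_smul, map_smul]
    refine (norm_sub_le _ _).trans_eq ?_
    rw [norm_smul, norm_smul, Real.norm_of_nonneg hδ0.le, Real.norm_of_nonneg (by norm_num)]
  have hmid : s < (s + s') / 2 := by linarith
  have hmid' : (s + s') / 2 < s' := by linarith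
  refine (NicelyJoined.trans hmid hmid' (hseg h₁ hδm hb1 hmid) (hseg hδm h₂ hb2 hmid')).mono ?_
  have hK0 : 0 ≤ K := norm_nonneg _
  rw [← ofReal_norm, ← ofReal_norm, ← ofReal_norm, ← ENNReal.ofReal_mul (by positivity),
    ← ENNReal.ofReal_mul (by positivity), ← ENNReal.ofReal_mul (by positivity),
    ← ENNReal.ofReal_add (by positivity) (by positivity),
    ← ENNReal.ofReal_add (by positivity) hη.le]
  refine ENNReal.ofReal_le_ofReal ?_
  have h3 : (1 + ε) * ‖L (m δ - u₁)‖ ≤ (1 + ε) * (1 / 2 * ‖L (u₂ - u₁)‖ + δ * K) := by gcongr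
  have h4 : (1 + ε) * ‖L (u₂ - m δ)‖ ≤ (1 + ε) * (1 / 2 * ‖L (u₂ - u₁)‖ + δ * K) := by gcongr
  linarith

/-- `C^1` curves in the total space are approximated by nice curves. -/
theorem nicelyJoined_of_contMDiffOn
    (hN : Continuous fun v : TangentBundle (𝓘(ℝ, B).prod 𝓘(ℝ, F)) (TotalSpace F V) ↦ ‖v.2‖)
    {α : ℝ → TotalSpace F V} {a b : ℝ} (hab : a < b)
    (hα : ContMDiffOn 𝓘(ℝ, ℝ) (𝓘(ℝ, B).prod 𝓘(ℝ, F)) 1 α (Icc a b)) {ε : ℝ} (hε : 0 < ε)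
    {η : ℝ} (hη : 0 < η) :
    NicelyJoined B (α a) (α b) a b (ENNReal.ofReal ((1 + ε) ^ 2) *
      pathELength (𝓘(ℝ, B).prod 𝓘(ℝ, F)) α a b + ENNReal.ofReal η) := by
  -- Quantifying over `η` makes the relation transitive, as each half of a curve can be given `η /
  -- 2`.
  suffices h : ∀ η > 0, NicelyJoined B (α a) (α b) a b (ENNReal.ofReal ((1 + ε) ^ 2) *
      pathELength (𝓘(ℝ, B).prod 𝓘(ℝ, F)) α a b + ENNReal.ofReal η) from h η hη
  refine rel_of_local (R := fun s s' ↦ ∀ η > 0, NicelyJoined B (α s) (α s') s s'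
    (ENNReal.ofReal ((1 + ε) ^ 2) * pathELength (𝓘(ℝ, B).prod 𝓘(ℝ, F)) α s s' + ENNReal.ofReal η)) hab ?_ ?_
  · intro s t u _ h1 h2 _ h3 h4 η hη
    refine (NicelyJoined.trans h1 h2 (h3 (η / 2) (by positivity)) (h4 (η / 2) (by positivity))).mono
      (le_of_eq ?_)
    rw [add_add_add_comm, ← mul_add, pathELength_add h1.le h2.le,
      ← ENNReal.ofReal_add (by positivity) (by positivity), add_halves]
  · intro t ht
    obtain ⟨r, hr, hball, hcomp⟩ := exists_chart_norm_comparison hN (α t) hε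
    have hU : ∀ᶠ x in 𝓝 (α t), x ∈ (extChartAt (𝓘(ℝ, B).prod 𝓘(ℝ, F)) (α t)).source ∧
        extChartAt (𝓘(ℝ, B).prod 𝓘(ℝ, F)) (α t) x ∈ Metric.ball (extChartAt (𝓘(ℝ, B).prod 𝓘(ℝ, F)) (α t) (α t)) r :=
      Filter.Eventually.and (extChartAt_source_mem_nhds (I := 𝓘(ℝ, B).prod 𝓘(ℝ, F)) (α t))
        ((continuousAt_extChartAt (I := 𝓘(ℝ, B).prod 𝓘(ℝ, F)) (α t)).preimage_mem_nhds (Metric.ball_mem_nhds _ hr))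
    obtain ⟨δ, hδ, hsub⟩ := Metric.mem_nhdsWithin_iff.1
      ((hα.continuousOn t ht).eventually hU)
    refine ⟨δ, hδ, fun s s' h1 h2 h3 h4 h5 η hη ↦ ?_⟩
    have hgood : ∀ x ∈ Icc s s', α x ∈ (extChartAt (𝓘(ℝ, B).prod 𝓘(ℝ, F)) (α t)).source ∧
        extChartAt (𝓘(ℝ, B).prod 𝓘(ℝ, F)) (α t) (α x) ∈ Metric.ball (extChartAt (𝓘(ℝ, B).prod 𝓘(ℝ, F)) (α t) (α t)) r := fun x hx ↦ by
      refine hsub ⟨?_, h1.trans hx.1, hx.2.trans h3⟩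
      rw [Metric.mem_ball, Real.dist_eq, abs_lt]
      constructor <;> linarith [hx.1, hx.2]
    have h6 := enorm_chartSymmDeriv_sub_le hε (fun u hu w ↦ (hcomp u hu w).2) h2
      (hα.mono (Icc_subset_Icc h1 h3)) hgood
    have hs := hgood s (left_mem_Icc.2 h2.le)
    have hs' := hgood s' (right_mem_Icc.2 h2.le)
    have h7 := nicelyJoined_of_mem_ball hε hball (fun u hu w ↦ (hcomp u hu w).1) hs.2 hs'.2 h2 hη
    rw [(extChartAt (𝓘(ℝ, B).prod 𝓘(ℝ, F)) (α t)).left_inv hs.1, (extChartAt (𝓘(ℝ, B).prod 𝓘(ℝ, F)) (α t)).left_inv hs'.1] at h7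
    refine h7.mono ?_
    rw [sq, ENNReal.ofReal_mul (by positivity), mul_assoc]
    gcongr

end Joined

open MeasureTheory

/-! ### Lower bound and existence of piecewise regular curves -/

section LowerBound

variable {B : Type*} [NormedAddCommGroup B] [NormedSpace ℝ B] [FiniteDimensional ℝ B] [Nontrivial B]
  {N : Type*} [TopologicalSpace N] [T2Space N] [ChartedSpace B N] [IsManifold 𝓘(ℝ, B) ∞ N]
  [RiemannianBundle (fun x : N ↦ TangentSpace 𝓘(ℝ, B) x)]
  [IsContMDiffRiemannianBundle 𝓘(ℝ, B) ∞ B (fun x : N ↦ TangentSpace 𝓘(ℝ, B) x)]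
  {F : Type*} [NormedAddCommGroup F] [NormedSpace ℝ F] [FiniteDimensional ℝ F]
  {V : N → Type*} [TopologicalSpace (TotalSpace F V)]
  [∀ x, NormedAddCommGroup (V x)] [∀ x, InnerProductSpace ℝ (V x)]
  [FiberBundle F V] [VectorBundle ℝ F V] [ContMDiffVectorBundle ∞ F V 𝓘(ℝ, B)]
  [IsContMDiffRiemannianBundle 𝓘(ℝ, B) ∞ F V]

theorem continuous_sasaki_norm {cov : CovariantDerivative 𝓘(ℝ, B) F V}
    (hcov : cov.ContMDiffCovariantDerivative ∞) :
    letI := sasakiBundle cov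
    Continuous fun v : TangentBundle (𝓘(ℝ, B).prod 𝓘(ℝ, F)) (TotalSpace F V) ↦ ‖v.2‖ := by
  let _ := sasakiBundle cov
  refine (continuous_inner_dproj_add_inner_connector hcov).sqrt.congr fun v ↦ ?_
  have h := sasaki_norm_sq cov v.proj v.2
  rw [real_inner_self_eq_norm_sq, real_inner_self_eq_norm_sq]
  exact (congrArg Real.sqrt h).symm.trans (Real.sqrt_sq (norm_nonneg _))

/-- The lower bound for the length of nice curves. -/
theorem IsNiceOn.sq_add_sq_le_pathELength_sq {cov : CovariantDerivative 𝓘(ℝ, B) F V}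
    (hcov : cov.ContMDiffCovariantDerivative ∞) (hmetric : cov.IsMetricCompatible)
    {β : ℝ → TotalSpace F V} (hβ : IsNiceOn (B := B) β 0 1) :
    letI := sasakiBundle cov
    IsPiecewiseRegular 𝓘(ℝ, B) (fun t ↦ (β t).proj) ∧
    ‖(β 0).2 - parallelTransport cov (fun t ↦ (β t).proj) (q₁ := (β 0).proj) (q₂ := (β 1).proj)
      (β 1).2‖ₑ ^ 2 + pathELength 𝓘(ℝ, B) (fun t ↦ (β t).proj) 0 1 ^ 2
      ≤ pathELength (𝓘(ℝ, B).prod 𝓘(ℝ, F)) β 0 1 ^ 2 := by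
  let _ := sasakiBundle cov
  set γ : ℝ → N := fun t ↦ (β t).proj with hγ
  let f : ∀ t, V (γ t) := fun t ↦ (β t).2
  have hreg : PiecewiseOn (IsRegularOn (B := B) γ) 0 1 := hβ.mono fun _ _ _ _ _ h ↦ h.2
  refine ⟨isPiecewiseRegular_iff.2 hreg, ?_⟩
  have hβ1 : PiecewiseOn (fun s s' ↦ ContMDiffOn 𝓘(ℝ, ℝ) (𝓘(ℝ, B).prod 𝓘(ℝ, F)) 1 β (Icc s s'))
    0 1 := hβ.mono fun _ _ _ _ _ h ↦ h.1
  have hγ1 : PiecewiseOn (fun s s' ↦ ContMDiffOn 𝓘(ℝ, ℝ) 𝓘(ℝ, B) 1 γ (Icc s s')) 0 1 :=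
    hreg.mono fun _ _ _ _ _ h ↦ h.1.of_le (by simp)
  obtain ⟨X, hX1, hX⟩ := (exists_isParallelSection (V := V) hcov one_pos hγ1).2 (f 1)
  have hP := parallelTransport_eq hmetric hX
  rw [hX1] at hP
  have hβc : ContinuousOn β (Icc 0 1) :=
    PiecewiseOn.continuousOn (hβ1.mono fun _ _ _ _ _ h ↦ h.continuousOn) one_pos
  obtain ⟨S, hS, hd⟩ := exists_finite_mdifferentiableAt hβ1
  obtain ⟨T, hT, hXd⟩ := hX.exists_finite
  have h1 := enorm_sub_le_of_parallel (f := f) (g := X) hmetric zero_le_one hβc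
    (hX.continuousOn one_pos) hS hT hd hXd hX1.symm
  have h2 : ‖(β 0).2 - parallelTransport cov γ (q₁ := (β 0).proj) (q₂ := (β 1).proj)
      (β 1).2‖ₑ ≤ ∫⁻ t in Icc (0 : ℝ) 1, ‖covDerivAlong cov β t‖ₑ := by
    refine le_of_eq_of_le ?_ h1
    exact congrArg (fun w : V (γ 0) ↦ ‖f 0 - w‖ₑ) hP
  refine (add_le_add_left (pow_le_pow_left' h2 2) _).trans ?_
  rw [pathELength_eq_lintegral_mfderiv_Icc, pathELength_eq_lintegral_mfderiv_Icc]
  -- Minkowski's inequality for the vertical and horizontal speeds, whose squares add up to the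
  -- squared Sasaki speed off finitely many times.
  refine sq_lintegral_add_sq_lintegral_le _ _ _ _ ?_
  filter_upwards [ae_restrict_mem measurableSet_Icc,
    measure_eq_zero_iff_ae_notMem.1 (hS.measure_zero (volume.restrict (Icc (0 : ℝ) 1)))]
    with t ht ht'
  have h3 := sasaki_enorm_sq cov (β t)
    (mfderiv 𝓘(ℝ, ℝ) (𝓘(ℝ, B).prod 𝓘(ℝ, F)) β t (1 : ℝ))
  have h4 := dproj_mfderiv_curve (hd t ⟨ht, ht'⟩)
  refine le_of_eq (Eq.trans ?_ h3.symm)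
  rw [add_comm]
  exact congrArg (fun w : TangentSpace 𝓘(ℝ, B) (γ t) ↦ ‖w‖ₑ ^ 2 + ‖covDerivAlong cov β t‖ₑ ^ 2)
    h4.symm

theorem exists_nice_of_sasakiEDist_lt {cov : CovariantDerivative 𝓘(ℝ, B) F V}
    (hcov : cov.ContMDiffCovariantDerivative ∞) {x y : TotalSpace F V} {r : ℝ≥0∞}
    (h : sasakiEDist cov x y < r) :
    letI := sasakiBundle cov
    ∃ β : ℝ → TotalSpace F V, β 0 = x ∧ β 1 = y ∧ IsNiceOn (B := B) β 0 1 ∧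
      pathELength (𝓘(ℝ, B).prod 𝓘(ℝ, F)) β 0 1 ≤ r := by
  let _ := sasakiBundle cov
  have h' : riemannianEDist (𝓘(ℝ, B).prod 𝓘(ℝ, F)) x y < r := h
  obtain ⟨α, h0, h1, hα, hlen⟩ := exists_lt_of_riemannianEDist_lt h'
  set l := pathELength (𝓘(ℝ, B).prod 𝓘(ℝ, F)) α 0 1 with hl
  have hltop : l ≠ ⊤ := hlen.ne_top
  -- As `l` is finite and `l < r`, the loss in the approximation fits below `r` for small `ε`.
  have htend : Filter.Tendsto (fun ε : ℝ ↦ ENNReal.ofReal ((1 + ε) ^ 2) * l + ENNReal.ofReal ε)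
      (𝓝[>] 0) (𝓝 (ENNReal.ofReal ((1 + 0) ^ 2) * l + ENNReal.ofReal 0)) := by
    refine Filter.Tendsto.mono_left ?_ nhdsWithin_le_nhds
    refine Filter.Tendsto.add (ENNReal.Tendsto.mul_const (ENNReal.tendsto_ofReal ?_) (.inr hltop))
      (ENNReal.tendsto_ofReal Filter.tendsto_id)
    exact Continuous.tendsto (by fun_prop) _
  simp only [add_zero, one_pow, ENNReal.ofReal_one, one_mul, ENNReal.ofReal_zero] at htend
  obtain ⟨ε, hε, hε0⟩ := ((htend.eventually_lt_const hlen).and self_mem_nhdsWithin).exists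
  have hε0' : 0 < ε := hε0
  obtain ⟨β, hb0, hb1, hβ, hβl⟩ := nicelyJoined_of_contMDiffOn (continuous_sasaki_norm hcov)
    one_pos hα hε0' hε0'
  exact ⟨β, hb0.trans h0, hb1.trans h1, hβ, hβl.trans hε.le⟩

theorem exists_isPiecewiseRegular_of_sasakiEDist_lt {cov : CovariantDerivative 𝓘(ℝ, B) F V}
    (hcov : cov.ContMDiffCovariantDerivative ∞) (hmetric : cov.IsMetricCompatible)
    {x y : TotalSpace F V} {r : ℝ≥0∞} (h : sasakiEDist cov x y < r) :
    ∃ γ : ℝ → N, IsPiecewiseRegular 𝓘(ℝ, B) γ ∧ γ 0 = x.proj ∧ γ 1 = y.proj ∧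
      ‖x.2 - parallelTransport cov γ y.2‖ₑ ^ 2 + pathELength 𝓘(ℝ, B) γ 0 1 ^ 2 ≤ r ^ 2 := by
  obtain ⟨β, rfl, rfl, hβ, hlen⟩ := exists_nice_of_sasakiEDist_lt hcov h
  obtain ⟨hreg, hle⟩ := hβ.sq_add_sq_le_pathELength_sq hcov hmetric
  exact ⟨_, hreg, rfl, rfl, hle.trans (pow_le_pow_left' hlen 2)⟩

/-- Points of a connected manifold are joined by piecewise regular curves. -/
theorem exists_isPiecewiseRegular [ConnectedSpace N] {cov : CovariantDerivative 𝓘(ℝ, B) F V}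
    (hcov : cov.ContMDiffCovariantDerivative ∞) (x y : N) :
    ∃ γ : ℝ → N, IsPiecewiseRegular 𝓘(ℝ, B) γ ∧ γ 0 = x ∧ γ 1 = y := by
  let _ := sasakiBundle cov
  -- Allowing every parameter interval makes concatenation possible without reparametrization.
  let P : N → N → Prop := fun x y ↦ ∀ a b : ℝ, a < b → ∃ γ : ℝ → N, γ a = x ∧ γ b = y ∧
    PiecewiseOn (IsRegularOn (B := B) γ) a b
  have hP : P x y := by
    refine PreconnectedSpace.induction₂' P (fun x ↦ ?_) ?_ x y
    -- The zero section lifts the local problem to a chart ball of the total space, where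
    -- `nicelyJoined_of_mem_ball` provides curves with regular projection, even for equal end
    -- points.
    · let z : N → TotalSpace F V := zeroSection F V
      have hz : Continuous z := (contMDiff_zeroSection (n := 0) (IB := 𝓘(ℝ, B)) ℝ V).continuous
      obtain ⟨r, hr, hball, hcomp⟩ :=
        exists_chart_norm_comparison (continuous_sasaki_norm hcov) (z x) one_pos
      have hU : ∀ᶠ w in 𝓝 (z x), w ∈ (extChartAt (𝓘(ℝ, B).prod 𝓘(ℝ, F)) (z x)).source ∧
          extChartAt (𝓘(ℝ, B).prod 𝓘(ℝ, F)) (z x) w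
            ∈ Metric.ball (extChartAt (𝓘(ℝ, B).prod 𝓘(ℝ, F)) (z x) (z x)) r :=
        Filter.Eventually.and (extChartAt_source_mem_nhds (I := 𝓘(ℝ, B).prod 𝓘(ℝ, F)) (z x))
          ((continuousAt_extChartAt (I := 𝓘(ℝ, B).prod 𝓘(ℝ, F)) (z x)).preimage_mem_nhds
            (Metric.ball_mem_nhds _ hr))
      have hjoin : ∀ v w, z v ∈ (extChartAt (𝓘(ℝ, B).prod 𝓘(ℝ, F)) (z x)).source ∧
          extChartAt (𝓘(ℝ, B).prod 𝓘(ℝ, F)) (z x) (z v)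
            ∈ Metric.ball (extChartAt (𝓘(ℝ, B).prod 𝓘(ℝ, F)) (z x) (z x)) r →
          z w ∈ (extChartAt (𝓘(ℝ, B).prod 𝓘(ℝ, F)) (z x)).source ∧
          extChartAt (𝓘(ℝ, B).prod 𝓘(ℝ, F)) (z x) (z w)
            ∈ Metric.ball (extChartAt (𝓘(ℝ, B).prod 𝓘(ℝ, F)) (z x) (z x)) r → P v w := by
        intro v w hv hw a b hab
        obtain ⟨β, h0, h1, hβ, -⟩ := nicelyJoined_of_mem_ball one_pos hball
          (fun u hu w ↦ (hcomp u hu w).1) hv.2 hw.2 hab one_pos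
        rw [(extChartAt (𝓘(ℝ, B).prod 𝓘(ℝ, F)) (z x)).left_inv hv.1] at h0
        rw [(extChartAt (𝓘(ℝ, B).prod 𝓘(ℝ, F)) (z x)).left_inv hw.1] at h1
        exact ⟨fun t ↦ (β t).proj, congrArg TotalSpace.proj h0, congrArg TotalSpace.proj h1,
          hβ.mono fun _ _ _ _ _ h ↦ h.2⟩
      have hx := hU.self_of_nhds
      filter_upwards [hz.continuousAt.eventually hU] with w hw
      exact ⟨hjoin x w hx hw, hjoin w x hw hx⟩
    · constructor
      intro u v w huv hvw a b hab
      classical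
      have h1 : a < (a + b) / 2 := by linarith
      have h2 : (a + b) / 2 < b := by linarith
      obtain ⟨γ, g0, g1, hγ⟩ := huv a _ h1
      obtain ⟨γ', g0', g1', hγ'⟩ := hvw _ b h2
      let k : ℝ → N := fun t ↦ if t ≤ (a + b) / 2 then γ t else γ' t
      have e1 : ∀ t ≤ (a + b) / 2, k t = γ t := fun t ht ↦ if_pos ht
      have e2 : ∀ t ≥ (a + b) / 2, k t = γ' t := fun t ht ↦ by
        rcases ht.eq_or_lt with h3 | h3
        · rw [← h3, e1 _ le_rfl, g1, g0']
        · exact if_neg (not_le.2 h3)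
      refine ⟨k, by rw [e1 a h1.le, g0], by rw [e2 b h2.le, g1'], PiecewiseOn.trans
        (hγ.mono fun s s' _ _ h3 h ↦ h.congr fun t ht ↦ e1 t (ht.2.trans h3))
        (hγ'.mono fun s s' h3 _ _ h ↦ h.congr fun t ht ↦ e2 t (h3.trans ht.1))⟩
  obtain ⟨γ, h0, h1, hγ⟩ := hP 0 1 one_pos
  exact ⟨γ, isPiecewiseRegular_iff.2 hγ, h0, h1⟩

end LowerBound

end Sasaki

end

/-! ### The distance formula -/

theorem proposition2p1
    -- `N` is a connected smooth manifold of positive finite dimension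
    {B : Type*} [NormedAddCommGroup B] [NormedSpace ℝ B] [FiniteDimensional ℝ B] [Nontrivial B]
    {N : Type*} [TopologicalSpace N] [T2Space N] [SecondCountableTopology N]
    [ChartedSpace B N] [IsManifold 𝓘(ℝ, B) ∞ N] [ConnectedSpace N]
    -- with a smooth Riemannian metric `h`
    [RiemannianBundle (fun x : N ↦ TangentSpace 𝓘(ℝ, B) x)]
    [IsContMDiffRiemannianBundle 𝓘(ℝ, B) ∞ B (fun x : N ↦ TangentSpace 𝓘(ℝ, B) x)]
    -- `V` is a smooth real vector bundle of finite rank over `N` with a smooth bundle metric `κ`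
    {F : Type*} [NormedAddCommGroup F] [NormedSpace ℝ F] [FiniteDimensional ℝ F]
    {V : N → Type*} [TopologicalSpace (TotalSpace F V)]
    [∀ x, NormedAddCommGroup (V x)] [∀ x, InnerProductSpace ℝ (V x)]
    [FiberBundle F V] [VectorBundle ℝ F V] [ContMDiffVectorBundle ∞ F V 𝓘(ℝ, B)]
    [IsContMDiffRiemannianBundle 𝓘(ℝ, B) ∞ F V]
    -- `cov` is a smooth metric connection on `V`
    (cov : CovariantDerivative 𝓘(ℝ, B) F V) (hcov : cov.ContMDiffCovariantDerivative ∞)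
    (hmetric : cov.IsMetricCompatible)
    (q₁ q₂ : N) (e₁ : V q₁) (e₂ : V q₂) :
    Sasaki.sasakiEDist cov ⟨q₁, e₁⟩ ⟨q₂, e₂⟩ ≠ ⊤ ∧
    Sasaki.sasakiEDist cov ⟨q₁, e₁⟩ ⟨q₂, e₂⟩ ^ 2 =
      ⨅ (γ : ℝ → N) (_ : Sasaki.IsPiecewiseRegular 𝓘(ℝ, B) γ ∧ γ 0 = q₁ ∧ γ 1 = q₂),
        (‖e₁ - Sasaki.parallelTransport cov γ e₂‖ₑ ^ 2 + pathELength 𝓘(ℝ, B) γ 0 1 ^ 2) := by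
  have hfin : Sasaki.sasakiEDist cov ⟨q₁, e₁⟩ ⟨q₂, e₂⟩ ≠ ⊤ := by
    obtain ⟨γ, hγ, rfl, rfl⟩ := Sasaki.exists_isPiecewiseRegular hcov q₁ q₂
    exact (Sasaki.sasakiEDist_sq_le hcov hmetric hγ e₁ e₂).1
  refine ⟨hfin, le_antisymm ?_ ?_⟩
  · refine le_iInf₂ fun γ hγ ↦ ?_
    obtain ⟨hγ, rfl, rfl⟩ := hγ
    exact (Sasaki.sasakiEDist_sq_le hcov hmetric hγ e₁ e₂).2
  · set X := ⨅ (γ : ℝ → N) (_ : Sasaki.IsPiecewiseRegular 𝓘(ℝ, B) γ ∧ γ 0 = q₁ ∧ γ 1 = q₂),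
      (‖e₁ - Sasaki.parallelTransport cov γ e₂‖ₑ ^ 2 + pathELength 𝓘(ℝ, B) γ 0 1 ^ 2) with hX
    have key : ∀ r > Sasaki.sasakiEDist cov ⟨q₁, e₁⟩ ⟨q₂, e₂⟩, X ≤ r ^ 2 := by
      intro r hr
      obtain ⟨γ, hγ, h0, h1, hle⟩ := Sasaki.exists_isPiecewiseRegular_of_sasakiEDist_lt hcov hmetric
        (x := ⟨q₁, e₁⟩) (y := ⟨q₂, e₂⟩) hr
      exact (iInf₂_le γ ⟨hγ, h0, h1⟩).trans hle
    by_contra! hlt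
    -- Continuity of squaring would give some `r` above the distance with `r ^ 2 < X`, against
    -- `key`; finiteness of the distance guarantees that there are larger `r`.
    have h3 : ∀ᶠ r in 𝓝[>] (Sasaki.sasakiEDist cov ⟨q₁, e₁⟩ ⟨q₂, e₂⟩), r ^ 2 < X :=
      nhdsWithin_le_nhds (((ENNReal.continuous_pow 2).tendsto _).eventually_lt_const hlt)
    have : (𝓝[>] (Sasaki.sasakiEDist cov ⟨q₁, e₁⟩ ⟨q₂, e₂⟩)).NeBot :=
      nhdsGT_neBot_of_exists_gt ⟨⊤, lt_top_iff_ne_top.2 hfin⟩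
    obtain ⟨r, hr, hr'⟩ := (h3.and self_mem_nhdsWithin).exists
    exact (key r hr').not_gt hr
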